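/- Work in the group $G=\mathbb Z_9\times\mathbb Z_9$ of order $81$. A $(81,5,1)$ difference family in $G$ is a collection of $5$-element subsets of $G$ (base blocks) such that every nonzero $d\in G$ occurs exactly once as a difference $x-y$ of two elements of one base block, counted over all base blocks. An automorphism $\varphi$ of $G$ carries a family $F$ to a family $F'$ if the base blocks of $F$ and $F'$ can be matched so that $\varphi$ carries each base block of $F$ to a translate of its partner in $F'$; two families are equivalent up to multipliers if some automorphism of $G$ carries one to the other, and the multiplier of $F$ is the number of automorphisms of $G$ carrying $F$ to itself. The development $\operatorname{dev}F$ is the set of all translates of base blocks of $F$. A Steiner system $S(2,5,81)$ is a set of $5$-subsets (blocks) of an $81$-point set such that any two distinct points lie in exactly one block. Isomorphisms of block systems are bijections of the points mapping the blocks onto the blocks. The hyperbolic frequency of an $S(2,5,81)$ assigns to each $n\ge 0$ the number of ordered quadruples $(o,x,y,p)$ of points, with $o,x,y$ not in a common block and $p$ in the block $xy$ through $x$ and $y$, $p\ne x,y$, for which exactly $n$ points $u$ of the block $oy$ have the property that the block $pu$ is disjoint from the block $ox$. Consider the following $14$ families $F_1,\dots,F_{14}$, each with a number $m_i$ and a function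 $h_i$ on the nonnegative integers, given by the quadruple $(h_i(0),h_i(1),h_i(2),h_i(3))$ and $h_i(n)=0$ for $n\ge4$. (An element of $G$ is written $ab$ for $(a,b)$.) 1. $m_{1}=1$, $h_{1}=(648, 43740, 466560, 966492)$, $F_{1}=\{\{00, 01, 03, 10, 41\},\ \{00, 04, 22, 61, 75\},\ \{00, 11, 23, 36, 78\},\ \{00, 15, 35, 43, 60\}\}$. 2. $m_{2}=1$, $h_{2}=(1296, 35964, 474336, 965844)$, $F_{2}=\{\{00, 01, 03, 10, 41\},\ \{00, 04, 22, 61, 75\},\ \{00, 11, 23, 36, 78\},\ \{00, 15, 45, 62, 70\}\}$. 3. $m_{3}=1$, $h_{3}=(1296, 63180, 484056, 928908)$, $F_{3}=\{\{00, 01, 03, 10, 62\},\ \{00, 04, 21, 41, 64\},\ \{00, 11, 24, 66, 82\},\ \{00, 12, 27, 63, 77\}\}$. 4. $m_{4}=1$, $h_{4}=(1296, 66582, 483084, 926478)$, $F_{4}=\{\{00, 01, 03, 10, 62\},\ \{00, 04, 21, 41, 64\},\ \{00, 11, 24, 66, 82\},\ \{00, 12, 34, 48, 84\}\}$. 5.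 $m_{5}=1$, $h_{5}=(648, 62694, 500580, 913518)$, $F_{5}=\{\{00, 01, 03, 10, 62\},\ \{00, 04, 21, 44, 60\},\ \{00, 11, 28, 64, 77\},\ \{00, 12, 27, 32, 75\}\}$. 6. $m_{6}=1$, $h_{6}=(1944, 71928, 505440, 898128)$, $F_{6}=\{\{00, 01, 03, 10, 62\},\ \{00, 04, 21, 44, 60\},\ \{00, 11, 28, 64, 77\},\ \{00, 12, 36, 70, 84\}\}$. 7. $m_{7}=3$, $h_{7}=(0, 49572, 491832, 936036)$, $F_{7}=\{\{00, 01, 03, 10, 62\},\ \{00, 04, 21, 44, 60\},\ \{00, 11, 33, 46, 82\},\ \{00, 12, 36, 70, 84\}\}$. 8. $m_{8}=1$, $h_{8}=(1296, 64152, 482112, 929880)$, $F_{8}=\{\{00, 01, 03, 10, 62\},\ \{00, 04, 22, 43, 58\},\ \{00, 11, 24, 66, 82\},\ \{00, 12, 26, 46, 76\}\}$. 9. $m_{9}=1$, $h_{9}=(0, 55890, 481140, 940410)$, $F_{9}=\{\{00, 01, 03, 10, 62\},\ \{00, 04, 22, 43, 58\},\ \{00, 11, 24, 66, 82\},\ \{00,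 12, 35, 65, 85\}\}$. 10. $m_{10}=1$, $h_{10}=(1296, 57348, 511272, 907524)$, $F_{10}=\{\{00, 01, 03, 10, 62\},\ \{00, 04, 22, 43, 58\},\ \{00, 11, 28, 44, 86\},\ \{00, 12, 26, 46, 76\}\}$. 11. $m_{11}=1$, $h_{11}=(648, 50058, 508356, 918378)$, $F_{11}=\{\{00, 01, 03, 10, 62\},\ \{00, 04, 22, 43, 58\},\ \{00, 11, 28, 44, 86\},\ \{00, 12, 35, 65, 85\}\}$. 12. $m_{12}=3$, $h_{12}=(0, 33534, 434484, 1009422)$, $F_{12}=\{\{00, 01, 03, 10, 62\},\ \{00, 04, 34, 50, 73\},\ \{00, 11, 33, 46, 82\},\ \{00, 12, 36, 70, 84\}\}$. 13. $m_{13}=3$, $h_{13}=(1944, 36450, 434484, 1004562)$, $F_{13}=\{\{00, 01, 10, 13, 38\},\ \{00, 02, 33, 40, 57\},\ \{00, 04, 21, 67, 72\},\ \{00, 11, 34, 54, 60\}\}$. 14. $m_{14}=3$, $h_{14}=(0, 34992, 425736, 1016712)$, $F_{14}=\{\{00, 01, 10, 13, 38\},\ \{00, 02, 33, 40, 57\},\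 \{00, 04, 21, 67, 72\},\ \{00, 11, 41, 56, 76\}\}$. Then: (i) each $F_i$ is a $(81,5,1)$ difference family in $G$; (ii) every $(81,5,1)$ difference family in $G$ is equivalent up to multipliers to exactly one of $F_1,\dots,F_{14}$; (iii) the multiplier of $F_i$ is $m_i$; (iv) $\operatorname{dev}F_i$ is a Steiner system $S(2,5,81)$; (v) the hyperbolic frequency of $\operatorname{dev}F_i$ is $h_i$; (vi) $\operatorname{dev}F_1,\dots,\operatorname{dev}F_{14}$ are pairwise non-isomorphic. -/

import Mathlib

/-- `B` is carried to `C` by the automorphism `φ` of `G` followed by a translation of `G`. -/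
def CarriesBlock {G : Type*} [AddCommGroup G] [DecidableEq G] (φ : G ≃+ G) (B C : Finset G) :
    Prop :=
  ∃ g : G, C = B.image (fun x => φ x + g)

/-- `F` is a `(|G|, k, l)` difference family in `G`: its members (the base blocks) are `k`-subsets
of `G`, and every `d ≠ 0` occurs exactly `l` times as a difference `x - y` of two elements of the
same base block, counted over all base blocks. -/
def IsDifferenceFamily {G : Type*} [AddCommGroup G] [DecidableEq G] (k l : ℕ)
    (F : Multiset (Finset G)) : Prop :=
  (∀ B ∈ F, B.card = k) ∧
  ∀ d : G, d ≠ 0 →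
    (F.map fun B => ((B ×ˢ B).filter fun z : G × G => z.1 - z.2 = d).card).sum = l

/-- The automorphism `φ` of `G` carries the family `F` to the family `F'`, where base blocks are
regarded up to translation: the members of the two families can be matched so that `φ` carries
each member of `F` to a translate of its partner in `F'`. -/
def CarriesFamily {G : Type*} [AddCommGroup G] [DecidableEq G] (φ : G ≃+ G)
    (F F' : Multiset (Finset G)) : Prop :=
  Multiset.Rel (CarriesBlock φ) F F'

/-- Two families are equivalent up to multipliers (group automorphisms). -/
def MultiplierEquivalent {G : Type*} [AddCommGroup G] [DecidableEq G]
    (F F' : Multiset (Finset G)) : Prop :=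
  ∃ φ : G ≃+ G, CarriesFamily φ F F'

/-- The number of automorphisms of `G` that fix the family `F` (base blocks being regarded up to
translation). -/
noncomputable def automorphismMultiplier {G : Type*} [AddCommGroup G] [DecidableEq G]
    (F : Multiset (Finset G)) : ℕ :=
  Nat.card {φ : G ≃+ G // CarriesFamily φ F F}

/-- The blocks generated by `F`: all translates of the base blocks. -/
def development {G : Type*} [AddCommGroup G] [Fintype G] [DecidableEq G]
    (F : Multiset (Finset G)) : Finset (Finset G) :=
  F.toFinset.biUnion fun B => Finset.univ.image fun g : G => B.image fun x => x + g

/-- The blocks `𝓑` form a Steiner system `S(t, k, v)` on the point set `V`. -/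
def IsSteinerSystem {V : Type*} [Fintype V] (t k v : ℕ) (𝓑 : Finset (Finset V)) : Prop :=
  Fintype.card V = v ∧ (∀ B ∈ 𝓑, B.card = k) ∧
  ∀ T : Finset V, T.card = t → ∃! B : Finset V, B ∈ 𝓑 ∧ T ⊆ B

/-- Isomorphism of block systems: a bijection of the points that maps the blocks of one onto the
blocks of the other. -/
def DesignIsomorphic {V W : Type*} [DecidableEq W] (𝓑 : Finset (Finset V))
    (𝓒 : Finset (Finset W)) : Prop :=
  ∃ e : V ≃ W, 𝓑.image (fun B => B.image e) = 𝓒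

/-- The points on a common block with `x` and `y`; for distinct points of a Steiner system
`S(2, k, v)` this is the unique block through them. -/
def lineThrough {V : Type*} [DecidableEq V] (𝓑 : Finset (Finset V)) (x y : V) : Finset V :=
  (𝓑.filter fun B => x ∈ B ∧ y ∈ B).biUnion id

/-- For a point `p` of the line `xy`: the number of points `u` on the line `oy` such that the line
`pu` does not meet the line `ox`. -/
def hyperbolicNumber {V : Type*} [DecidableEq V] (𝓑 : Finset (Finset V)) (o x y p : V) : ℕ :=
  ((lineThrough 𝓑 o y).filter fun u => Disjoint (lineThrough 𝓑 p u) (lineThrough 𝓑 o x)).card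

/-- The hyperbolic frequency of `𝓑` at `n`: the number of quadruples `(o, x, y, p)`, with `o`, `x`,
`y` not on a common block and `p` on the line `xy` distinct from `x` and `y`, whose hyperbolic
number is `n`. -/
def hyperbolicFrequency {V : Type*} [Fintype V] [DecidableEq V] (𝓑 : Finset (Finset V))
    (n : ℕ) : ℕ :=
  (Finset.univ.filter fun q : V × V × V × V =>
    (¬ ∃ B ∈ 𝓑, q.1 ∈ B ∧ q.2.1 ∈ B ∧ q.2.2.1 ∈ B) ∧
    q.2.2.2 ∈ lineThrough 𝓑 q.2.1 q.2.2.1 ∧ q.2.2.2 ≠ q.2.1 ∧ q.2.2.2 ≠ q.2.2.1 ∧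
    hyperbolicNumber 𝓑 q.1 q.2.1 q.2.2.1 q.2.2.2 = n).card

/-- The fourteen listed families of base blocks in `ℤ/9 × ℤ/9`. -/
def listedFamily : Fin 14 → Multiset (Finset (ZMod 9 × ZMod 9)) :=
  ![
    {{(0, 0), (0, 1), (0, 3), (1, 0), (4, 1)},
     {(0, 0), (0, 4), (2, 2), (6, 1), (7, 5)},
     {(0, 0), (1, 1), (2, 3), (3, 6), (7, 8)},
     {(0, 0), (1, 5), (3, 5), (4, 3), (6, 0)}},
    {{(0, 0), (0, 1), (0, 3), (1, 0), (4, 1)},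
     {(0, 0), (0, 4), (2, 2), (6, 1), (7, 5)},
     {(0, 0), (1, 1), (2, 3), (3, 6), (7, 8)},
     {(0, 0), (1, 5), (4, 5), (6, 2), (7, 0)}},
    {{(0, 0), (0, 1), (0, 3), (1, 0), (6, 2)},
     {(0, 0), (0, 4), (2, 1), (4, 1), (6, 4)},
     {(0, 0), (1, 1), (2, 4), (6, 6), (8, 2)},
     {(0, 0), (1, 2), (2, 7), (6, 3), (7, 7)}},
    {{(0, 0), (0, 1), (0, 3), (1, 0), (6, 2)},
     {(0, 0), (0, 4), (2, 1), (4, 1), (6, 4)},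
     {(0, 0), (1, 1), (2, 4), (6, 6), (8, 2)},
     {(0, 0), (1, 2), (3, 4), (4, 8), (8, 4)}},
    {{(0, 0), (0, 1), (0, 3), (1, 0), (6, 2)},
     {(0, 0), (0, 4), (2, 1), (4, 4), (6, 0)},
     {(0, 0), (1, 1), (2, 8), (6, 4), (7, 7)},
     {(0, 0), (1, 2), (2, 7), (3, 2), (7, 5)}},
    {{(0, 0), (0, 1), (0, 3), (1, 0), (6, 2)},
     {(0, 0), (0, 4), (2, 1), (4, 4), (6, 0)},
     {(0, 0), (1, 1), (2, 8), (6, 4), (7, 7)},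
     {(0, 0), (1, 2), (3, 6), (7, 0), (8, 4)}},
    {{(0, 0), (0, 1), (0, 3), (1, 0), (6, 2)},
     {(0, 0), (0, 4), (2, 1), (4, 4), (6, 0)},
     {(0, 0), (1, 1), (3, 3), (4, 6), (8, 2)},
     {(0, 0), (1, 2), (3, 6), (7, 0), (8, 4)}},
    {{(0, 0), (0, 1), (0, 3), (1, 0), (6, 2)},
     {(0, 0), (0, 4), (2, 2), (4, 3), (5, 8)},
     {(0, 0), (1, 1), (2, 4), (6, 6), (8, 2)},
     {(0, 0), (1, 2), (2, 6), (4, 6), (7, 6)}},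
    {{(0, 0), (0, 1), (0, 3), (1, 0), (6, 2)},
     {(0, 0), (0, 4), (2, 2), (4, 3), (5, 8)},
     {(0, 0), (1, 1), (2, 4), (6, 6), (8, 2)},
     {(0, 0), (1, 2), (3, 5), (6, 5), (8, 5)}},
    {{(0, 0), (0, 1), (0, 3), (1, 0), (6, 2)},
     {(0, 0), (0, 4), (2, 2), (4, 3), (5, 8)},
     {(0, 0), (1, 1), (2, 8), (4, 4), (8, 6)},
     {(0, 0), (1, 2), (2, 6), (4, 6), (7, 6)}},
    {{(0, 0), (0, 1), (0, 3), (1, 0), (6, 2)},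
     {(0, 0), (0, 4), (2, 2), (4, 3), (5, 8)},
     {(0, 0), (1, 1), (2, 8), (4, 4), (8, 6)},
     {(0, 0), (1, 2), (3, 5), (6, 5), (8, 5)}},
    {{(0, 0), (0, 1), (0, 3), (1, 0), (6, 2)},
     {(0, 0), (0, 4), (3, 4), (5, 0), (7, 3)},
     {(0, 0), (1, 1), (3, 3), (4, 6), (8, 2)},
     {(0, 0), (1, 2), (3, 6), (7, 0), (8, 4)}},
    {{(0, 0), (0, 1), (1, 0), (1, 3), (3, 8)},
     {(0, 0), (0, 2), (3, 3), (4, 0), (5, 7)},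
     {(0, 0), (0, 4), (2, 1), (6, 7), (7, 2)},
     {(0, 0), (1, 1), (3, 4), (5, 4), (6, 0)}},
    {{(0, 0), (0, 1), (1, 0), (1, 3), (3, 8)},
     {(0, 0), (0, 2), (3, 3), (4, 0), (5, 7)},
     {(0, 0), (0, 4), (2, 1), (6, 7), (7, 2)},
     {(0, 0), (1, 1), (4, 1), (5, 6), (7, 6)}}
  ]

/-- The listed multipliers. -/
def listedMultiplier : Fin 14 → ℕ :=
  ![1, 1, 1, 1, 1, 1, 3, 1, 1, 1, 1, 3, 3, 3]

/-- The listed hyperbolic frequencies: the entries of each list are the frequencies at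
`0, 1, 2, 3`; all other frequencies are zero. -/
def listedFrequency : Fin 14 → List ℕ :=
  ![
    [648, 43740, 466560, 966492],
    [1296, 35964, 474336, 965844],
    [1296, 63180, 484056, 928908],
    [1296, 66582, 483084, 926478],
    [648, 62694, 500580, 913518],
    [1944, 71928, 505440, 898128],
    [0, 49572, 491832, 936036],
    [1296, 64152, 482112, 929880],
    [0, 55890, 481140, 940410],
    [1296, 57348, 511272, 907524],
    [648, 50058, 508356, 918378],
    [0, 33534, 434484, 1009422],
    [1944, 36450, 434484, 1004562],
    [0, 34992, 425736, 1016712]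
  ]

/-! The classification and the counts are finite checks; the mathematics below makes them small
enough and shows that nothing is missed.

A block of five points has 20 differences, so a difference family consists of four blocks whose
difference sets partition the 80 nonzero elements (`IsCover`). This property survives automorphisms
of the group, translations of single blocks and negation of single blocks.

Partial families are cut off by positivity. For a homomorphism `χ` from the group to `ℤ/9` and any
integer function `w` on `ℤ/9`, the sum over `t` of the squares of `∑ x ∈ B, w (t + χ x)` is
nonnegative. For `w = wave` this bounds the total of `weight (χ d)` over the differences `d` of a
block by 76 · 5² = 1900 (`sum_weight_le`), whereas all nonzero `d` together have total 6156 if `χ`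
is nonzero. Hence `r` blocks that are still missing can absorb at most `1900 * r`
(`IsCover.totalWeight_le`). In particular no block lies in the kernel of a character `x ↦ 3 * x.1`
or `x ↦ 3 * x.2`, since 6156 > 3 · 1900.

Some block has the difference `(0, 3)`. By the last remark it can be moved to the form `{0, (0, 3),
(1, 0), y, z}` with six possible `y` (`isListed_of_isCover`). The admissible blocks of this form are
equivalent to 38 of them (`withBlock_isReduced`, `isReduced_sound`). For each of these the search
takes a missing difference `d` and tries all blocks through `0` and `d`, up to the reflection `x ↦ d
- x` (`search_sound`). Every family found is the image of one of five listed families up to negating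
single blocks (`isListed_of_isKnown`), and the sixteen sign choices of each of the five are matched
explicitly with listed families (`allCertified_signed`).

The hyperbolic frequency is an isomorphism invariant, and translations reduce its computation to
quadruples starting at `0` (`hyperbolicFrequency_development`). Its fourteen values are distinct,
which separates the developments and therefore also the equivalence classes of families. The
multipliers are found from the fact that the first base block of each listed family contains `0`,
`(1, 0)` and `(0, 1)`, so that its image determines the automorphism (`mem_fixing`). -/

namespace Z9

/-- The group `ℤ/9 × ℤ/9`. -/
abbrev G := ZMod 9 × ZMod 9

/-! ### Group elements as numbers and sets as bit masks

The element `(a, b)` is the number `18 * a + b`, so that translations of a set become shifts of the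
bit mask of its periodic continuation. The functions evaluated by the kernel are written with the
operations `Nat.land`, `Nat.shiftLeft`, … themselves and with recursors. -/

theorem raw_or (a b : ℕ) : Nat.lor a b = a ||| b := rfl
theorem raw_and (a b : ℕ) : Nat.land a b = a &&& b := rfl
theorem raw_xor (a b : ℕ) : Nat.xor a b = a ^^^ b := rfl
theorem raw_shiftLeft (a b : ℕ) : Nat.shiftLeft a b = a <<< b := rfl
theorem raw_shiftRight (a b : ℕ) : Nat.shiftRight a b = a >>> b := rfl
theorem raw_sub (a b : ℕ) : Nat.sub a b = a - b := rfl
theorem raw_add (a b : ℕ) : Nat.add a b = a + b := rfl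
theorem raw_mul (a b : ℕ) : Nat.mul a b = a * b := rfl
theorem raw_div (a b : ℕ) : Nat.div a b = a / b := rfl
theorem raw_mod (a b : ℕ) : Nat.mod a b = a % b := rfl

/-- The number of an element. -/
def code (x : G) : ℕ := 18 * x.1.val + x.2.val

/-- The element with a given number. -/
def point (n : ℕ) : G := (((n / 18 : ℕ) : ZMod 9), ((n % 18 : ℕ) : ZMod 9))

theorem code_lt (x : G) : code x < 153 := by
  have h1 := ZMod.val_lt x.1
  have h2 := ZMod.val_lt x.2
  simp only [code]; omega

theorem point_code (x : G) : point (code x) = x := by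
  have h1 := ZMod.val_lt x.1
  have h2 := ZMod.val_lt x.2
  have e1 : code x / 18 = x.1.val := by simp only [code]; omega
  have e2 : code x % 18 = x.2.val := by simp only [code]; omega
  simp [point, e1, e2]

theorem code_injective : Function.Injective code :=
  Function.LeftInverse.injective point_code

theorem code_inj {x y : G} : code x = code y ↔ x = y := code_injective.eq_iff

/-- Reduction modulo `9` of both digits. -/
def reduceCode (q : ℕ) : ℕ :=
  Nat.add (Nat.mul 18 (Nat.mod (Nat.div q 18) 9)) (Nat.mod (Nat.mod q 18) 9)

/-- Subtraction of numbers of elements. -/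
def subCode (x y : ℕ) : ℕ := reduceCode (Nat.sub (Nat.add x 171) y)

theorem val_sub_cases : ∀ a b : ZMod 9,
    a.val + 9 = b.val + (a - b).val ∨ a.val + 9 = b.val + (a - b).val + 9 := by
  decide

/-- 171 = 18 · 9 + 9 raises both digits by 9, so that the subtraction never borrows. The carry `c`
records in which digits a superfluous 9 remains. -/
theorem code_shift (x y : G) : ∃ c, (c = 0 ∨ c = 9 ∨ c = 162 ∨ c = 171) ∧
    code x + 171 = code y + code (x - y) + c := by
  have h1 := val_sub_cases x.1 y.1
  have h2 := val_sub_cases x.2 y.2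
  simp only [code, Prod.fst_sub, Prod.snd_sub]
  rcases h1 with h1 | h1 <;> rcases h2 with h2 | h2
  · exact ⟨0, by simp, by omega⟩
  · exact ⟨9, by simp, by omega⟩
  · exact ⟨162, by simp, by omega⟩
  · exact ⟨171, by simp, by omega⟩

theorem reduceCode_add (x : G) {c : ℕ} (hc : c = 0 ∨ c = 9 ∨ c = 162 ∨ c = 171) :
    reduceCode (code x + c) = code x := by
  have h1 := ZMod.val_lt x.1
  have h2 := ZMod.val_lt x.2
  simp only [reduceCode, code, raw_add, raw_mul, raw_div, raw_mod]
  rcases hc with rfl | rfl | rfl | rfl <;> omega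

theorem subCode_code (x y : G) : subCode (code x) (code y) = code (x - y) := by
  obtain ⟨c, hc, h⟩ := code_shift x y
  have : code x + 171 - code y = code (x - y) + c := by omega
  simp only [subCode, raw_sub, raw_add, this, reduceCode_add _ hc]

/-- Converse of `code_shift`: the four carries are removed by reduction of the digits modulo 9. -/
theorem eq_sub_of_code {x y d : G} {c : ℕ} (hc : c = 0 ∨ c = 9 ∨ c = 162 ∨ c = 171)
    (h : code x + 171 = code y + code d + c) : d = x - y := by
  apply code_injective
  have : code x + 171 - code y = code d + c := by omega
  rw [← subCode_code, subCode, raw_sub, raw_add, this, reduceCode_add _ hc]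

/-- The mask of the whole group. -/
def grid : ℕ := 11395724267687352188722688754123064480748012031

theorem testBit_grid (n : ℕ) : grid.testBit n = true ↔ ∃ x : G, code x = n := by
  constructor
  · intro h
    have hn : n < 162 := by
      by_contra hn
      have : grid < 2 ^ n := lt_of_lt_of_le (by decide +kernel : grid < 2 ^ 162)
        (Nat.pow_le_pow_right (by norm_num) (not_lt.mp hn))
      rw [Nat.testBit_lt_two_pow this] at h
      exact Bool.noConfusion h
    have key : ∀ n < 162, grid.testBit n = true → n / 18 < 9 ∧ n % 18 < 9 := by decide +kernel
    obtain ⟨h1, h2⟩ := key n hn h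
    refine ⟨point n, ?_⟩
    simp only [code, point, ZMod.val_natCast, Nat.mod_eq_of_lt h1, Nat.mod_eq_of_lt h2]
    omega
  · rintro ⟨x, rfl⟩
    have key : ∀ a < 9, ∀ b < 9, grid.testBit (18 * a + b) = true := by decide +kernel
    exact key _ (ZMod.val_lt x.1) _ (ZMod.val_lt x.2)

/-- `A` is the bit mask of `S`. -/
def IsMask (A : ℕ) (S : Finset G) : Prop := ∀ n, A.testBit n = true ↔ ∃ x ∈ S, code x = n

/-- `A` is the bit mask of `S` read backwards. -/
def IsRevMask (A : ℕ) (S : Finset G) : Prop :=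
  ∀ n, A.testBit n = true ↔ ∃ x ∈ S, 171 - code x = n

theorem IsMask.testBit_code {A : ℕ} {S : Finset G} (h : IsMask A S) (x : G) :
    A.testBit (code x) = true ↔ x ∈ S := by
  rw [h]
  constructor
  · rintro ⟨y, hy, e⟩; rwa [← code_injective e]
  · exact fun hx => ⟨x, hx, rfl⟩

theorem isMask_grid : IsMask grid Finset.univ := by
  intro n; simp [testBit_grid]

/-- Through this lemma, inclusions and disjointness proved for sets become the numerical equations
that the evaluated functions test. -/
theorem IsMask.unique {A B : ℕ} {S : Finset G} (hA : IsMask A S) (hB : IsMask B S) : A = B := by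
  apply Nat.eq_of_testBit_eq
  intro n
  rw [Bool.eq_iff_iff, hA, hB]

theorem IsMask.inter {A B : ℕ} {S T : Finset G} (hA : IsMask A S) (hB : IsMask B T) :
    IsMask (A &&& B) (S ∩ T) := by
  intro n
  rw [Nat.testBit_and, Bool.and_eq_true, hA, hB]
  constructor
  · rintro ⟨⟨x, hx, rfl⟩, ⟨y, hy, e⟩⟩
    rw [code_inj] at e; subst e
    exact ⟨y, by simp [hx, hy], rfl⟩
  · rintro ⟨x, hx, rfl⟩
    simp only [Finset.mem_inter] at hx
    exact ⟨⟨x, hx.1, rfl⟩, ⟨x, hx.2, rfl⟩⟩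

theorem IsMask.union {A B : ℕ} {S T : Finset G} (hA : IsMask A S) (hB : IsMask B T) :
    IsMask (A ||| B) (S ∪ T) := by
  intro n
  rw [Nat.testBit_or, Bool.or_eq_true, hA, hB]
  simp only [Finset.mem_union, or_and_right, exists_or]

/-- The symmetric difference is a removal because `T` lies in `S`. -/
theorem IsMask.sdiff {A B : ℕ} {S T : Finset G} (hA : IsMask A S) (hB : IsMask B T)
    (h : T ⊆ S) : IsMask (A ^^^ B) (S \ T) := by
  intro n
  rw [Nat.testBit_xor]
  by_cases hn : ∃ x : G, code x = n
  · obtain ⟨x, rfl⟩ := hn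
    have e1 := hA.testBit_code x
    have e2 := hB.testBit_code x
    have e3 : (∃ y ∈ S \ T, code y = code x) ↔ x ∈ S \ T := by
      simp only [code_inj, exists_eq_right]
    rw [e3, Finset.mem_sdiff]
    have := @h x
    cases hA' : A.testBit (code x) <;> cases hB' : B.testBit (code x) <;> simp_all
  · have e1 : A.testBit n = false := by
      rw [← Bool.not_eq_true, hA]; rintro ⟨x, -, e⟩; exact hn ⟨x, e⟩
    have e2 : B.testBit n = false := by
      rw [← Bool.not_eq_true, hB]; rintro ⟨x, -, e⟩; exact hn ⟨x, e⟩
    simp only [e1, e2, bne_self_eq_false, Bool.false_eq_true, false_iff]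
    rintro ⟨x, -, e⟩; exact hn ⟨x, e⟩

theorem isMask_singleton (x : G) : IsMask (1 <<< code x) {x} := by
  intro n
  simp [Nat.shiftLeft_eq, Nat.testBit_two_pow]

theorem IsMask.insert {M : ℕ} {P : Finset G} (h : IsMask M P) (y : G) :
    IsMask (M ||| 1 <<< code y) (insert y P) := by
  have := h.union (isMask_singleton y)
  rwa [Finset.union_comm] at this

theorem IsRevMask.insert {M : ℕ} {P : Finset G} (h : IsRevMask M P) (y : G) :
    IsRevMask (M ||| 1 <<< (171 - code y)) (insert y P) := by
  intro n
  rw [Nat.testBit_or, Bool.or_eq_true, h]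
  simp [Nat.shiftLeft_eq, Nat.testBit_two_pow, or_comm]

theorem IsMask.eq_zero_of_disjoint {A B : ℕ} {S T : Finset G} (hA : IsMask A S) (hB : IsMask B T)
    (h : Disjoint S T) : A &&& B = 0 := by
  have h1 := hA.inter hB
  rw [Finset.disjoint_iff_inter_eq_empty.mp h] at h1
  exact h1.unique (fun n => by simp)

/-- Reduction modulo `9` of both digits, applied to all elements of a mask. -/
def foldMask (U : ℕ) : ℕ :=
  (fun V => Nat.land (Nat.lor V (Nat.shiftRight V 162)) grid) (Nat.lor U (Nat.shiftRight U 9))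

/-- A shift by 9 followed by one by 162 collects the four carries of `code_shift`. -/
theorem testBit_foldMask (U n : ℕ) : (foldMask U).testBit n = true ↔
    (∃ c, (c = 0 ∨ c = 9 ∨ c = 162 ∨ c = 171) ∧ U.testBit (n + c) = true) ∧
      grid.testBit n = true := by
  simp only [foldMask, raw_and, raw_or, raw_shiftRight, Nat.testBit_and, Nat.testBit_or,
    Nat.testBit_shiftRight, Bool.and_eq_true, Bool.or_eq_true, exists_eq_or_imp, exists_eq_left,
    add_zero]
  have e : 9 + (162 + n) = n + 171 := by ring
  rw [e, add_comm 9 n, add_comm 162 n, or_assoc]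

/-- The shift moves the bit of `p` to `code p + 171 - code y`, which is `code (p - y)` plus a carry;
folding removes the carry. -/
theorem isMask_foldMask_shiftLeft {M : ℕ} {P : Finset G} (h : IsMask M P) (y : G) :
    IsMask (foldMask (M <<< (171 - code y))) (P.image fun p => p - y) := by
  intro n
  have hy := code_lt y
  rw [testBit_foldMask, testBit_grid]
  simp only [Nat.testBit_shiftLeft, Bool.and_eq_true, decide_eq_true_eq, h _, Finset.mem_image]
  constructor
  · rintro ⟨⟨c, hc, hle, p, hp, e⟩, d, rfl⟩
    exact ⟨d, ⟨p, hp, (eq_sub_of_code hc (by omega)).symm⟩, rfl⟩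
  · rintro ⟨_, ⟨p, hp, rfl⟩, rfl⟩
    obtain ⟨c, hc, e⟩ := code_shift p y
    exact ⟨⟨c, hc, by omega, p, hp, by omega⟩, _, rfl⟩

/-- The reversed mask is kept so that the differences `y - p`, too, arise from a single shift. -/
theorem isMask_foldMask_rev {M : ℕ} {P : Finset G} (h : IsRevMask M P) (y : G) :
    IsMask (foldMask (M <<< code y)) (P.image fun p => y - p) := by
  intro n
  rw [testBit_foldMask, testBit_grid]
  simp only [Nat.testBit_shiftLeft, Bool.and_eq_true, decide_eq_true_eq, h _, Finset.mem_image]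
  constructor
  · rintro ⟨⟨c, hc, hle, p, hp, e⟩, d, rfl⟩
    have := code_lt p
    exact ⟨d, ⟨p, hp, (eq_sub_of_code hc (by omega)).symm⟩, rfl⟩
  · rintro ⟨_, ⟨p, hp, rfl⟩, rfl⟩
    have := code_lt p
    obtain ⟨c, hc, e⟩ := code_shift y p
    exact ⟨⟨c, hc, by omega, p, hp, by omega⟩, _, rfl⟩

/-- The periodic continuation of a mask. -/
def extendMask (A : ℕ) : ℕ :=
  (fun B => Nat.lor B (Nat.shiftLeft B 162)) (Nat.lor A (Nat.shiftLeft A 9))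

theorem testBit_extendMask {A m c : ℕ} (h : A.testBit m = true)
    (hc : c = 0 ∨ c = 9 ∨ c = 162 ∨ c = 171) : (extendMask A).testBit (m + c) = true := by
  simp only [extendMask, raw_or, raw_shiftLeft, Nat.testBit_or, Nat.testBit_shiftLeft,
    Bool.or_eq_true, Bool.and_eq_true, decide_eq_true_eq]
  rcases hc with rfl | rfl | rfl | rfl
  · simp [h]
  · simp [h]
  · simp [h]
  · right
    refine ⟨by omega, Or.inr ⟨by omega, ?_⟩⟩
    have : m + 171 - 162 - 9 = m := by omega
    rw [this, h]

/-- One implication is enough: a mask of candidates may be too large, since `addPoint` tests every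
candidate, but it must not miss a point. -/
theorem testBit_shift_extendMask {A : ℕ} {S : Finset G} (hA : IsMask A S) {y s : G}
    (h : y - s ∈ S) : (extendMask A >>> (171 - code s)).testBit (code y) = true := by
  rw [Nat.testBit_shiftRight]
  obtain ⟨c, hc, e⟩ := code_shift y s
  have := code_lt s
  have e2 : 171 - code s + code y = code (y - s) + c := by omega
  rw [e2]
  exact testBit_extendMask ((hA.testBit_code _).mpr h) hc

/-! ### Exhaustive enumeration of blocks -/

/-- Case distinction on whether a number is zero. -/
def ifZero {α : Type} (n : ℕ) (a b : α) : α := Nat.rec a (fun _ _ => b) n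

theorem ifZero_zero {α : Type} (a b : α) : ifZero 0 a b = a := rfl

theorem ifZero_of_ne {α : Type} {n : ℕ} (hn : n ≠ 0) (a b : α) : ifZero n a b = b := by
  cases n with
  | zero => exact absurd rfl hn
  | succ n => rfl

theorem boolRec_eq_true {a b : Bool} (h : (Bool.rec false a b : Bool) = true) :
    b = true ∧ a = true := by
  cases b
  · exact Bool.noConfusion h
  · exact ⟨rfl, h⟩

/-- The table of the discrete logarithms to base `2` modulo `163`. -/
def logTable : ℕ := 110936657300104122607488078898614058708404294876163137535473866820231109536615574210406678975858332644500102542469841201442695190079575704653460482616705024679032128735095575144963435245708349687068857256268992822609225428423457756446005625597351645693055414470449075977189309276484482124787190820858394207711175539825653689827367242291002432237438324263486074371928727531764370500861684678656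

/-- The position of a bit of a nonzero mask. -/
def someBit (C : ℕ) : ℕ :=
  Nat.mod (Nat.shiftRight logTable
    (Nat.mul 8 (Nat.mod (Nat.sub C (Nat.land C (Nat.sub C 1))) 163))) 256

/-- Adjoin the point `y` to the points with mask `M` (and reversed mask `Mr`) and remove the new
differences from the mask `A` of available differences. -/
def addPoint (M Mr A y : ℕ) (k : ℕ → ℕ → ℕ → Bool) : Bool :=
  (fun F₁ F₂ => (fun F =>
      ifZero (Nat.add (Nat.land F₁ F₂) (Nat.xor F (Nat.land A F)))
        (k (Nat.lor M (Nat.shiftLeft 1 y)) (Nat.lor Mr (Nat.shiftLeft 1 (Nat.sub 171 y)))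
          (Nat.xor A F)) true)
      (Nat.lor F₁ F₂))
    (foldMask (Nat.shiftLeft M (Nat.sub 171 y))) (foldMask (Nat.shiftLeft Mr y))

/-- Test `k` on all elements of a mask, together with the mask of the elements not yet visited. -/
def forallBits (k : ℕ → ℕ → Bool) (fuel : ℕ) : ℕ → Bool :=
  Nat.rec (fun C => Nat.beq C 0)
    (fun _ ih C => ifZero C true
      ((fun x => (fun r => Bool.rec false (ih r) (k x r))
        (Nat.xor C (Nat.land C (Nat.shiftLeft 1 x)))) (someBit C))) fuel

/-- The same, with only one of the elements `x` and `d - x` visited. -/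
def forallBitsFlip (d : ℕ) (k : ℕ → ℕ → Bool) (fuel : ℕ) : ℕ → Bool :=
  Nat.rec (fun C => Nat.beq C 0)
    (fun _ ih C => ifZero C true
      ((fun x => ifZero (Nat.land C (Nat.shiftLeft 1 x)) false
        ((fun r => Bool.rec false (ih r) (k x r))
          (Nat.xor C (Nat.land C (Nat.lor (Nat.shiftLeft 1 x) (Nat.shiftLeft 1 (subCode d x)))))))
        (someBit C))) fuel

/-- Test `k` on all blocks `{0, d, x, y, z}` with available differences. -/
def forallBlocks (d A : ℕ) (k : ℕ → ℕ → ℕ → ℕ → Bool) : Bool :=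
  addPoint 1 (Nat.shiftLeft 1 171) A d fun M Mr A =>
  (fun E => forallBitsFlip d (fun x C => addPoint M Mr A x fun M Mr A =>
    (fun E => forallBits (fun y C => addPoint M Mr A y fun M Mr A =>
      (fun E => forallBits (fun z _ => addPoint M Mr A z fun _ _ A => k x y z A) 81
        (Nat.land (Nat.land C A) (Nat.land (Nat.shiftRight E (Nat.sub 171 d))
          (Nat.land (Nat.shiftRight E (Nat.sub 171 x)) (Nat.shiftRight E (Nat.sub 171 y))))))
      (extendMask A)) 81
      (Nat.land (Nat.land C A)
        (Nat.land (Nat.shiftRight E (Nat.sub 171 d)) (Nat.shiftRight E (Nat.sub 171 x)))))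
    (extendMask A)) 81
    (Nat.land A (Nat.shiftRight E (Nat.sub 171 d))))
  (extendMask A)

/-! ### Sets with distinct differences, and completeness of the enumeration of blocks. -/

/-- The differences of distinct elements of a set. -/
def diffSet (B : Finset G) : Finset G := B.offDiag.image fun z => z.1 - z.2

/-- All differences of distinct elements of the set are distinct. -/
def IsSidon (B : Finset G) : Prop := Set.InjOn (fun z : G × G => z.1 - z.2) B.offDiag

theorem mem_diffSet {B : Finset G} {d : G} :
    d ∈ diffSet B ↔ ∃ x ∈ B, ∃ y ∈ B, x ≠ y ∧ x - y = d := by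
  constructor
  · intro h
    obtain ⟨⟨x, y⟩, hxy, e⟩ := Finset.mem_image.mp h
    obtain ⟨hx, hy, h⟩ := Finset.mem_offDiag.mp hxy
    exact ⟨x, hx, y, hy, h, e⟩
  · rintro ⟨x, hx, y, hy, h, rfl⟩
    exact Finset.mem_image.mpr ⟨(x, y), Finset.mem_offDiag.mpr ⟨hx, hy, h⟩, rfl⟩

theorem sub_mem_diffSet {B : Finset G} {x y : G} (hx : x ∈ B) (hy : y ∈ B) (h : x ≠ y) :
    x - y ∈ diffSet B :=
  mem_diffSet.mpr ⟨x, hx, y, hy, h, rfl⟩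

theorem IsSidon.eq {B : Finset G} (h : IsSidon B) {x y z w : G} (hx : x ∈ B) (hy : y ∈ B)
    (hz : z ∈ B) (hw : w ∈ B) (hxy : x ≠ y) (e : x - y = z - w) : x = z ∧ y = w := by
  have hzw : z ≠ w := by
    rintro rfl; rw [sub_self, sub_eq_zero] at e; exact hxy e
  have := @h (x, y) (by simp [hx, hy, hxy]) (z, w) (by simp [hz, hw, hzw]) e
  simpa using this

/-- In a set with distinct differences a difference determines its pair of points, so one that
involves a point outside `P` is not a difference of `P`. -/
theorem sub_notMem_diffSet {B P : Finset G} (h : IsSidon B) (hP : P ⊆ B) {y z : G} (hy : y ∈ B)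
    (hz : z ∈ B) (hyz : y ≠ z) (hn : y ∉ P ∨ z ∉ P) : y - z ∉ diffSet P := by
  intro hm
  obtain ⟨⟨a, b⟩, hab, e⟩ := Finset.mem_image.mp hm
  obtain ⟨ha, hb, -⟩ := Finset.mem_offDiag.mp hab
  obtain ⟨rfl, rfl⟩ := h.eq hy hz (hP ha) (hP hb) hyz e.symm
  rcases hn with hn | hn
  · exact hn ha
  · exact hn hb

theorem diffSet_insert {P : Finset G} {y : G} (hy : y ∉ P) : diffSet (insert y P) =
    diffSet P ∪ ((P.image fun p => p - y) ∪ (P.image fun p => y - p)) := by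
  ext d
  simp only [mem_diffSet, Finset.mem_union, Finset.mem_image, Finset.mem_insert]
  constructor
  · rintro ⟨a, ha, b, hb, hab, rfl⟩
    rcases ha with rfl | ha <;> rcases hb with rfl | hb
    · exact absurd rfl hab
    · exact Or.inr (Or.inr ⟨b, hb, rfl⟩)
    · exact Or.inr (Or.inl ⟨a, ha, rfl⟩)
    · exact Or.inl ⟨a, ha, b, hb, hab, rfl⟩
  · rintro (⟨a, ha, b, hb, hab, rfl⟩ | ⟨p, hp, rfl⟩ | ⟨p, hp, rfl⟩)
    · exact ⟨a, Or.inr ha, b, Or.inr hb, hab, rfl⟩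
    · exact ⟨p, Or.inr hp, y, Or.inl rfl, fun e => hy (e ▸ hp), rfl⟩
    · exact ⟨y, Or.inl rfl, p, Or.inr hp, fun e => hy (e ▸ hp), rfl⟩

/-- The state of the enumeration after the points `P` have been chosen. -/
structure IsState (M Mr A : ℕ) (P S : Finset G) : Prop where
  mask : IsMask M P
  rev : IsRevMask Mr P
  avail : IsMask A (S \ diffSet P)

theorem isState_zero {A : ℕ} {S : Finset G} (hA : IsMask A S) :
    IsState 1 (Nat.shiftLeft 1 171) A {0} S where
  mask := by simpa [code] using isMask_singleton (0 : G)
  rev := fun n => by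
    have e : Nat.shiftLeft 1 171 = 2 ^ 171 := by rw [raw_shiftLeft, Nat.shiftLeft_eq, one_mul]
    rw [e, Nat.testBit_two_pow]
    simp [code]
  avail := by simpa [diffSet] using hA

/-- For points of an actual block the test in `addPoint` succeeds, so its default value `true` is
never what makes `h` hold: `p - y = y - q` would force `p = y`, and the new differences are
available because they belong to `B` and not to `P`. -/
theorem IsState.addPoint {M Mr A : ℕ} {P S B : Finset G} (hs : IsState M Mr A P S)
    (hB : IsSidon B) (hBS : diffSet B ⊆ S) (hPB : P ⊆ B) {y : G} (hyB : y ∈ B) (hy : y ∉ P)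
    {k : ℕ → ℕ → ℕ → Bool} (h : addPoint M Mr A (code y) k = true) :
    ∃ M' Mr' A', IsState M' Mr' A' (insert y P) S ∧ k M' Mr' A' = true := by
  have m1 := isMask_foldMask_shiftLeft hs.mask y
  have m2 := isMask_foldMask_rev hs.rev y
  have hne : ∀ p ∈ P, p ≠ y := by rintro p hp rfl; exact hy hp
  have hd : Disjoint (P.image fun p => p - y) (P.image fun p => y - p) := by
    rw [Finset.disjoint_left]
    intro d h1 h2
    obtain ⟨p, hp, rfl⟩ := Finset.mem_image.mp h1
    obtain ⟨q, hq, e⟩ := Finset.mem_image.mp h2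
    exact hne p hp (hB.eq (hPB hp) hyB hyB (hPB hq) (hne p hp) e.symm).1
  have m3 := m1.union m2
  have hsub : (P.image fun p => p - y) ∪ (P.image fun p => y - p) ⊆ S \ diffSet P := by
    apply Finset.union_subset
    · intro d hd
      obtain ⟨p, hp, rfl⟩ := Finset.mem_image.mp hd
      exact Finset.mem_sdiff.mpr ⟨hBS (sub_mem_diffSet (hPB hp) hyB (hne p hp)),
        sub_notMem_diffSet hB hPB (hPB hp) hyB (hne p hp) (Or.inr hy)⟩
    · intro d hd
      obtain ⟨p, hp, rfl⟩ := Finset.mem_image.mp hd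
      exact Finset.mem_sdiff.mpr ⟨hBS (sub_mem_diffSet hyB (hPB hp) (hne p hp).symm),
        sub_notMem_diffSet hB hPB hyB (hPB hp) (hne p hp).symm (Or.inl hy)⟩
  have e1 := m1.eq_zero_of_disjoint m2 hd
  have m4 := hs.avail.inter m3
  rw [Finset.inter_eq_right.mpr hsub] at m4
  have e2 := m4.unique m3
  simp only [Z9.addPoint, raw_and, raw_or, raw_xor, raw_add, raw_shiftLeft, raw_sub, e1, e2,
    Nat.xor_self, add_zero, ifZero_zero] at h
  refine ⟨_, _, _, ⟨hs.mask.insert y, hs.rev.insert y, ?_⟩, h⟩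
  rw [diffSet_insert hy, show ∀ I : Finset G, S \ (diffSet P ∪ I) = (S \ diffSet P) \ I from
    fun I => by ext; simp [and_assoc]]
  exact hs.avail.sdiff m3 hsub

theorem IsState.testBit {M Mr A : ℕ} {P S B : Finset G} (hs : IsState M Mr A P S)
    (hB : IsSidon B) (hBS : diffSet B ⊆ S) (hPB : P ⊆ B) {z s : G} (hz : z ∈ B) (hzP : z ∉ P)
    (hsP : s ∈ P) : (Nat.shiftRight (extendMask A) (Nat.sub 171 (code s))).testBit (code z) = true := by
  have hne : z ≠ s := by rintro rfl; exact hzP hsP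
  exact testBit_shift_extendMask hs.avail (Finset.mem_sdiff.mpr
    ⟨hBS (sub_mem_diffSet hz (hPB hsP) hne),
      sub_notMem_diffSet hB hPB hz (hPB hsP) hne (Or.inl hzP)⟩)

theorem IsState.testBit_avail {M Mr A : ℕ} {P S B : Finset G} (hs : IsState M Mr A P S)
    (hB : IsSidon B) (hBS : diffSet B ⊆ S) (hPB : P ⊆ B) {z : G} (hz : z ∈ B) (hzP : z ∉ P)
    (h0 : 0 ∈ P) : A.testBit (code z) = true := by
  have hne : z ≠ 0 := by rintro rfl; exact hzP h0
  rw [hs.avail.testBit_code, Finset.mem_sdiff, ← sub_zero z]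
  exact ⟨hBS (sub_mem_diffSet hz (hPB h0) hne),
      sub_notMem_diffSet hB hPB hz (hPB h0) hne (Or.inl hzP)⟩

theorem testBit_remove {C x n : ℕ} (h : C.testBit n = true) (hn : n ≠ x) :
    (C ^^^ (C &&& 1 <<< x)).testBit n = true := by
  simp only [Nat.testBit_xor, Nat.testBit_and, Nat.shiftLeft_eq, one_mul, Nat.testBit_two_pow, h]
  simp [Ne.symm hn]

/-- No property of `someBit` is needed: a position that does not come from `T` can be removed
without harm to `T`, and running out of fuel with a nonzero mask gives `false`. At the first visited
element of `T` all others are still in `r`, so later points of a block need to be sought only there.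
-/
theorem forallBits_sound {k : ℕ → ℕ → Bool} {fuel C : ℕ} (h : forallBits k fuel C = true)
    {T : Finset G} (hT : T.Nonempty) (hC : ∀ x ∈ T, C.testBit (code x) = true) :
    ∃ x ∈ T, ∃ r, k (code x) r = true ∧ ∀ y ∈ T, y ≠ x → r.testBit (code y) = true := by
  induction fuel generalizing C with
  | zero =>
    obtain ⟨x, hx⟩ := hT
    have h0 : C = 0 := Nat.eq_of_beq_eq_true h
    have := hC x hx
    simp [h0] at this
  | succ fuel ih =>
    have hC0 : C ≠ 0 := by
      rintro rfl
      obtain ⟨x, hx⟩ := hT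
      simpa using hC x hx
    have h' : ifZero C true ((fun x => (fun r => Bool.rec false (forallBits k fuel r) (k x r))
        (Nat.xor C (Nat.land C (Nat.shiftLeft 1 x)))) (someBit C)) = true := h
    rw [ifZero_of_ne hC0] at h'
    obtain ⟨h1, h2⟩ := boolRec_eq_true h'
    by_cases hx : ∃ x ∈ T, code x = someBit C
    · obtain ⟨x, hx, e⟩ := hx
      refine ⟨x, hx, _, e ▸ h1, fun y hy hyx => testBit_remove (hC y hy) ?_⟩
      rwa [Ne, code_inj]
    · exact ih h2 fun y hy => testBit_remove (hC y hy) fun e => hx ⟨y, hy, e⟩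

theorem testBit_remove_two {C x y n : ℕ} (h : C.testBit n = true) (hn : n ≠ x) (hn' : n ≠ y) :
    (C ^^^ (C &&& (1 <<< x ||| 1 <<< y))).testBit n = true := by
  simp only [Nat.testBit_xor, Nat.testBit_and, Nat.testBit_or, Nat.shiftLeft_eq, one_mul,
    Nat.testBit_two_pow, h]
  simp [Ne.symm hn, Ne.symm hn']

/-- Each step removes a pair `x`, `d - x`. Until a pair meets `T`, the mask still contains every
element of `T` together with its partner, whichever of the two is visited. -/
theorem forallBitsFlip_sound {d : G} {k : ℕ → ℕ → Bool} {fuel C : ℕ}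
    (h : forallBitsFlip (code d) k fuel C = true) {T : Finset G} (hT : T.Nonempty)
    (hC : ∀ x ∈ T, C.testBit (code x) = true ∧ C.testBit (code (d - x)) = true)
    (hG : ∀ n, C.testBit n = true → ∃ x : G, code x = n) :
    ∃ x r, (x ∈ T ∨ d - x ∈ T) ∧ k (code x) r = true ∧ ∀ y ∈ T, y ≠ x → y ≠ d - x →
      r.testBit (code y) = true ∧ r.testBit (code (d - y)) = true := by
  induction fuel generalizing C with
  | zero =>
    obtain ⟨x, hx⟩ := hT
    have h0 : C = 0 := Nat.eq_of_beq_eq_true h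
    have := (hC x hx).1
    simp [h0] at this
  | succ fuel ih =>
    have hC0 : C ≠ 0 := by
      rintro rfl
      obtain ⟨x, hx⟩ := hT
      simpa using hC x hx
    have h' : ifZero C true ((fun x => ifZero (Nat.land C (Nat.shiftLeft 1 x)) false
        ((fun r => Bool.rec false (forallBitsFlip (code d) k fuel r) (k x r))
          (Nat.xor C (Nat.land C (Nat.lor (Nat.shiftLeft 1 x)
            (Nat.shiftLeft 1 (subCode (code d) x))))))) (someBit C)) = true := h
    rw [ifZero_of_ne hC0] at h'
    dsimp only at h'
    -- Here, unlike in `forallBits`, the position must be the number of a group element, because its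
    -- partner `d - x` is computed from it.
    have hbit : Nat.land C (Nat.shiftLeft 1 (someBit C)) ≠ 0 := by
      intro e; rw [e] at h'; exact Bool.noConfusion h'
    rw [ifZero_of_ne hbit] at h'
    obtain ⟨h1, h2⟩ := boolRec_eq_true h'
    have hx : ∃ x : G, code x = someBit C := by
      apply hG
      by_contra hf
      apply hbit
      rw [raw_and, raw_shiftLeft, Nat.shiftLeft_eq, one_mul]
      apply Nat.eq_of_testBit_eq
      intro n
      rw [Nat.testBit_and, Nat.testBit_two_pow, Nat.zero_testBit]
      by_cases e : someBit C = n
      · subst e; simpa using hf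
      · simp [e]
    obtain ⟨x, e⟩ := hx
    rw [← e, subCode_code] at h1 h2
    simp only [raw_xor, raw_and, raw_or, raw_shiftLeft] at h1 h2
    have key : ∀ y ∈ T, y ≠ x → y ≠ d - x →
        (C ^^^ (C &&& (1 <<< code x ||| 1 <<< code (d - x)))).testBit (code y) = true ∧
        (C ^^^ (C &&& (1 <<< code x ||| 1 <<< code (d - x)))).testBit (code (d - y)) = true := by
      intro y hy hyx hyx'
      refine ⟨testBit_remove_two (hC y hy).1 (by rwa [Ne, code_inj]) (by rwa [Ne, code_inj]),
        testBit_remove_two (hC y hy).2 ?_ ?_⟩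
      · rw [Ne, code_inj]; rintro rfl; exact hyx' (by abel)
      · rw [Ne, code_inj]; intro e; exact hyx (sub_right_injective e)
    by_cases hx : x ∈ T ∨ d - x ∈ T
    · exact ⟨x, _, hx, h1, key⟩
    · push Not at hx
      refine ih h2 (fun y hy => key y hy ?_ ?_) fun n hn => hG n ?_
      · rintro rfl; exact hx.1 hy
      · rintro rfl; exact hx.2 hy
      · rw [Nat.testBit_xor, Nat.testBit_and] at hn
        cases hCn : C.testBit n
        · simp [hCn] at hn
        · rfl

theorem IsSidon.flip {B : Finset G} (h : IsSidon B) (d : G) : IsSidon (B.image fun x => d - x) := by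
  rintro ⟨a, b⟩ hab ⟨a', b'⟩ hab' e
  simp only [Finset.mem_coe, Finset.mem_offDiag, Finset.mem_image] at hab hab'
  obtain ⟨⟨x, hx, rfl⟩, ⟨y, hy, rfl⟩, hxy⟩ := hab
  obtain ⟨⟨x', hx', rfl⟩, ⟨y', hy', rfl⟩, -⟩ := hab'
  have hne : y ≠ x := by rintro rfl; exact hxy rfl
  obtain ⟨rfl, rfl⟩ := h.eq hy hx hy' hx' hne (by simpa using e)
  rfl

/-- A reflection reverses the sign of each difference, and the set of differences is symmetric. -/
theorem diffSet_flip (B : Finset G) (d : G) : diffSet (B.image fun x => d - x) = diffSet B := by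
  ext e
  simp only [mem_diffSet, Finset.mem_image]
  constructor
  · rintro ⟨_, ⟨x, hx, rfl⟩, _, ⟨y, hy, rfl⟩, hxy, rfl⟩
    exact ⟨y, hy, x, hx, by rintro rfl; exact hxy rfl, by abel⟩
  · rintro ⟨x, hx, y, hy, hxy, rfl⟩
    exact ⟨_, ⟨y, hy, rfl⟩, _, ⟨x, hx, rfl⟩, fun e => hxy (sub_right_injective e).symm, by abel⟩

theorem exists_mem_sdiff_of_card {B P : Finset G} (h : P.card < B.card) : (B \ P).Nonempty := by
  rw [← Finset.card_pos]
  have := Finset.le_card_sdiff P B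
  omega

/-- The choice of the last two points, separated because it is applied both to a block and to its
reflection. -/
theorem forallBits_blocks_sound {S B : Finset G} (hB : IsSidon B) (hBS : diffSet B ⊆ S)
    (hc : B.card = 5) {d x : G} (h0 : 0 ∈ B) (hd : d ∈ B) (hd0 : d ≠ 0) (hx : x ∈ B)
    (hx0 : x ≠ 0) (hxd : x ≠ d) {M Mr A C : ℕ} (hs : IsState M Mr A {d, 0} S)
    (hC : ∀ y ∈ B, y ∉ ({x, d, 0} : Finset G) → C.testBit (code y) = true)
    {k : ℕ → ℕ → ℕ → ℕ → Bool}
    (h : (addPoint M Mr A (code x) fun M Mr A =>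
      (fun E => forallBits (fun y C => addPoint M Mr A y fun M Mr A =>
        (fun E => forallBits (fun z _ => addPoint M Mr A z fun _ _ A => k (code x) y z A) 81
          (Nat.land (Nat.land C A) (Nat.land (Nat.shiftRight E (Nat.sub 171 (code d)))
            (Nat.land (Nat.shiftRight E (Nat.sub 171 (code x)))
              (Nat.shiftRight E (Nat.sub 171 y))))))
        (extendMask A)) 81
        (Nat.land (Nat.land C A) (Nat.land (Nat.shiftRight E (Nat.sub 171 (code d)))
          (Nat.shiftRight E (Nat.sub 171 (code x))))))
      (extendMask A)) = true) :
    ∃ y z A', ({z, y, x, d, 0} : Finset G) = B ∧ k (code x) (code y) (code z) A' = true ∧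
      IsMask A' (S \ diffSet B) := by
  have hP2 : ({d, 0} : Finset G) ⊆ B := by simp [Finset.insert_subset_iff, h0, hd]
  have hP3 : ({x, d, 0} : Finset G) ⊆ B := Finset.insert_subset hx hP2
  have c3 : ({x, d, 0} : Finset G).card = 3 := Finset.card_eq_three.mpr ⟨x, d, 0, hxd, hx0, hd0, rfl⟩
  obtain ⟨M, Mr, A, hs, h⟩ := hs.addPoint hB hBS hP2 hx (by simp [hx0, hxd]) h
  obtain ⟨y, hy, r, h, hr⟩ := forallBits_sound h (T := B \ {x, d, 0})
    (exists_mem_sdiff_of_card (by omega)) (by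
      intro y hy
      obtain ⟨hyB, hy⟩ := Finset.mem_sdiff.mp hy
      simp only [raw_and, Nat.testBit_and, Bool.and_eq_true]
      exact ⟨⟨hC y hyB hy, hs.testBit_avail hB hBS hP3 hyB hy (by simp)⟩,
        hs.testBit hB hBS hP3 hyB hy (by simp), hs.testBit hB hBS hP3 hyB hy (by simp)⟩)
  obtain ⟨hyB, hy⟩ := Finset.mem_sdiff.mp hy
  have hP4 : ({y, x, d, 0} : Finset G) ⊆ B := Finset.insert_subset hyB hP3
  have c4 : ({y, x, d, 0} : Finset G).card = 4 := by rw [Finset.card_insert_of_notMem hy, c3]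
  obtain ⟨M, Mr, A, hs, h⟩ := hs.addPoint hB hBS hP3 hyB hy h
  obtain ⟨z, hz, r', h, -⟩ := forallBits_sound h (T := B \ {y, x, d, 0})
    (exists_mem_sdiff_of_card (by omega)) (by
      intro z hz
      obtain ⟨hzB, hz⟩ := Finset.mem_sdiff.mp hz
      have hz' : z ∉ ({x, d, 0} : Finset G) ∧ z ≠ y := by
        simp only [Finset.mem_insert, not_or] at hz ⊢; tauto
      simp only [raw_and, Nat.testBit_and, Bool.and_eq_true]
      exact ⟨⟨hr z (Finset.mem_sdiff.mpr ⟨hzB, hz'.1⟩) hz'.2,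
        hs.testBit_avail hB hBS hP4 hzB hz (by simp)⟩,
        hs.testBit hB hBS hP4 hzB hz (by simp), hs.testBit hB hBS hP4 hzB hz (by simp),
        hs.testBit hB hBS hP4 hzB hz (by simp)⟩)
  obtain ⟨hzB, hz⟩ := Finset.mem_sdiff.mp hz
  have hP5 : ({z, y, x, d, 0} : Finset G) ⊆ B := Finset.insert_subset hzB hP4
  have c5 : ({z, y, x, d, 0} : Finset G).card = 5 := by rw [Finset.card_insert_of_notMem hz, c4]
  obtain ⟨M, Mr, A, hs, h⟩ := hs.addPoint hB hBS hP4 hzB hz h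
  have e := Finset.eq_of_subset_of_card_le hP5 (by omega)
  exact ⟨y, z, A, e, h, e ▸ hs.avail⟩

/-- The reflection `x ↦ d - x` exchanges `0` and `d` and keeps the differences, so it is enough that
the enumeration reaches the block or its reflection. -/
theorem forallBlocks_sound {A : ℕ} {S B : Finset G} {d : G} {k : ℕ → ℕ → ℕ → ℕ → Bool}
    (hA : IsMask A S) (hB : IsSidon B) (hBS : diffSet B ⊆ S) (hc : B.card = 5) (h0 : 0 ∈ B)
    (hd : d ∈ B) (hd0 : d ≠ 0) (h : forallBlocks (code d) A k = true) :
    ∃ x y z A', (({z, y, x, d, 0} : Finset G) = B ∨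
        ({z, y, x, d, 0} : Finset G) = B.image fun x => d - x) ∧
      k (code x) (code y) (code z) A' = true ∧ IsMask A' (S \ diffSet B) := by
  have hB' := hB.flip d
  have hBS' : diffSet (B.image fun x => d - x) ⊆ S := by rwa [diffSet_flip]
  have hc' : (B.image fun x => d - x).card = 5 := by
    rw [Finset.card_image_of_injective _ sub_right_injective, hc]
  have h0' : 0 ∈ B.image fun x => d - x := Finset.mem_image.mpr ⟨d, hd, sub_self d⟩
  have hd' : d ∈ B.image fun x => d - x := Finset.mem_image.mpr ⟨0, h0, sub_zero d⟩
  have hP : ({d, 0} : Finset G) ⊆ B := by simp [Finset.insert_subset_iff, h0, hd]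
  have hP' : ({d, 0} : Finset G) ⊆ B.image fun x => d - x :=
    Finset.insert_subset hd' (Finset.singleton_subset_iff.mpr h0')
  obtain ⟨M, Mr, A, hs, h⟩ := (isState_zero hA).addPoint hB hBS (by simpa using h0) hd
    (by simpa using hd0) h
  have hsym : ∀ x, x ∉ ({d, 0} : Finset G) → d - x ∉ ({d, 0} : Finset G) := by
    intro x hx
    simp only [Finset.mem_insert, Finset.mem_singleton, not_or] at hx ⊢
    refine ⟨fun e => hx.2 ?_, fun e => hx.1 (sub_eq_zero.mp e).symm⟩
    simpa using e
  obtain ⟨x, r, hx, h, hr⟩ := forallBitsFlip_sound h (T := B \ {d, 0})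
    (exists_mem_sdiff_of_card (lt_of_le_of_lt Finset.card_le_two (by omega))) (by
      intro x hx
      obtain ⟨hxB, hx⟩ := Finset.mem_sdiff.mp hx
      have hxB' : d - x ∈ B.image fun x => d - x := Finset.mem_image_of_mem _ hxB
      simp only [raw_and, Nat.testBit_and, Bool.and_eq_true]
      exact ⟨⟨hs.testBit_avail hB hBS hP hxB hx (by simp), hs.testBit hB hBS hP hxB hx (by simp)⟩,
        hs.testBit_avail hB' hBS' hP' hxB' (hsym x hx) (by simp),
        hs.testBit hB' hBS' hP' hxB' (hsym x hx) (by simp)⟩) (by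
      intro n hn
      simp only [raw_and, Nat.testBit_and, Bool.and_eq_true] at hn
      obtain ⟨x, -, e⟩ := (hs.avail n).mp hn.1
      exact ⟨x, e⟩)
  -- The partner `d - x` of a point of the block is never in the block, since `x - 0 = d - (d - x)`
  -- would be a repeated difference. So removing it loses no later point.
  have hflip : ∀ B : Finset G, IsSidon B → 0 ∈ B → d ∈ B → x ∈ B → x ≠ d → x ≠ 0 → d - x ∉ B := by
    intro B hB h0 hd hxB hxd hx0 hm
    exact hxd (hB.eq hxB h0 hd hm hx0 (by abel)).1
  rcases hx with hx | hx
  · obtain ⟨hxB, hx⟩ := Finset.mem_sdiff.mp hx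
    simp only [Finset.mem_insert, Finset.mem_singleton, not_or] at hx
    obtain ⟨y, z, A', e, h⟩ := forallBits_blocks_sound hB hBS hc h0 hd hd0 hxB hx.2 hx.1 hs
      (fun y hyB hy => by
        simp only [Finset.mem_insert, Finset.mem_singleton, not_or] at hy
        refine (hr y (by simp [hyB, hy]) hy.1 ?_).1
        rintro rfl
        exact hflip B hB h0 hd hxB hx.1 hx.2 hyB) h
    exact ⟨x, y, z, A', Or.inl e, h⟩
  · obtain ⟨hxB, hx⟩ := Finset.mem_sdiff.mp hx
    have hx' := hsym _ hx
    rw [sub_sub_cancel] at hx'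
    simp only [Finset.mem_insert, Finset.mem_singleton, not_or] at hx'
    have hxB' : x ∈ B.image fun x => d - x := Finset.mem_image.mpr ⟨_, hxB, sub_sub_cancel d x⟩
    obtain ⟨y, z, A', e, h⟩ := forallBits_blocks_sound hB' hBS' hc' h0' hd' hd0 hxB' hx'.2 hx'.1 hs
      (fun y hyB hy => by
        simp only [Finset.mem_insert, Finset.mem_singleton, not_or] at hy
        obtain ⟨w, hw, rfl⟩ := Finset.mem_image.mp hyB
        refine (hr w ?_ ?_ ?_).2
        · refine Finset.mem_sdiff.mpr ⟨hw, ?_⟩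
          have := hsym (d - w) (by simp [hy.2.1, hy.2.2])
          rwa [sub_sub_cancel] at this
        · rintro rfl
          exact hflip _ hB' h0' hd' hxB' hx'.1 hx'.2 hyB
        · rintro rfl
          exact hy.1 (sub_sub_cancel d x)) h
    exact ⟨x, y, z, A', Or.inr e, h.1, by simpa [diffSet_flip] using h.2⟩

/-! ### The positivity bound -/

/-- An integer approximation of `4 cos (2 π t / 9)`. -/
def wave : ZMod 9 → ℤ := ![4, 3, 1, -2, -4, -4, -2, 1, 3]

/-- The number `76 - ∑ t, wave t * wave (t + k)`. -/
def weight (n : ℕ) : ℕ := Nat.mod (Nat.shiftRight 85585727953625323152384 (Nat.mul 9 n)) 512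

/-- The pairing of `ℤ/9 × ℤ/9` with itself. -/
def pairing (χ x : G) : ZMod 9 := χ.1 * x.1 + χ.2 * x.2

theorem pairing_sub (χ x y : G) : pairing χ (x - y) = pairing χ x - pairing χ y := by
  simp only [pairing, Prod.fst_sub, Prod.snd_sub]; ring

theorem weight_eq : ∀ k : ZMod 9, (weight k.val : ℤ) = 76 - ∑ t, wave t * wave (t + k) := by
  decide

theorem weight_neg : ∀ k : ZMod 9, weight (-k).val = weight k.val := by decide

/-- The defect is a sum of squares; 76 is the sum of the squares of `wave`. Any integer function
would give such a bound, and one close to a cosine imitates the nonnegativity of `|∑ x ∈ B, χ x| ^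
2` for complex characters. -/
theorem sum_weight_le (χ : G) (B : Finset G) :
    ∑ x ∈ B, ∑ y ∈ B, weight (pairing χ (x - y)).val ≤ 76 * B.card ^ 2 := by
  have h1 : ((∑ x ∈ B, ∑ y ∈ B, weight (pairing χ (x - y)).val : ℕ) : ℤ) =
      76 * (B.card : ℤ) ^ 2 - ∑ t, (∑ x ∈ B, wave (t + pairing χ x)) ^ 2 := by
    have h2 : ∀ x y : G, ∑ t, wave t * wave (t + pairing χ (x - y)) =
        ∑ t, wave (t + pairing χ x) * wave (t + pairing χ y) := by
      intro x y
      -- Replacing `t` by `t + pairing χ y` turns the correlation at `pairing χ (x - y)` into a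
      -- product of a factor for `x` and a factor for `y`.
      rw [← Equiv.sum_comp (Equiv.addRight (pairing χ y))]
      refine Finset.sum_congr rfl fun t _ => ?_
      rw [pairing_sub, Equiv.coe_addRight, mul_comm, add_assoc, add_sub_cancel]
    have h3 : ∑ t, (∑ x ∈ B, wave (t + pairing χ x)) ^ 2 = ∑ x ∈ B, ∑ y ∈ B, ∑ t,
        wave (t + pairing χ x) * wave (t + pairing χ y) := by
      simp only [sq, Finset.sum_mul_sum]
      rw [Finset.sum_comm]
      exact Finset.sum_congr rfl fun x _ => Finset.sum_comm
    rw [h3]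
    push_cast
    simp only [weight_eq, h2, Finset.sum_sub_distrib, Finset.sum_const, nsmul_eq_mul]
    ring
  have h3 : 0 ≤ ∑ t, (∑ x ∈ B, wave (t + pairing χ x)) ^ 2 :=
    Finset.sum_nonneg fun t _ => sq_nonneg _
  have h4 : ((∑ x ∈ B, ∑ y ∈ B, weight (pairing χ (x - y)).val : ℕ) : ℤ) ≤
      ((76 * B.card ^ 2 : ℕ) : ℤ) := by
    rw [h1]; push_cast; linarith
  exact_mod_cast h4

/-- The total weight of a set of differences. -/
def totalWeight (S : Finset G) (χ : G) : ℕ := ∑ d ∈ S, weight (pairing χ d).val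

theorem sum_offDiag_weight (B : Finset G) (χ : G) :
    ∑ z ∈ B.offDiag, weight (pairing χ (z.1 - z.2)).val =
      ∑ x ∈ B, ∑ y ∈ B, weight (pairing χ (x - y)).val := by
  rw [← Finset.sum_product', ← Finset.diag_union_offDiag,
    Finset.sum_union (Finset.disjoint_diag_offDiag B)]
  have : ∑ z ∈ B.diag, weight (pairing χ (z.1 - z.2)).val = 0 := by
    refine Finset.sum_eq_zero fun z hz => ?_
    rw [(Finset.mem_diag.mp hz).2, sub_self]
    simp [pairing]; rfl
  rw [this, zero_add]

theorem totalWeight_diffSet {B : Finset G} (hB : IsSidon B) (χ : G) :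
    totalWeight (diffSet B) χ = ∑ x ∈ B, ∑ y ∈ B, weight (pairing χ (x - y)).val := by
  rw [totalWeight, diffSet, Finset.sum_image hB, sum_offDiag_weight]

theorem totalWeight_sdiff {S T : Finset G} (h : T ⊆ S) (χ : G) :
    totalWeight (S \ T) χ + totalWeight T χ = totalWeight S χ :=
  Finset.sum_sdiff h

/-! ### Packed vectors of weights -/

/-- The numbers of representatives of the nonzero characters up to sign. -/
def characters : List ℕ :=
  [1, 2, 3, 4, 18, 19, 20, 21, 22, 23, 24, 25, 26, 36, 37, 38, 39, 40, 41, 42, 43, 44, 54, 55, 56,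
    57, 58, 59, 60, 61, 62, 72, 73, 74, 75, 76, 77, 78, 79, 80]

/-- Pack a family of numbers into fields of `14` bits. -/
def pack (f : ℕ → ℕ) (l : List ℕ) : ℕ :=
  List.rec 0 (fun c _ ih => Nat.add (f c) (Nat.mul 16384 ih)) l

theorem pack_nil (f : ℕ → ℕ) : pack f [] = 0 := rfl

theorem pack_cons (f : ℕ → ℕ) (c : ℕ) (l : List ℕ) :
    pack f (c :: l) = f c + 16384 * pack f l := rfl

/-- An identity of numbers that needs no bound on the entries; it lets one addition or subtraction
treat all characters at once. -/
theorem pack_add (f g : ℕ → ℕ) (l : List ℕ) :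
    pack (fun c => f c + g c) l = pack f l + pack g l := by
  induction l with
  | nil => rfl
  | cons c l ih => simp only [pack_cons, ih]; ring

theorem pack_const_mul (a b : ℕ) (l : List ℕ) :
    pack (fun _ => a * b) l = pack (fun _ => a) l * b := by
  induction l with
  | nil => simp [pack_nil]
  | cons c l ih => simp only [pack_cons, ih]; ring

theorem pack_congr {f g : ℕ → ℕ} {l : List ℕ} (h : ∀ c ∈ l, f c = g c) : pack f l = pack g l := by
  induction l with
  | nil => rfl
  | cons c l ih =>
    simp only [pack_cons, h c (by simp), ih fun d hd => h d (by simp [hd])]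

/-- 8192 = 2 ^ 13 is the top bit of a field of 14 bits, and it is clear in every entry below 8192.
-/
theorem pack_and_eq_zero {f : ℕ → ℕ} {l : List ℕ} (h : ∀ c ∈ l, f c < 8192) :
    pack f l &&& pack (fun _ => 8192) l = 0 := by
  induction l with
  | nil => exact Nat.zero_and 0
  | cons c l ih =>
    have ih := ih fun d hd => h d (by simp [hd])
    have hc := h c (by simp)
    apply Nat.eq_of_testBit_eq
    intro n
    rw [Nat.testBit_and, pack_cons, pack_cons, Nat.zero_testBit, add_comm, add_comm 8192,
      show (16384 : ℕ) = 2 ^ 14 from rfl, Nat.testBit_two_pow_mul_add _ (by omega),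
      Nat.testBit_two_pow_mul_add _ (by norm_num)]
    split_ifs with hn
    · rw [show (8192 : ℕ) = 2 ^ 13 from rfl, Nat.testBit_two_pow]
      by_cases e : 13 = n
      · subst e
        rw [Nat.testBit_lt_two_pow (by omega)]; rfl
      · simp [e]
    · rw [← Nat.testBit_and, ih, Nat.zero_testBit]

/-- The packed weights of a difference, given the absolute value of a difference of numbers. -/
def packedWeight (i : ℕ) : ℕ :=
  (fun a b => pack (fun c => Nat.mul 2 (weight (Nat.mod
    (Nat.add (Nat.mul (Nat.div c 18) a) (Nat.mul (Nat.mod c 18) b)) 9))) characters)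
    (Nat.div (Nat.add i 8) 18) (Nat.add (Nat.mod (Nat.add i 8) 18) 1)

/-- Evaluate `f` at a number that is first brought into normal form, so that the kernel finds
earlier evaluations in its cache. -/
def memo {α : Type} (f : ℕ → α) (i : ℕ) : α := Nat.rec (f 0) (fun m _ => f (Nat.succ m)) i

theorem memo_eq {α : Type} (f : ℕ → α) (i : ℕ) : memo f i = f i := by cases i <;> rfl

/-- The packed weights of the differences `x - y` and `y - x`. -/
def pairWeight (x y : ℕ) : ℕ := memo packedWeight (Nat.add (Nat.sub x y) (Nat.sub y x))

/-- The packed weights of all differences in the block `{0, d, x, y, z}`. -/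
def blockWeight (d x y z : ℕ) : ℕ :=
  Nat.add (Nat.add (Nat.add (Nat.add (pairWeight d 0) (pairWeight x 0))
      (Nat.add (pairWeight x d) (pairWeight y 0)))
    (Nat.add (Nat.add (pairWeight y d) (pairWeight y x))
      (Nat.add (pairWeight z 0) (pairWeight z d))))
    (Nat.add (pairWeight z x) (pairWeight z y))

theorem weight_code (c : ℕ) (d : G) {a b : ℕ} (ha : (a : ZMod 9) = d.1) (hb : (b : ZMod 9) = d.2) :
    weight (Nat.mod (Nat.add (Nat.mul (Nat.div c 18) a) (Nat.mul (Nat.mod c 18) b)) 9) =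
      weight (pairing (point c) d).val := by
  congr 1
  rw [pairing, point, ← ha, ← hb, ← Nat.cast_mul, ← Nat.cast_mul, ← Nat.cast_add, ZMod.val_natCast]
  rfl

theorem packedWeight_eq (i : ℕ) : packedWeight i = pack (fun c => 2 * weight (Nat.mod
    (Nat.add (Nat.mul (Nat.div c 18) ((i + 8) / 18))
      (Nat.mul (Nat.mod c 18) ((i + 8) % 18 + 1))) 9)) characters := rfl

/-- The second digits differ by at least -8, so after adding 8 to the difference of the numbers both
digits can be read off without a borrow. The further 1 in `packedWeight` makes the shift 9, which
vanishes modulo 9. -/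
theorem packedWeight_of_le {x y : G} (h : code y ≤ code x) :
    packedWeight (code x - code y) =
      pack (fun c => 2 * weight (pairing (point c) (x - y)).val) characters := by
  have hx := ZMod.val_lt x.2
  have hy := ZMod.val_lt y.2
  have hx' := ZMod.val_lt x.1
  have hy' := ZMod.val_lt y.1
  obtain ⟨a, ha⟩ : ∃ a, x.1.val = y.1.val + a := by
    refine ⟨x.1.val - y.1.val, ?_⟩
    simp only [code] at h; omega
  obtain ⟨b, hb⟩ : ∃ b, x.2.val + 8 = y.2.val + b := ⟨x.2.val + 8 - y.2.val, by omega⟩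
  have e : code x - code y + 8 = 18 * a + b := by simp only [code] at h ⊢; omega
  have e1 : (code x - code y + 8) / 18 = a := by omega
  have e2 : (code x - code y + 8) % 18 = b := by omega
  rw [packedWeight_eq, e1, e2]
  refine pack_congr fun c _ => congrArg (2 * ·) (weight_code c (x - y) ?_ ?_)
  · have := congrArg (Nat.cast : ℕ → ZMod 9) ha
    simp only [Nat.cast_add, ZMod.natCast_val, ZMod.cast_id', id] at this
    rw [Prod.fst_sub, this]; ring
  · have := congrArg (Nat.cast : ℕ → ZMod 9) hb
    simp only [Nat.cast_add, ZMod.natCast_val, ZMod.cast_id', id] at this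
    rw [Prod.snd_sub, Nat.cast_add, eq_sub_iff_add_eq]
    have h9 : ((8 : ℕ) : ZMod 9) + 1 = 0 := by decide
    linear_combination h9 - this

theorem pairWeight_code (x y : G) : pairWeight (code x) (code y) =
    pack (fun c => 2 * weight (pairing (point c) (x - y)).val) characters := by
  rw [pairWeight, memo_eq, raw_add, raw_sub, raw_sub]
  rcases le_total (code y) (code x) with h | h
  · rw [Nat.sub_eq_zero_of_le h, add_zero, packedWeight_of_le h]
  · rw [Nat.sub_eq_zero_of_le h, zero_add, packedWeight_of_le h]
    refine pack_congr fun c _ => ?_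
    rw [← neg_sub x y, pairing, pairing, Prod.fst_neg, Prod.snd_neg, mul_neg, mul_neg, ← neg_add,
      weight_neg]

/-- The twenty differences come from ten pairs of points. Each pair counts twice because `weight` is
even, which is the factor 2 in `packedWeight`. -/
theorem blockWeight_code {d x y z : G} {B : Finset G} (hB : IsSidon B) (hc : B.card = 5)
    (e : ({z, y, x, d, 0} : Finset G) = B) :
    blockWeight (code d) (code x) (code y) (code z) =
      pack (fun c => totalWeight (diffSet B) (point c)) characters := by
  have h0 : code (0 : G) = 0 := rfl
  have hp : ∀ x : G, pairWeight (code x) 0 =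
      pack (fun c => 2 * weight (pairing (point c) x).val) characters := by
    intro x
    rw [← h0, pairWeight_code, sub_zero]
  simp only [blockWeight, hp, pairWeight_code, raw_add, ← pack_add]
  refine pack_congr fun c _ => ?_
  rw [totalWeight_diffSet hB]
  obtain ⟨h1, h2, h3, h4⟩ : z ∉ ({y, x, d, 0} : Finset G) ∧ y ∉ ({x, d, 0} : Finset G) ∧
      x ∉ ({d, 0} : Finset G) ∧ d ∉ ({0} : Finset G) := by
    have c5 : ({z, y, x, d, 0} : Finset G).card = 5 := by rw [e, hc]
    refine ⟨fun h => ?_, fun h => ?_, fun h => ?_, fun h => ?_⟩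
    · rw [Finset.insert_eq_of_mem h] at c5
      have := Finset.card_le_four (a := y) (b := x) (c := d) (d := 0); omega
    · rw [Finset.insert_eq_of_mem h] at c5
      have := Finset.card_le_four (a := z) (b := x) (c := d) (d := 0); omega
    · rw [Finset.insert_eq_of_mem h] at c5
      have := Finset.card_le_four (a := z) (b := y) (c := d) (d := 0); omega
    · rw [Finset.insert_eq_of_mem h] at c5
      have := Finset.card_le_four (a := z) (b := y) (c := x) (d := 0); omega
  have hw : ∀ x y : G, weight (pairing (point c) (y - x)).val =
      weight (pairing (point c) (x - y)).val := by
    intro x y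
    rw [← weight_neg, pairing_sub, pairing_sub, neg_sub]
  have hw0 : weight (pairing (point c) 0).val = 0 := by simp [pairing]; rfl
  rw [← e]
  simp only [Finset.sum_insert h1, Finset.sum_insert h2, Finset.sum_insert h3,
    Finset.sum_insert h4, Finset.sum_singleton, sub_self, hw0, zero_add, add_zero,
    hw z y, hw z x, hw z d, hw z 0, hw y x, hw y d, hw y 0, hw x d, hw x 0, hw d 0, sub_zero]
  ring

/-! ### The search -/

/-- Nonzero if some entry of the packed vector `acc` exceeds `1900 * r`. -/
def overflow (r acc : ℕ) : ℕ :=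
  Nat.land (Nat.add acc (Nat.mul
    230358446244371687251514043886239937185919625246685004478801580922030407275355481418917580734765230271712651836096187810521307735452895845239665156041793080855117825
    (Nat.sub 8191 (Nat.mul 1900 r))))
    1887096391633892861964403047516077565427053570020843556690342550913273096399712103783772821379196766385870043841299970543790552968830122764203336958294368918365125222400

/-- Adding `8191 - 1900 * r` keeps an entry of at most `1900 * r` below the top bit of its field.
For `r ≤ 4` the truncated subtraction is exact. -/
theorem overflow_eq_zero {f : ℕ → ℕ} {r : ℕ} (hr : r ≤ 4) (h : ∀ c ∈ characters, f c ≤ 1900 * r) :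
    overflow r (pack f characters) = 0 := by
  have e1 : 230358446244371687251514043886239937185919625246685004478801580922030407275355481418917580734765230271712651836096187810521307735452895845239665156041793080855117825 =
      pack (fun _ => 1) characters := by decide +kernel
  have e2 : 1887096391633892861964403047516077565427053570020843556690342550913273096399712103783772821379196766385870043841299970543790552968830122764203336958294368918365125222400 =
      pack (fun _ => 8192) characters := by decide +kernel
  rw [overflow, e1, e2, raw_and, raw_add, raw_mul, raw_sub, raw_mul, ← pack_const_mul, ← pack_add]
  refine pack_and_eq_zero fun c hc => ?_
  have := h c hc
  omega

/-- Some element of the mask `A`, of order `3` if possible. -/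
def pick (A : ℕ) : ℕ :=
  ifZero (Nat.land A 23689854417065152370221480694251592) (someBit A)
    (someBit (Nat.land A 23689854417065152370221480694251592))

/-- Test `fin` on all families of blocks that extend the list `bs` by `r` blocks, whose differences
are the elements of the mask `A`; the packed total weight of these elements is `acc`. -/
def search (fin : List (List ℕ) → Bool) (r : ℕ) : List (List ℕ) → ℕ → ℕ → Bool :=
  Nat.rec (fun bs _ _ => fin bs)
    (fun r ih bs A acc => (fun d => ifZero (Nat.land A (Nat.shiftLeft 1 d)) false
      (forallBlocks d A fun x y z A' =>
        (fun acc' => ifZero (overflow r acc') (ih ([z, y, x, d, 0] :: bs) A' acc') true)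
          (Nat.sub acc (blockWeight d x y z))))
      (pick A)) r

/-! ### Partial families and completeness of the search. -/

/-- The family `R` has blocks with five elements and its differences are the elements of `S`, each
of them once. -/
structure IsCover (R : Multiset (Finset G)) (S : Finset G) : Prop where
  card : ∀ B ∈ R, B.card = 5
  sidon : ∀ B ∈ R, IsSidon B
  bind : R.bind (fun B => (diffSet B).val) = S.val

theorem IsCover.diffSet_subset {R : Multiset (Finset G)} {S : Finset G} (h : IsCover R S)
    {B : Finset G} (hB : B ∈ R) : diffSet B ⊆ S := by
  intro d hd
  rw [← Finset.mem_val, ← h.bind, Multiset.mem_bind]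
  exact ⟨B, hB, hd⟩

theorem IsCover.exists_mem {R : Multiset (Finset G)} {S : Finset G} (h : IsCover R S) {d : G}
    (hd : d ∈ S) : ∃ B ∈ R, d ∈ diffSet B := by
  rw [← Finset.mem_val, ← h.bind, Multiset.mem_bind] at hd
  exact hd

theorem IsCover.of_cons {R : Multiset (Finset G)} {B S : Finset G} (h : IsCover (B ::ₘ R) S) :
    IsCover R (S \ diffSet B) where
  card := fun C hC => h.card C (Multiset.mem_cons_of_mem hC)
  sidon := fun C hC => h.sidon C (Multiset.mem_cons_of_mem hC)
  bind := by
    have := h.bind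
    rw [Multiset.cons_bind] at this
    rw [Finset.sdiff_val, ← this, add_tsub_cancel_left]

/-- The total weight is additive over the blocks, and each contributes at most 76 · 5² = 1900. -/
theorem IsCover.totalWeight_le {R : Multiset (Finset G)} {S : Finset G} (h : IsCover R S) (χ : G) :
    totalWeight S χ ≤ 1900 * Multiset.card R := by
  induction R using Multiset.induction_on generalizing S with
  | empty =>
    have : S = ∅ := by
      have := h.bind
      rw [Multiset.zero_bind] at this
      exact Finset.val_eq_zero.mp this.symm
    simp [this, totalWeight]
  | cons B R ih =>
    have h1 := ih h.of_cons
    have h2 := totalWeight_sdiff (h.diffSet_subset (Multiset.mem_cons_self B R)) χ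
    have h3 := sum_weight_le χ B
    rw [← totalWeight_diffSet (h.sidon B (Multiset.mem_cons_self B R)),
      h.card B (Multiset.mem_cons_self B R)] at h3
    rw [Multiset.card_cons]
    omega

/-- The set of elements with the given numbers. -/
def points (l : List ℕ) : Finset G := (l.map point).toFinset

theorem mem_points {l : List ℕ} {x : G} : x ∈ points l ↔ ∃ n ∈ l, point n = x := by
  simp only [points, List.mem_toFinset, List.mem_map]

/-- `C` is the image of `B` under a translation or a reflection. -/
def IsSimilar (B C : Finset G) : Prop :=
  ∃ g, C = B.image (fun x => x + g) ∨ C = B.image fun x => g - x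

theorem IsSidon.translate {B : Finset G} (h : IsSidon B) (g : G) :
    IsSidon (B.image fun x => x - g) := by
  rintro ⟨a, b⟩ hab ⟨a', b'⟩ hab' e
  simp only [Finset.mem_coe, Finset.mem_offDiag, Finset.mem_image] at hab hab'
  obtain ⟨⟨x, hx, rfl⟩, ⟨y, hy, rfl⟩, hxy⟩ := hab
  obtain ⟨⟨x', hx', rfl⟩, ⟨y', hy', rfl⟩, -⟩ := hab'
  have hne : x ≠ y := by rintro rfl; exact hxy rfl
  obtain ⟨rfl, rfl⟩ := h.eq hx hy hx' hy' hne (by simpa using e)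
  rfl

theorem diffSet_translate (B : Finset G) (g : G) : diffSet (B.image fun x => x - g) = diffSet B := by
  ext e
  simp only [mem_diffSet, Finset.mem_image]
  constructor
  · rintro ⟨_, ⟨x, hx, rfl⟩, _, ⟨y, hy, rfl⟩, hxy, rfl⟩
    exact ⟨x, hx, y, hy, by rintro rfl; exact hxy rfl, by abel⟩
  · rintro ⟨x, hx, y, hy, hxy, rfl⟩
    exact ⟨_, ⟨x, hx, rfl⟩, _, ⟨y, hy, rfl⟩, fun e => hxy (sub_left_injective e), by abel⟩

/-- The picked difference is `p - q` for two points of some remaining block `B`, so `B - q` contains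
`0` and `p - q`, and the enumeration meets it or its reflection. Hence the recorded lists describe
the blocks only up to `IsSimilar`, which does not affect the differences. -/
theorem search_sound {fin : List (List ℕ) → Bool} {Good : Multiset (Finset G) → Prop}
    (hfin : ∀ (bs : List (List ℕ)) (Cs : List (Finset G)), fin bs = true →
      List.Forall₂ (fun l C => IsSimilar (points l) C) bs Cs → Good Cs)
    {r : ℕ} (hr : r ≤ 4) {bs : List (List ℕ)} {A acc : ℕ} (h : search fin r bs A acc = true)
    {R : Multiset (Finset G)} {S : Finset G} (hR : IsCover R S) (hcard : Multiset.card R = r)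
    (hS : 0 ∉ S) (hA : IsMask A S)
    (hacc : acc = pack (fun c => totalWeight S (point c)) characters) {Cs : List (Finset G)}
    (hCs : List.Forall₂ (fun l C => IsSimilar (points l) C) bs Cs) : Good (Cs + R) := by
  induction r generalizing bs A acc R S Cs with
  | zero =>
    obtain rfl := Multiset.card_eq_zero.mp hcard
    rw [add_zero]
    exact hfin bs Cs h hCs
  | succ r ih =>
    have h' : ifZero (Nat.land A (Nat.shiftLeft 1 (pick A))) false
      (forallBlocks (pick A) A fun x y z A' =>
        ifZero (overflow r (Nat.sub acc (blockWeight (pick A) x y z)))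
          (search fin r ([z, y, x, pick A, 0] :: bs) A'
            (Nat.sub acc (blockWeight (pick A) x y z))) true) = true := h
    have hbit : Nat.land A (Nat.shiftLeft 1 (pick A)) ≠ 0 := by
      intro e; rw [e] at h'; exact Bool.noConfusion h'
    rw [ifZero_of_ne hbit] at h'
    have hx : A.testBit (pick A) = true := by
      by_contra hf
      apply hbit
      rw [raw_and, raw_shiftLeft, Nat.shiftLeft_eq, one_mul]
      apply Nat.eq_of_testBit_eq
      intro n
      rw [Nat.testBit_and, Nat.testBit_two_pow, Nat.zero_testBit]
      by_cases e : pick A = n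
      · subst e; simpa using hf
      · simp [e]
    obtain ⟨d, hd, e⟩ := (hA _).mp hx
    rw [← e] at h'
    obtain ⟨B, hBR, hdB⟩ := hR.exists_mem hd
    obtain ⟨R, rfl⟩ := Multiset.exists_cons_of_mem hBR
    obtain ⟨p, hp, q, hq, hpq, rfl⟩ := mem_diffSet.mp hdB
    have hsid := (hR.sidon B hBR).translate q
    have hds := diffSet_translate B q
    have hc : (B.image fun x => x - q).card = 5 := by
      rw [Finset.card_image_of_injective _ sub_left_injective, hR.card B hBR]
    obtain ⟨x, y, z, A', hB, hk, hA'⟩ := forallBlocks_sound hA hsid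
      (by rw [hds]; exact hR.diffSet_subset hBR) hc
      (Finset.mem_image.mpr ⟨q, hq, sub_self q⟩) (Finset.mem_image_of_mem _ hp)
      (sub_ne_zero.mpr hpq) h'
    have hbw : blockWeight (code (p - q)) (code x) (code y) (code z) =
        pack (fun c => totalWeight (diffSet B) (point c)) characters := by
      rcases hB with hB | hB
      · rw [blockWeight_code hsid hc hB, hds]
      · rw [blockWeight_code (hsid.flip (p - q))
          (by rw [Finset.card_image_of_injective _ sub_right_injective, hc]) hB, diffSet_flip, hds]
    have hacc' : Nat.sub acc (blockWeight (code (p - q)) (code x) (code y) (code z)) =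
        pack (fun c => totalWeight (S \ diffSet B) (point c)) characters := by
      rw [raw_sub, hbw, hacc]
      apply Nat.sub_eq_of_eq_add
      rw [← pack_add]
      exact pack_congr fun c _ => (totalWeight_sdiff (hR.diffSet_subset hBR) _).symm
    rw [Multiset.card_cons, add_left_inj] at hcard
    -- The pruning does not discard an actual family, because the blocks that remain satisfy the
    -- positivity bound.
    have hov : overflow r (Nat.sub acc (blockWeight (code (p - q)) (code x) (code y) (code z))) =
        0 := by
      rw [hacc']
      exact overflow_eq_zero (by omega) fun c _ => hcard ▸ hR.of_cons.totalWeight_le _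
    rw [hov, ifZero_zero] at hk
    have hpts : points [code z, code y, code x, code (p - q), 0] = {z, y, x, p - q, 0} := by
      simp only [points, List.map_cons, List.map_nil, point_code, List.toFinset_cons,
        List.toFinset_nil, show point 0 = 0 from rfl]
      rfl
    have hsim : IsSimilar (points [code z, code y, code x, code (p - q), 0]) B := by
      rw [hpts]
      have hBq : B = (B.image fun x => x - q).image fun x => x + q := by
        rw [Finset.image_image]
        conv_lhs => rw [← Finset.image_id (s := B)]
        congr 1
        funext w
        simp
      rcases hB with hB | hB
      · exact ⟨q, Or.inl (by rw [hB]; exact hBq)⟩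
      · refine ⟨p - q + q, Or.inr ?_⟩
        rw [hB, Finset.image_image, Finset.image_image]
        conv_lhs => rw [← Finset.image_id (s := B)]
        congr 1
        funext w
        simp only [id, Function.comp]
        abel
    have := ih (by omega) hk hR.of_cons hcard (fun h0 => hS (Finset.mem_sdiff.mp h0).1)
      (hds ▸ hA') hacc' (List.Forall₂.cons hsim hCs)
    rwa [← Multiset.cons_coe, Multiset.cons_add, ← Multiset.add_cons] at this

/-- The defining property of difference families, in terms of sets of differences. -/
theorem isCover_of_isDifferenceFamily {F : Multiset (Finset G)} (h : IsDifferenceFamily 5 1 F) :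
    IsCover F (Finset.univ.erase 0) := by
  have hle : ∀ B ∈ F, ∀ d ≠ 0, ((B ×ˢ B).filter fun z : G × G => z.1 - z.2 = d).card ≤ 1 := by
    intro B hB d hd
    rw [← h.2 d hd]
    exact Multiset.single_le_sum (fun _ _ => Nat.zero_le _) _ (Multiset.mem_map_of_mem _ hB)
  have hs : ∀ B ∈ F, IsSidon B := by
    intro B hB z hz w hw e
    obtain ⟨hz1, hz2, hz3⟩ := Finset.mem_offDiag.mp hz
    obtain ⟨hw1, hw2, hw3⟩ := Finset.mem_offDiag.mp hw
    exact Finset.card_le_one.mp (hle B hB _ (sub_ne_zero.mpr hz3)) z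
      (by simp [hz1, hz2]) w (by rw [Finset.mem_filter]; exact ⟨by simp [hw1, hw2], e.symm⟩)
  refine ⟨h.1, hs, ?_⟩
  ext d
  rw [Multiset.count_bind]
  by_cases hd : d = 0
  · subst hd
    have h1 : Multiset.count 0 (Finset.univ.erase (0 : G)).val = 0 := by
      rw [Multiset.count_eq_zero, Finset.mem_val]; simp
    rw [h1, Multiset.sum_eq_zero_iff]
    intro n hn
    obtain ⟨B, -, rfl⟩ := Multiset.mem_map.mp hn
    rw [Multiset.count_eq_zero, Finset.mem_val, mem_diffSet]
    rintro ⟨x, -, y, -, hxy, e⟩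
    exact hxy (sub_eq_zero.mp e)
  · have h1 : Multiset.count d (Finset.univ.erase (0 : G)).val = 1 :=
      Multiset.count_eq_one_of_mem (Finset.nodup _) (Finset.mem_val.mpr (by simp [hd]))
    rw [h1, ← h.2 d hd]
    congr 1
    refine Multiset.map_congr rfl fun B hB => ?_
    by_cases hdB : d ∈ diffSet B
    · rw [Multiset.count_eq_one_of_mem (Finset.nodup _) hdB]
      refine le_antisymm (Finset.card_pos.mpr ?_) (hle B hB d hd)
      obtain ⟨x, hx, y, hy, -, e⟩ := mem_diffSet.mp hdB
      exact ⟨(x, y), by simp [hx, hy, e]⟩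
    · rw [Multiset.count_eq_zero.mpr hdB, eq_comm, Finset.card_eq_zero,
        Finset.filter_eq_empty_iff]
      rintro ⟨x, y⟩ hxy e
      rw [Finset.mem_product] at hxy
      apply hdB
      refine mem_diffSet.mpr ⟨x, hxy.1, y, hxy.2, ?_, e⟩
      rintro rfl
      exact hd (by rw [← e, sub_self])

/-! ### Linear maps -/

/-- The endomorphism of `ℤ/9 × ℤ/9` with `(1, 0) ↦ u` and `(0, 1) ↦ v`. -/
def linHom (u v : G) : G →+ G where
  toFun x := (x.1 * u.1 + x.2 * v.1, x.1 * u.2 + x.2 * v.2)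
  map_zero' := by simp
  map_add' x y := by ext <;> simp <;> ring

theorem linHom_apply (u v x : G) :
    linHom u v x = (x.1 * u.1 + x.2 * v.1, x.1 * u.2 + x.2 * v.2) := rfl

/-- The effect of `linHom` on numbers of elements. -/
def linCode (u v n : ℕ) : ℕ :=
  Nat.add
    (Nat.mul 18 (Nat.mod (Nat.add (Nat.mul (Nat.div n 18) (Nat.div u 18))
      (Nat.mul (Nat.mod n 18) (Nat.div v 18))) 9))
    (Nat.mod (Nat.add (Nat.mul (Nat.div n 18) (Nat.mod u 18))
      (Nat.mul (Nat.mod n 18) (Nat.mod v 18))) 9)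

theorem linCode_code (u v : ℕ) (x : G) :
    linCode u v (code x) = code (linHom (point u) (point v) x) := by
  have h1 := ZMod.val_lt x.1
  have h2 := ZMod.val_lt x.2
  have e1 : code x / 18 = x.1.val := by simp only [code]; omega
  have e2 : code x % 18 = x.2.val := by simp only [code]; omega
  have key : ∀ a b : ℕ, (x.1 * (a : ZMod 9) + x.2 * (b : ZMod 9)).val =
      (x.1.val * a + x.2.val * b) % 9 := by
    intro a b
    rw [← ZMod.val_natCast]
    congr 1
    push_cast
    simp
  simp only [linCode, raw_add, raw_mul, raw_mod, raw_div, e1, e2]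
  rw [code, linHom_apply, point, point, key, key]

/-- Whether the determinant of a linear map is a unit. -/
def isUnitDet (u v : ℕ) : Bool :=
  Nat.ble 1 (Nat.mod (Nat.add (Nat.mul (Nat.div u 18) (Nat.mod v 18))
    (Nat.mul 8 (Nat.mul (Nat.mod u 18) (Nat.div v 18)))) 3)

/-- The units modulo 9 are the residues not divisible by 3. -/
theorem exists_mul_eq_one : ∀ D : ZMod 9, D.val % 3 ≠ 0 → ∃ e, e * D = 1 := by decide

/-- Cramer's rule gives injectivity, and finiteness of the group gives the rest. -/
theorem exists_equiv_of_mul_det_eq_one {u v : G} {e : ZMod 9}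
    (h : e * (u.1 * v.2 - u.2 * v.1) = 1) : ∃ φ : G ≃+ G, ∀ x, φ x = linHom u v x := by
  have hinj : Function.Injective (linHom u v) := by
    rw [injective_iff_map_eq_zero]
    intro x hx
    rw [linHom_apply] at hx
    have h1 := congrArg Prod.fst hx
    have h2 := congrArg Prod.snd hx
    simp only [Prod.fst_zero, Prod.snd_zero] at h1 h2
    ext
    · rw [Prod.fst_zero]
      linear_combination (-x.1) * h + e * v.2 * h1 - e * v.1 * h2
    · rw [Prod.snd_zero]
      linear_combination (-x.2) * h - e * u.2 * h1 + e * u.1 * h2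
  exact ⟨AddEquiv.ofBijective (linHom u v) (Finite.injective_iff_bijective.mp hinj), fun x => rfl⟩

/-- Since 8 = -1 modulo 9, the number tested by `isUnitDet` is the determinant, and it is a unit
unless 3 divides it. -/
theorem exists_equiv_of_isUnitDet {u v : ℕ} (h : isUnitDet u v = true) :
    ∃ φ : G ≃+ G, ∀ x, φ x = linHom (point u) (point v) x := by
  have h1 := Nat.le_of_ble_eq_true h
  simp only [raw_add, raw_mul, raw_mod, raw_div] at h1
  obtain ⟨e, he⟩ := exists_mul_eq_one
    (((u / 18 * (v % 18) + 8 * (u % 18 * (v / 18)) : ℕ) : ZMod 9)) (by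
      rw [ZMod.val_natCast]; omega)
  refine exists_equiv_of_mul_det_eq_one (e := e) ?_
  rw [← he, point, point]
  push_cast
  have h9 : (8 : ZMod 9) = -1 := by decide
  rw [h9]; ring

/-! ### Matching of families of blocks -/

/-- The numbers in the list are numbers of elements. -/
def IsCodes (l : List ℕ) : Prop := ∀ n ∈ l, ∃ x : G, code x = n

/-- Whether the numbers in the list are numbers of elements. -/
def isCodes (l : List ℕ) : Bool := l.all fun n => grid.testBit n

theorem isCodes_sound {l : List ℕ} (h : isCodes l = true) : IsCodes l := by
  intro n hn
  exact (testBit_grid n).mp (List.all_eq_true.mp h n hn)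

/-- The bit mask of a list. -/
def maskOf (l : List ℕ) : ℕ := List.rec 0 (fun n _ ih => Nat.lor (Nat.shiftLeft 1 n) ih) l

theorem testBit_maskOf (l : List ℕ) (n : ℕ) : (maskOf l).testBit n = true ↔ n ∈ l := by
  induction l with
  | nil => simp [maskOf]
  | cons m l ih =>
    have : maskOf (m :: l) = 1 <<< m ||| maskOf l := rfl
    rw [this, Nat.testBit_or, Bool.or_eq_true, ih, Nat.shiftLeft_eq, one_mul, Nat.testBit_two_pow,
      List.mem_cons, decide_eq_true_eq, eq_comm]

/-- Whether the second list is a translate of the first. -/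
def isTranslate (b c : List ℕ) : Bool :=
  c.head?.any fun q => b.any fun p =>
    Nat.beq (maskOf (b.map fun x => subCode x p)) (maskOf (c.map fun x => subCode x q))

/-- If `b - p` and `c - q` have the same mask, the translation is by `q - p`. Fixing `q` as the head
of `c` loses nothing, since a translation onto `c` moves some point `p` of `b` to it. -/
theorem isTranslate_sound {b c : List ℕ} (hb : IsCodes b) (hc : IsCodes c)
    (h : isTranslate b c = true) : ∃ g, points c = (points b).image fun x => x + g := by
  obtain ⟨q, hq, h⟩ := Option.any_eq_true _ _ |>.mp h
  obtain ⟨p, hp, h⟩ := List.any_eq_true.mp h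
  have hqc : q ∈ c := List.mem_of_mem_head? hq
  have e := Nat.eq_of_beq_eq_true h
  obtain ⟨p, rfl⟩ := hb p hp
  obtain ⟨q, rfl⟩ := hc q hqc
  have key : ∀ (l : List ℕ) (p x : G), IsCodes l →
      ((maskOf (l.map fun x => subCode x (code p))).testBit (code (x - p)) = true ↔
        x ∈ points l) := by
    intro l p x hl
    rw [testBit_maskOf, List.mem_map, mem_points]
    constructor
    · rintro ⟨n, hn, e⟩
      obtain ⟨y, rfl⟩ := hl n hn
      rw [subCode_code, code_inj] at e
      exact ⟨_, hn, by rw [point_code]; exact sub_left_injective e⟩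
    · rintro ⟨n, hn, rfl⟩
      obtain ⟨y, rfl⟩ := hl n hn
      exact ⟨_, hn, by rw [subCode_code, point_code]⟩
  refine ⟨q - p, ?_⟩
  ext x
  rw [← key c q x hc, ← e, Finset.mem_image]
  constructor
  · intro hx
    refine ⟨x - q + p, ?_, by abel⟩
    rw [← key b p _ hb, add_sub_cancel_right]
    exact hx
  · rintro ⟨y, hy, rfl⟩
    rw [← key b p y hb] at hy
    rwa [show y + (q - p) - q = y - p by abel]

theorem isCodes_map_linCode {b : List ℕ} (hb : IsCodes b) (u v : ℕ) :
    IsCodes (b.map (linCode u v)) := by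
  intro n hn
  obtain ⟨m, hm, rfl⟩ := List.mem_map.mp hn
  obtain ⟨x, rfl⟩ := hb m hm
  exact ⟨_, (linCode_code u v x).symm⟩

theorem points_map_linCode {b : List ℕ} (hb : IsCodes b) (u v : ℕ) :
    points (b.map (linCode u v)) = (points b).image (linHom (point u) (point v)) := by
  ext y
  simp only [mem_points, Finset.mem_image, List.mem_map]
  constructor
  · rintro ⟨_, ⟨m, hm, rfl⟩, rfl⟩
    obtain ⟨x, rfl⟩ := hb m hm
    exact ⟨_, ⟨_, hm, rfl⟩, by rw [linCode_code, point_code, point_code]⟩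
  · rintro ⟨_, ⟨m, hm, rfl⟩, rfl⟩
    obtain ⟨x, rfl⟩ := hb m hm
    exact ⟨_, ⟨_, hm, rfl⟩, by rw [linCode_code, point_code, point_code]⟩

theorem isCodes_map_neg {b : List ℕ} (hb : IsCodes b) : IsCodes (b.map (subCode 0)) := by
  intro n hn
  obtain ⟨m, hm, rfl⟩ := List.mem_map.mp hn
  obtain ⟨x, rfl⟩ := hb m hm
  exact ⟨_, (subCode_code 0 x).symm⟩

theorem points_map_neg {b : List ℕ} (hb : IsCodes b) :
    points (b.map (subCode 0)) = (points b).image fun x => -x := by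
  have h : ∀ x : G, point (subCode 0 (code x)) = -x := by
    intro x
    have := subCode_code 0 x
    rw [show code (0 : G) = 0 from rfl] at this
    rw [this, point_code, zero_sub]
  ext y
  simp only [mem_points, Finset.mem_image, List.mem_map]
  constructor
  · rintro ⟨_, ⟨m, hm, rfl⟩, rfl⟩
    obtain ⟨x, rfl⟩ := hb m hm
    exact ⟨_, ⟨_, hm, rfl⟩, by rw [h, point_code]⟩
  · rintro ⟨_, ⟨m, hm, rfl⟩, rfl⟩
    obtain ⟨x, rfl⟩ := hb m hm
    exact ⟨_, ⟨_, hm, rfl⟩, by rw [h, point_code]⟩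

/-- The ways to remove an element from a list. -/
def picks {α : Type} : List α → List (α × List α)
  | [] => []
  | a :: l => (a, l) :: (picks l).map fun z => (z.1, a :: z.2)

theorem perm_of_mem_picks {α : Type} {l : List α} {z : α × List α} (h : z ∈ picks l) :
    l.Perm (z.1 :: z.2) := by
  induction l generalizing z with
  | nil => simp [picks] at h
  | cons a l ih =>
    rcases List.mem_cons.mp h with rfl | h
    · exact List.Perm.refl _
    · obtain ⟨w, hw, rfl⟩ := List.mem_map.mp h
      exact ((ih hw).cons a).trans (List.Perm.swap _ _ _)

/-- Whether two lists can be matched so that partners are related. -/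
def matchAll {α β : Type} (r : α → β → Bool) : List α → List β → Bool
  | [], cs => cs.isEmpty
  | b :: bs, cs => (picks cs).any fun z => r b z.1 && matchAll r bs z.2

/-- Membership of the partners is kept in the relation so that properties known for all members of
the lists, such as `IsCodes`, are available for them. -/
theorem matchAll_sound {α β : Type} {r : α → β → Bool} {bs : List α} {cs : List β}
    (h : matchAll r bs cs = true) : Multiset.Rel (fun b c => r b c = true ∧ b ∈ bs ∧ c ∈ cs) bs cs := by
  induction bs generalizing cs with
  | nil =>
    rw [matchAll, List.isEmpty_iff] at h
    subst h
    exact Multiset.Rel.zero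
  | cons b bs ih =>
    obtain ⟨z, hz, h⟩ := List.any_eq_true.mp h
    rw [Bool.and_eq_true] at h
    have hp := perm_of_mem_picks hz
    have e : (cs : Multiset β) = z.1 ::ₘ (z.2 : Multiset β) := by
      rw [Multiset.cons_coe]; exact Multiset.coe_eq_coe.mpr hp
    rw [e, ← Multiset.cons_coe]
    refine Multiset.Rel.cons ⟨h.1, by simp, hp.mem_iff.mpr (by simp)⟩ ((ih h.2).mono ?_)
    rintro b' - c' - ⟨h1, h2, h3⟩
    exact ⟨h1, by simp [h2], hp.mem_iff.mpr (by simp [h3])⟩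

/-! ### Transfer of families -/

theorem rel_trans {α β γ : Type} {r : α → β → Prop} {s : β → γ → Prop} {t : α → γ → Prop}
    (h : ∀ a b c, r a b → s b c → t a c) {A : Multiset α} {B : Multiset β} {C : Multiset γ}
    (h1 : Multiset.Rel r A B) (h2 : Multiset.Rel s B C) : Multiset.Rel t A C := by
  induction h1 generalizing C with
  | zero =>
    rw [Multiset.rel_zero_left] at h2
    subst h2
    exact Multiset.Rel.zero
  | cons hab _ ih =>
    obtain ⟨c, C', hc, hC, rfl⟩ := Multiset.rel_cons_left.mp h2
    exact Multiset.Rel.cons (h _ _ _ hab hc) (ih hC)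

theorem carriesFamily_trans {φ ψ : G ≃+ G} {F F' F'' : Multiset (Finset G)}
    (h1 : CarriesFamily φ F F') (h2 : CarriesFamily ψ F' F'') :
    CarriesFamily (φ.trans ψ) F F'' := by
  refine rel_trans ?_ h1 h2
  rintro A _ _ ⟨g, rfl⟩ ⟨g', rfl⟩
  refine ⟨ψ g + g', ?_⟩
  rw [Finset.image_image]
  congr 1
  funext x
  simp [add_assoc]

theorem carriesFamily_symm {φ : G ≃+ G} {F F' : Multiset (Finset G)}
    (h : CarriesFamily φ F F') : CarriesFamily φ.symm F' F := by
  refine Multiset.rel_flip.mp (h.mono ?_)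
  rintro A - _ - ⟨g, rfl⟩
  refine ⟨-φ.symm g, ?_⟩
  rw [Finset.image_image]
  conv_lhs => rw [← Finset.image_id (s := A)]
  congr 1
  funext x
  simp

/-- The family is equivalent to a listed one. -/
def IsListed (F : Multiset (Finset G)) : Prop :=
  ∃ i : Fin 14, MultiplierEquivalent (listedFamily i) F

theorem IsListed.of_carries {φ : G ≃+ G} {F F' : Multiset (Finset G)} (h : IsListed F)
    (h' : CarriesFamily φ F F') : IsListed F' := by
  obtain ⟨i, ψ, hψ⟩ := h
  exact ⟨i, _, carriesFamily_trans hψ h'⟩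

/-- `φ` carries `B` to a translate of `C` or of `-C`. -/
def CarriesUpToSign (φ : G ≃+ G) (B C : Finset G) : Prop :=
  ∃ g, C = B.image (fun x => φ x + g) ∨ C = B.image fun x => g - φ x

theorem CarriesUpToSign.trans_isSimilar {φ : G ≃+ G} {A B C : Finset G}
    (h : CarriesUpToSign φ A B) (h' : IsSimilar B C) : CarriesUpToSign φ A C := by
  obtain ⟨g, rfl | rfl⟩ := h <;> obtain ⟨g', rfl | rfl⟩ := h'
  · refine ⟨g + g', Or.inl ?_⟩
    rw [Finset.image_image]; congr 1; funext x; simp [add_assoc]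
  · refine ⟨g' - g, Or.inr ?_⟩
    rw [Finset.image_image]; congr 1; funext x; simp only [Function.comp]; abel
  · refine ⟨g + g', Or.inr ?_⟩
    rw [Finset.image_image]; congr 1; funext x; simp only [Function.comp]; abel
  · refine ⟨g' - g, Or.inl ?_⟩
    rw [Finset.image_image]; congr 1; funext x; simp only [Function.comp]; abel

/-- Whether a linear map carries one block to a translate of another. -/
def carriesBlock (u v : ℕ) (b c : List ℕ) : Bool := isTranslate (b.map (linCode u v)) c

/-- Whether a linear map or its negative carries one block to a translate of another. -/
def carriesBlockUpToSign (u v : ℕ) (b c : List ℕ) : Bool :=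
  carriesBlock u v b c || isTranslate ((b.map (linCode u v)).map (subCode 0)) c

theorem carriesBlock_sound {u v : ℕ} {φ : G ≃+ G} (hφ : ∀ x, φ x = linHom (point u) (point v) x)
    {b c : List ℕ} (hb : IsCodes b) (hc : IsCodes c) (h : carriesBlock u v b c = true) :
    CarriesBlock φ (points b) (points c) := by
  obtain ⟨g, e⟩ := isTranslate_sound (isCodes_map_linCode hb u v) hc h
  refine ⟨g, ?_⟩
  rw [e, points_map_linCode hb, Finset.image_image]
  simp only [hφ, Function.comp_def]

theorem carriesBlockUpToSign_sound {u v : ℕ} {φ : G ≃+ G}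
    (hφ : ∀ x, φ x = linHom (point u) (point v) x) {b c : List ℕ} (hb : IsCodes b)
    (hc : IsCodes c) (h : carriesBlockUpToSign u v b c = true) :
    CarriesUpToSign φ (points b) (points c) := by
  rcases Bool.or_eq_true _ _ ▸ h with h | h
  · obtain ⟨g, e⟩ := carriesBlock_sound hφ hb hc h
    exact ⟨g, Or.inl e⟩
  · have hb' := isCodes_map_linCode hb u v
    obtain ⟨g, e⟩ := isTranslate_sound (isCodes_map_neg hb') hc h
    refine ⟨g, Or.inr ?_⟩
    rw [e, points_map_neg hb', points_map_linCode hb, Finset.image_image, Finset.image_image]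
    congr 1
    funext x
    simp only [hφ, Function.comp]
    abel

theorem carriesFamily_of_matchAll {u v : ℕ} {φ : G ≃+ G}
    (hφ : ∀ x, φ x = linHom (point u) (point v) x) {bs cs : List (List ℕ)}
    (hb : ∀ b ∈ bs, IsCodes b) (hc : ∀ c ∈ cs, IsCodes c)
    (h : matchAll (carriesBlock u v) bs cs = true) :
    CarriesFamily φ ((bs.map points : List (Finset G)) : Multiset (Finset G)) (cs.map points : List (Finset G)) := by
  rw [← Multiset.map_coe, ← Multiset.map_coe, CarriesFamily, Multiset.rel_map]
  exact (matchAll_sound h).mono fun b _ c _ ⟨h1, h2, h3⟩ =>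
    carriesBlock_sound hφ (hb b h2) (hc c h3) h1

/-! ### The listed families -/

/-- The numbers of the elements of the listed blocks. -/
def listedCodes : Fin 14 → List (List ℕ) :=
  ![
    [[0, 1, 3, 18, 73], [0, 4, 38, 109, 131], [0, 19, 39, 60, 134], [0, 23, 59, 75, 108]],
    [[0, 1, 3, 18, 73], [0, 4, 38, 109, 131], [0, 19, 39, 60, 134], [0, 23, 77, 110, 126]],
    [[0, 1, 3, 18, 110], [0, 4, 37, 73, 112], [0, 19, 40, 114, 146], [0, 20, 43, 111, 133]],
    [[0, 1, 3, 18, 110], [0, 4, 37, 73, 112], [0, 19, 40, 114, 146], [0, 20, 58, 80, 148]],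
    [[0, 1, 3, 18, 110], [0, 4, 37, 76, 108], [0, 19, 44, 112, 133], [0, 20, 43, 56, 131]],
    [[0, 1, 3, 18, 110], [0, 4, 37, 76, 108], [0, 19, 44, 112, 133], [0, 20, 60, 126, 148]],
    [[0, 1, 3, 18, 110], [0, 4, 37, 76, 108], [0, 19, 57, 78, 146], [0, 20, 60, 126, 148]],
    [[0, 1, 3, 18, 110], [0, 4, 38, 75, 98], [0, 19, 40, 114, 146], [0, 20, 42, 78, 132]],
    [[0, 1, 3, 18, 110], [0, 4, 38, 75, 98], [0, 19, 40, 114, 146], [0, 20, 59, 113, 149]],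
    [[0, 1, 3, 18, 110], [0, 4, 38, 75, 98], [0, 19, 44, 76, 150], [0, 20, 42, 78, 132]],
    [[0, 1, 3, 18, 110], [0, 4, 38, 75, 98], [0, 19, 44, 76, 150], [0, 20, 59, 113, 149]],
    [[0, 1, 3, 18, 110], [0, 4, 58, 90, 129], [0, 19, 57, 78, 146], [0, 20, 60, 126, 148]],
    [[0, 1, 18, 21, 62], [0, 2, 57, 72, 97], [0, 4, 37, 115, 128], [0, 19, 58, 94, 108]],
    [[0, 1, 18, 21, 62], [0, 2, 57, 72, 97], [0, 4, 37, 115, 128], [0, 19, 73, 96, 132]]]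

theorem listedFamily_eq (i : Fin 14) :
    listedFamily i = (((listedCodes i).map points : List (Finset G)) : Multiset (Finset G)) := by
  revert i
  decide +kernel

theorem isCodes_listedCodes (i : Fin 14) : ∀ b ∈ listedCodes i, IsCodes b := by
  have h : ∀ i, (listedCodes i).all isCodes = true := by decide +kernel
  exact fun b hb => isCodes_sound (List.all_eq_true.mp (h i) b hb)

theorem isListed_of_matchAll {j : Fin 14} {u v : ℕ} {cs : List (List ℕ)}
    (hcs : ∀ c ∈ cs, IsCodes c) (hd : isUnitDet u v = true)
    (h : matchAll (carriesBlock u v) (listedCodes j) cs = true) :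
    IsListed ((cs.map points : List (Finset G)) : Multiset (Finset G)) := by
  obtain ⟨φ, hφ⟩ := exists_equiv_of_isUnitDet hd
  refine ⟨j, φ, ?_⟩
  rw [listedFamily_eq]
  exact carriesFamily_of_matchAll hφ (isCodes_listedCodes j) hcs h

/-! ### Changes of signs -/

/-- The lists obtained by replacing some blocks by their negatives. -/
def signed : List (List ℕ) → List (List (List ℕ))
  | [] => [[]]
  | b :: l => (signed l).flatMap fun l' => [b :: l', b.map (subCode 0) :: l']

theorem isCodes_of_mem_signed {l l' : List (List ℕ)} (hl : ∀ b ∈ l, IsCodes b)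
    (h : l' ∈ signed l) : ∀ b ∈ l', IsCodes b := by
  induction l generalizing l' with
  | nil => simp only [signed, List.mem_singleton] at h; subst h; simp
  | cons b l ih =>
    obtain ⟨l'', h1, h2⟩ := List.mem_flatMap.mp h
    have ih' := ih (fun c hc => hl c (List.mem_cons_of_mem _ hc)) h1
    have hb := hl b List.mem_cons_self
    simp only [List.mem_cons, List.not_mem_nil, or_false] at h2
    rcases h2 with rfl | rfl
    · exact List.forall_mem_cons.mpr ⟨hb, ih'⟩
    · exact List.forall_mem_cons.mpr ⟨isCodes_map_neg hb, ih'⟩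

/-- Since `g - φ x = φ (-x) + g`, a reflection after `φ` can be replaced by a negation of the block
before `φ`. -/
theorem exists_mem_signed {φ : G ≃+ G} {l : List (List ℕ)} (hl : ∀ b ∈ l, IsCodes b)
    {Cs : Multiset (Finset G)}
    (h : Multiset.Rel (CarriesUpToSign φ) ((l.map points : List (Finset G)) : Multiset (Finset G)) Cs) :
    ∃ l' ∈ signed l, CarriesFamily φ ((l'.map points : List (Finset G)) : Multiset (Finset G)) Cs := by
  induction l generalizing Cs with
  | nil =>
    refine ⟨[], by simp [signed], ?_⟩
    have := (Multiset.rel_zero_left (r := CarriesUpToSign φ)).mp h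
    subst this
    exact Multiset.Rel.zero
  | cons b l ih =>
    rw [List.map_cons, ← Multiset.cons_coe] at h
    obtain ⟨C, Cs, hC, hCs, rfl⟩ := Multiset.rel_cons_left.mp h
    obtain ⟨l', h1, h2⟩ := ih (fun c hc => hl c (List.mem_cons_of_mem _ hc)) hCs
    have hb := hl b List.mem_cons_self
    obtain ⟨g, rfl | rfl⟩ := hC
    · refine ⟨b :: l', List.mem_flatMap.mpr ⟨l', h1, by simp⟩, ?_⟩
      rw [List.map_cons, ← Multiset.cons_coe]
      exact Multiset.Rel.cons ⟨g, rfl⟩ h2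
    · refine ⟨b.map (subCode 0) :: l', List.mem_flatMap.mpr ⟨l', h1, by simp⟩, ?_⟩
      rw [List.map_cons, ← Multiset.cons_coe]
      refine Multiset.Rel.cons ⟨g, ?_⟩ h2
      rw [points_map_neg hb, Finset.image_image]
      congr 1
      funext x
      simp only [Function.comp, map_neg]
      abel

/-- Whether each family in the list is carried to from a listed one by the linear map given in the
other list. -/
def allCertified : List (List (List ℕ)) → List (Fin 14 × ℕ × ℕ) → Bool
  | [], _ => true
  | _ :: _, [] => false
  | l :: ls, (j, u, v) :: cs =>
    isUnitDet u v && (matchAll (carriesBlock u v) (listedCodes j) l && allCertified ls cs)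

theorem allCertified_sound {ls : List (List (List ℕ))} {cs : List (Fin 14 × ℕ × ℕ)}
    (hls : ∀ l ∈ ls, ∀ c ∈ l, IsCodes c) (h : allCertified ls cs = true) {l : List (List ℕ)}
    (hl : l ∈ ls) : IsListed ((l.map points : List (Finset G)) : Multiset (Finset G)) := by
  induction ls generalizing cs with
  | nil => simp at hl
  | cons l' ls ih =>
    match cs with
    | [] => exact absurd h (by simp [allCertified])
    | (j, u, v) :: cs =>
      simp only [allCertified, Bool.and_eq_true] at h
      rcases List.mem_cons.mp hl with rfl | hl
      · exact isListed_of_matchAll (hls _ List.mem_cons_self) h.1 h.2.1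
      · exact ih (fun l hl => hls l (List.mem_cons_of_mem _ hl)) h.2.2 hl

/-- Families that represent the listed families up to negatives of blocks, each with linear maps
that carry listed families to its families with changed signs. -/
def signCertificates : List (Fin 14 × List (Fin 14 × ℕ × ℕ)) :=
  [(0, [(0, 18, 1), (1, 91, 22), (1, 113, 129), (0, 113, 129), (1, 152, 37), (0, 91, 22),
      (0, 152, 37), (1, 144, 8), (1, 18, 1), (0, 19, 134), (0, 80, 149), (1, 19, 134), (0, 58, 42),
      (1, 58, 42), (1, 80, 149), (0, 144, 8)]),
    (2, [(2, 18, 1), (3, 59, 132), (3, 22, 80), (2, 22, 80), (3, 74, 95), (2, 59, 132),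
      (2, 74, 95), (3, 144, 8), (3, 18, 1), (2, 97, 76), (2, 112, 39), (3, 97, 76), (2, 149, 91),
      (3, 149, 91), (3, 112, 39), (2, 144, 8)]),
    (4, [(4, 18, 1), (11, 96, 74), (5, 96, 74), (6, 96, 74), (5, 78, 19), (4, 78, 19), (4, 96, 74),
      (5, 144, 8), (5, 18, 1), (4, 75, 97), (4, 93, 152), (5, 93, 152), (6, 18, 1), (5, 75, 97),
      (11, 18, 1), (4, 144, 8)]),
    (7, [(7, 18, 1), (9, 133, 128), (8, 38, 43), (10, 144, 8), (9, 18, 1), (10, 133, 128),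
      (7, 38, 43), (8, 144, 8), (8, 18, 1), (7, 133, 128), (10, 38, 43), (9, 144, 8), (10, 18, 1),
      (8, 133, 128), (9, 38, 43), (7, 144, 8)]),
    (12, [(12, 18, 1), (13, 55, 95), (13, 23, 126), (12, 59, 132), (13, 5, 134), (12, 5, 134),
      (12, 24, 79), (13, 44, 62), (13, 18, 1), (12, 38, 43), (12, 4, 37), (13, 4, 37),
      (12, 26, 61), (13, 73, 96), (13, 24, 79), (12, 73, 96)])]

/-- Negating single blocks keeps all differences, so each representative yields sixteen families, in
the order produced by `signed`. The certificates of the five representatives together involve all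
fourteen listed families. -/
theorem allCertified_signed :
    ∀ z ∈ signCertificates, allCertified (signed (listedCodes z.1)) z.2 = true := by
  decide +kernel

theorem isListed_of_rel_carriesUpToSign {φ : G ≃+ G} {z : Fin 14 × List (Fin 14 × ℕ × ℕ)}
    (hz : z ∈ signCertificates) {Cs : Multiset (Finset G)}
    (h : Multiset.Rel (CarriesUpToSign φ) (listedFamily z.1) Cs) : IsListed Cs := by
  rw [listedFamily_eq] at h
  obtain ⟨l', h1, h2⟩ := exists_mem_signed (isCodes_listedCodes _) h
  exact (allCertified_sound (fun l hl => isCodes_of_mem_signed (isCodes_listedCodes _) hl)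
    (allCertified_signed z hz) h1).of_carries h2

/-! ### The end of the search -/

/-- Whether the family is an image of a listed one under a linear map, up to negatives of
blocks. -/
def isKnown (bs : List (List ℕ)) : Bool :=
  bs.all isCodes && [(0, 18, 1), (2, 18, 1), (2, 24, 116), (4, 7, 38), (4, 18, 1), (4, 24, 116),
    (7, 4, 42), (7, 18, 1), (7, 24, 116), (7, 41, 20), (12, 4, 42), (12, 5, 44)].any
      fun z : Fin 14 × ℕ × ℕ =>
    isUnitDet z.2.1 z.2.2 && (signCertificates.any fun w => Nat.beq w.1.val z.1.val) &&
      matchAll (carriesBlockUpToSign z.2.1 z.2.2) (listedCodes z.1) bs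

/-- The search leaves open whether a block or its reflection is present. This is harmless because
the certificates cover every choice of signs. -/
theorem isListed_of_isKnown {bs : List (List ℕ)} {Cs : List (Finset G)} (h : isKnown bs = true)
    (hCs : List.Forall₂ (fun l C => IsSimilar (points l) C) bs Cs) :
    IsListed (Cs : Multiset (Finset G)) := by
  rw [isKnown, Bool.and_eq_true, List.any_eq_true] at h
  obtain ⟨h1, z, -, h2⟩ := h
  simp only [Bool.and_eq_true] at h2
  obtain ⟨⟨h3, h4⟩, h5⟩ := h2
  obtain ⟨w, hw, h4⟩ := List.any_eq_true.mp h4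
  have e : w.1 = z.1 := Fin.ext (Nat.eq_of_beq_eq_true h4)
  have hbs : ∀ b ∈ bs, IsCodes b := fun b hb => isCodes_sound (List.all_eq_true.mp h1 b hb)
  obtain ⟨φ, hφ⟩ := exists_equiv_of_isUnitDet h3
  apply isListed_of_rel_carriesUpToSign (φ := φ) hw
  rw [e, listedFamily_eq]
  have hr : Multiset.Rel (fun b l => CarriesUpToSign φ (points b) (points l))
      (listedCodes z.1 : Multiset (List ℕ)) bs :=
    (matchAll_sound h5).mono fun b _ c _ ⟨h1, h2, h3⟩ =>
      carriesBlockUpToSign_sound hφ (isCodes_listedCodes _ b h2) (hbs c h3) h1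
  have hs : Multiset.Rel (fun l C => IsSimilar (points l) C) (bs : Multiset (List ℕ)) Cs := by
    clear hr h5 hbs h1
    induction hCs with
    | nil => exact Multiset.Rel.zero
    | cons h _ ih => rw [← Multiset.cons_coe, ← Multiset.cons_coe]; exact Multiset.Rel.cons h ih
  rw [← Multiset.map_coe, Multiset.rel_map_left]
  exact rel_trans (fun a b c h1 h2 => h1.trans_isSimilar h2) hr hs

/-! ### Normal forms of a block -/

/-- 6156 = 81 · 76: the correlations cancel because `wave` has sum zero over each residue class
modulo 3, which also settles the characters of order 3. -/
theorem totalWeight_univ_erase : ∀ c ∈ 3 :: 54 :: characters,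
    totalWeight (Finset.univ.erase 0) (point c) = 6156 := by
  decide +kernel

/-- Test `fin` on the remaining differences and their packed total weight, for the block
`{0, 3, 18, y, z}` (elements are given by their numbers). -/
def withBlock (fin : ℕ → ℕ → Bool) (y z : ℕ) : Bool :=
  addPoint 1 (Nat.shiftLeft 1 171) (Nat.xor grid 1) 3 fun M Mr A => addPoint M Mr A 18 fun M Mr A =>
    addPoint M Mr A y fun M Mr A => addPoint M Mr A z fun _ _ A =>
      (fun acc => ifZero (overflow 3 acc) (fin A acc) true)
        (Nat.sub (pack (fun _ => 6156) characters) (blockWeight 3 18 y z))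

/-- If the block belongs to an actual family, no test ends early with the default value `true`, so
the value comes from `fin`. -/
theorem withBlock_sound {fin : ℕ → ℕ → Bool} {y z : G}
    (h : withBlock fin (code y) (code z) = true) {B : Finset G} {R : Multiset (Finset G)}
    (hR : IsCover (B ::ₘ R) (Finset.univ.erase 0)) (hcard : Multiset.card R = 3)
    (hB : ({z, y, (1, 0), (0, 3), 0} : Finset G) = B) :
    ∃ A acc, IsMask A (Finset.univ.erase 0 \ diffSet B) ∧
      acc = pack (fun c => totalWeight (Finset.univ.erase 0 \ diffSet B) (point c)) characters ∧
      fin A acc = true := by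
  have hsid := hR.sidon B (Multiset.mem_cons_self B R)
  have hc := hR.card B (Multiset.mem_cons_self B R)
  have hsub := hR.diffSet_subset (Multiset.mem_cons_self B R)
  have hA : IsMask (Nat.xor grid 1) (Finset.univ.erase 0) := by
    rw [Finset.erase_eq, raw_xor]
    exact isMask_grid.sdiff (isMask_singleton (0 : G)) (Finset.subset_univ _)
  have hn3 : (0, 3) ∉ ({0} : Finset G) := by decide
  have hn18 : (1, 0) ∉ (insert (0, 3) {0} : Finset G) := by decide
  have hny : y ∉ (insert (1, 0) (insert (0, 3) {0}) : Finset G) := by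
    intro hy
    have h1 : insert y (insert (1, 0) (insert (0, 3) {0})) =
      (insert (1, 0) (insert (0, 3) {0}) : Finset G) := Finset.insert_eq_of_mem hy
    have : B.card ≤ 4 := by
      rw [← hB, show ({z, y, (1, 0), (0, 3), 0} : Finset G) =
        insert z (insert y (insert (1, 0) (insert (0, 3) {0}))) from rfl, h1]
      exact Finset.card_le_four
    omega
  have hnz : z ∉ (insert y (insert (1, 0) (insert (0, 3) {0})) : Finset G) := by
    intro hz
    have : B.card ≤ 4 := by
      rw [← hB, show ({z, y, (1, 0), (0, 3), 0} : Finset G) =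
        insert z (insert y (insert (1, 0) (insert (0, 3) {0}))) from rfl,
        Finset.insert_eq_of_mem hz]
      exact Finset.card_le_four
    omega
  have sub : ∀ S : Finset G, S ⊆ {z, y, (1, 0), (0, 3), 0} → S ⊆ B := fun S hS => hB ▸ hS
  obtain ⟨M, Mr, A, hs, h⟩ := (isState_zero hA).addPoint hsid hsub
    (sub _ (by simp)) (y := (0, 3)) (hB ▸ by simp) hn3 h
  obtain ⟨M, Mr, A, hs, h⟩ := hs.addPoint hsid hsub
    (sub _ (by intro w; simp only [Finset.mem_insert, Finset.mem_singleton]; tauto))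
    (y := (1, 0)) (hB ▸ by simp) hn18 h
  obtain ⟨M, Mr, A, hs, h⟩ := hs.addPoint hsid hsub
    (sub _ (by intro w; simp only [Finset.mem_insert, Finset.mem_singleton]; tauto))
    (y := y) (hB ▸ by simp) hny h
  obtain ⟨M, Mr, A, hs, h⟩ := hs.addPoint hsid hsub
    (sub _ (by intro w; simp only [Finset.mem_insert, Finset.mem_singleton]; tauto))
    (y := z) (hB ▸ by simp) hnz h
  have hacc : Nat.sub (pack (fun _ => 6156) characters) (blockWeight 3 18 (code y) (code z)) =
      pack (fun c => totalWeight (Finset.univ.erase 0 \ diffSet B) (point c)) characters := by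
    rw [raw_sub]
    have hbw : blockWeight 3 18 (code y) (code z) =
      pack (fun c => totalWeight (diffSet B) (point c)) characters :=
        blockWeight_code (d := (0, 3)) (x := (1, 0)) hsid hc hB
    rw [hbw]
    apply Nat.sub_eq_of_eq_add
    rw [← pack_add]
    exact pack_congr fun c hc => by
      rw [totalWeight_sdiff hsub, totalWeight_univ_erase c (by simp [hc])]
  have hov : overflow 3
      (Nat.sub (pack (fun _ => 6156) characters) (blockWeight 3 18 (code y) (code z))) = 0 := by
    rw [hacc]
    exact overflow_eq_zero (by omega) fun c _ => hcard ▸ hR.of_cons.totalWeight_le _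
  have h : ifZero (overflow 3
      (Nat.sub (pack (fun _ => 6156) characters) (blockWeight 3 18 (code y) (code z))))
      (fin A (Nat.sub (pack (fun _ => 6156) characters) (blockWeight 3 18 (code y) (code z))))
      true = true := h
  rw [hov, ifZero_zero] at h
  refine ⟨A, _, ?_, hacc, h⟩
  have e : (insert z (insert y (insert (1, 0) (insert (0, 3) {0}))) : Finset G) = B := hB
  rw [← e]
  exact hs.avail

/-! ### Covers of all nonzero elements -/

/-- Each block has 5 · 4 = 20 differences, and there are 80 nonzero elements. -/
theorem IsCover.card_eq_four {R : Multiset (Finset G)} (h : IsCover R (Finset.univ.erase 0)) :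
    Multiset.card R = 4 := by
  have h1 := congrArg Multiset.card h.bind
  rw [Multiset.card_bind, Multiset.map_congr rfl (g := fun _ => 20)] at h1
  · rw [Multiset.map_const', Multiset.sum_replicate] at h1
    have : Multiset.card (Finset.univ.erase (0 : G)).val = 80 := by decide +kernel
    rw [this, smul_eq_mul] at h1
    omega
  · intro B hB
    have hc := h.card B hB
    change (diffSet B).card = 20
    rw [diffSet, Finset.card_image_of_injOn (h.sidon B hB), Finset.offDiag_card, hc]

/-- `φ` followed by a translation. -/
def affine (φ : G ≃+ G) (g : G) (B : Finset G) : Finset G := B.image fun x => φ x + g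

theorem affine_injective (φ : G ≃+ G) (g : G) : Function.Injective fun x => φ x + g :=
  fun _ _ e => φ.injective (add_right_cancel e)

theorem diffSet_affine (φ : G ≃+ G) (g : G) (B : Finset G) :
    diffSet (affine φ g B) = (diffSet B).image φ := by
  ext d
  simp only [mem_diffSet, affine, Finset.mem_image]
  constructor
  · rintro ⟨_, ⟨x, hx, rfl⟩, _, ⟨y, hy, rfl⟩, hxy, rfl⟩
    exact ⟨x - y, ⟨x, hx, y, hy, fun e => hxy (by rw [e]), rfl⟩, by rw [map_sub]; abel⟩
  · rintro ⟨_, ⟨x, hx, y, hy, hxy, rfl⟩, rfl⟩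
    exact ⟨_, ⟨x, hx, rfl⟩, _, ⟨y, hy, rfl⟩, fun e => hxy (affine_injective φ g e),
      by rw [map_sub]; abel⟩

theorem IsSidon.affine {B : Finset G} (h : IsSidon B) (φ : G ≃+ G) (g : G) :
    IsSidon (affine φ g B) := by
  rintro ⟨a, b⟩ hab ⟨a', b'⟩ hab' e
  simp only [Finset.mem_coe, Finset.mem_offDiag, Z9.affine, Finset.mem_image] at hab hab'
  obtain ⟨⟨x, hx, rfl⟩, ⟨y, hy, rfl⟩, hxy⟩ := hab
  obtain ⟨⟨x', hx', rfl⟩, ⟨y', hy', rfl⟩, -⟩ := hab'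
  have hne : x ≠ y := by rintro rfl; exact hxy rfl
  obtain ⟨rfl, rfl⟩ := h.eq hx hy hx' hy' hne
    (φ.injective (by simpa only [map_sub, add_sub_add_right_eq_sub] using e))
  rfl

theorem IsCover.affine {R : Multiset (Finset G)} (h : IsCover R (Finset.univ.erase 0))
    (φ : G ≃+ G) (g : G) : IsCover (R.map (affine φ g)) (Finset.univ.erase 0) where
  card := by
    intro B hB
    obtain ⟨C, hC, rfl⟩ := Multiset.mem_map.mp hB
    rw [Z9.affine, Finset.card_image_of_injective _ (affine_injective φ g), h.card C hC]
  sidon := by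
    intro B hB
    obtain ⟨C, hC, rfl⟩ := Multiset.mem_map.mp hB
    exact (h.sidon C hC).affine φ g
  bind := by
    have e : ((Finset.univ.erase (0 : G)).image φ) = Finset.univ.erase 0 := by
      rw [Finset.image_erase φ.injective, map_zero, Finset.image_univ_of_surjective φ.surjective]
    conv_rhs => rw [← e, Finset.image_val_of_injOn φ.injective.injOn, ← h.bind, Multiset.map_bind]
    rw [Multiset.bind_map]
    exact Multiset.bind_congr fun B _ => by
      rw [diffSet_affine, Finset.image_val_of_injOn φ.injective.injOn]

/-- All families with the given block are equivalent to listed ones. -/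
def IsSettled (B : Finset G) : Prop :=
  ∀ R, IsCover R (Finset.univ.erase 0) → B ∈ R → IsListed R

/-- An affine map carries the families through `B` to families through its image, and being listed
is invariant under automorphisms. So a block may be moved freely before it is treated. -/
theorem IsSettled.of_affine {B : Finset G} {φ : G ≃+ G} {g : G} (h : IsSettled (affine φ g B)) :
    IsSettled B := by
  intro R hR hB
  refine (h _ (hR.affine φ g) (Multiset.mem_map_of_mem _ hB)).of_carries (φ := φ.symm)
    (carriesFamily_symm ?_)
  rw [CarriesFamily, Multiset.rel_map_right]
  exact Multiset.rel_refl_of_refl_on fun C _ => ⟨g, rfl⟩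

theorem IsSettled.of_search {y z : G}
    (h : withBlock (search isKnown 3 [[code z, code y, 18, 3, 0]]) (code y) (code z) = true) :
    IsSettled {z, y, (1, 0), (0, 3), 0} := by
  intro R hR hB
  obtain ⟨R, rfl⟩ := Multiset.exists_cons_of_mem hB
  have hc := hR.card_eq_four
  rw [Multiset.card_cons] at hc
  have hcard : Multiset.card R = 3 := by omega
  obtain ⟨A, acc, hA, hacc, h⟩ := withBlock_sound h hR hcard rfl
  have hpts : points [code z, code y, 18, 3, 0] = {z, y, (1, 0), (0, 3), 0} := by
    simp only [points, List.map_cons, List.map_nil, point_code, List.toFinset_cons,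
      List.toFinset_nil, show point 0 = 0 from rfl, show point 18 = (1, 0) from rfl,
      show point 3 = (0, 3) from rfl]
    rfl
  exact search_sound (Good := IsListed) (fun bs Cs h1 h2 => isListed_of_isKnown h1 h2)
    (by omega) h hR.of_cons hcard
    (by simp) hA hacc (List.Forall₂.cons ⟨0, Or.inl (by simp [hpts])⟩ List.Forall₂.nil)

/-! ### Reduction to normal forms -/

/-- The pairs `y`, `z` for which the families with the block `{0, 3, 18, y, z}` are searched. -/
def searched : List (ℕ × ℕ) :=
  [(1, 37), (1, 38), (1, 39), (1, 40), (1, 41), (1, 43), (1, 54), (1, 55), (1, 56), (1, 57), (1,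
  58), (1, 59), (1, 60), (1, 61), (1, 73), (1, 74), (1, 75), (1, 76), (1, 77), (1, 78), (1, 79),
  (1, 80), (1, 110), (1, 111), (1, 113), (1, 114), (19, 39), (19, 40), (19, 73), (19, 74), (19,
  78), (19, 91), (19, 93), (19, 94), (19, 128), (19, 134), (19, 145), (19, 151)]

/-- For `y` the list of `z`, `u`, `v`, `y'`, `z'` such that `linHom u v` carries the block
`{0, 3, 18, y, z}` to a translate of `{0, 3, 18, y', z'}`. -/
def reductions : List (ℕ × List (ℕ × ℕ × ℕ × ℕ × ℕ)) :=
  [(1, [(62, 24, 56, 1, 59), (72, 2, 26, 1, 61), (91, 43, 1, 1, 43), (92, 41, 1, 1, 41), (93, 39,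
  1, 1, 39), (94, 37, 1, 1, 37), (97, 40, 1, 1, 40), (98, 38, 1, 1, 38), (108, 7, 24, 1, 57),
  (109, 18, 55, 1, 55), (112, 18, 61, 1, 61), (115, 18, 58, 1, 58), (116, 24, 110, 1, 113), (126,
  8, 26, 1, 61), (127, 77, 1, 1, 77), (128, 73, 1, 1, 73), (129, 78, 1, 1, 78), (130, 74, 1, 1,
  74), (131, 79, 1, 1, 79), (132, 75, 1, 1, 75), (133, 80, 1, 1, 80), (134, 76, 1, 1, 76)]), (2,
  [(37, 24, 8, 1, 41), (38, 24, 8, 1, 40), (39, 24, 8, 1, 39), (40, 24, 8, 1, 38), (41, 24, 8, 1,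
  37), (44, 24, 8, 1, 43), (54, 24, 8, 1, 57), (55, 24, 8, 1, 56), (56, 24, 8, 1, 55), (57, 109,
  144, 1, 54), (58, 18, 115, 1, 59), (59, 24, 8, 1, 61), (60, 24, 8, 1, 60), (61, 24, 8, 1, 59),
  (62, 24, 8, 1, 58), (72, 113, 145, 1, 61), (73, 24, 8, 1, 80), (74, 24, 8, 1, 79), (75, 24, 8,
  1, 78), (76, 24, 8, 1, 77), (77, 24, 8, 1, 76), (78, 24, 8, 1, 75), (79, 24, 8, 1, 74), (80,
  24, 8, 1, 73), (92, 43, 8, 1, 37), (93, 36, 8, 1, 39), (94, 38, 8, 1, 41), (95, 40, 8, 1, 43),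
  (97, 44, 8, 1, 38), (98, 37, 8, 1, 40), (108, 24, 8, 1, 111), (109, 24, 8, 1, 110), (110, 24,
  116, 1, 55), (111, 115, 147, 1, 57), (112, 18, 61, 1, 113), (113, 24, 113, 1, 58), (114, 24, 8,
  1, 114), (115, 24, 8, 1, 113), (116, 24, 110, 1, 61), (126, 110, 145, 1, 61), (127, 73, 8, 1,
  76), (128, 77, 8, 1, 80), (129, 72, 8, 1, 75), (130, 76, 8, 1, 79), (131, 80, 8, 1, 74), (132,
  75, 8, 1, 78), (133, 79, 8, 1, 73), (134, 74, 8, 1, 77)]), (19, [(41, 25, 8, 19, 39), (54, 1,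
  26, 1, 60), (55, 77, 112, 1, 77), (56, 24, 62, 1, 80), (57, 18, 145, 1, 111), (58, 80, 109, 1,
  80), (59, 24, 59, 1, 77), (60, 129, 145, 1, 60), (61, 74, 115, 1, 74), (62, 24, 56, 1, 74),
  (72, 2, 24, 1, 55), (75, 25, 8, 19, 73), (76, 134, 147, 1, 55), (77, 24, 56, 19, 74), (79, 25,
  8, 19, 78), (80, 74, 115, 19, 74), (97, 25, 8, 19, 94), (98, 25, 8, 19, 93), (108, 126, 145, 1,
  54), (109, 18, 55, 1, 73), (110, 73, 113, 1, 76), (111, 58, 26, 1, 114), (112, 18, 61, 1, 79),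
  (113, 76, 110, 1, 79), (114, 24, 145, 1, 114), (115, 18, 58, 1, 76), (116, 79, 116, 1, 73),
  (126, 8, 18, 1, 55), (127, 116, 144, 19, 73), (129, 78, 112, 19, 78), (130, 25, 59, 19, 78),
  (131, 25, 8, 19, 128), (132, 152, 18, 19, 73), (133, 134, 144, 1, 55), (148, 25, 8, 19, 145)]),
  (20, [(39, 24, 5, 19, 39), (41, 19, 4, 19, 40), (43, 19, 4, 19, 39), (54, 1, 94, 1, 111), (55,
  18, 109, 1, 74), (56, 77, 59, 1, 80), (57, 112, 94, 1, 60), (58, 18, 115, 1, 77), (59, 74, 56,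
  1, 77), (60, 18, 77, 1, 60), (61, 18, 112, 1, 80), (62, 80, 62, 1, 74), (72, 110, 93, 1, 55),
  (73, 18, 109, 19, 74), (74, 24, 5, 19, 73), (75, 24, 5, 19, 78), (76, 19, 4, 19, 74), (77, 19,
  4, 19, 78), (78, 19, 4, 19, 73), (79, 80, 62, 19, 74), (80, 26, 78, 1, 55), (92, 19, 4, 19,
  94), (93, 24, 5, 19, 93), (94, 19, 4, 19, 93), (95, 24, 5, 19, 94), (98, 19, 4, 19, 91), (108,
  7, 94, 1, 114), (109, 73, 58, 1, 73), (110, 24, 116, 1, 79), (111, 24, 77, 1, 54), (112, 79,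
  55, 1, 79), (113, 24, 113, 1, 73), (114, 75, 77, 1, 114), (115, 76, 61, 1, 76), (116, 24, 110,
  1, 76), (126, 116, 90, 1, 55), (127, 19, 4, 19, 128), (128, 8, 72, 19, 73), (129, 98, 90, 19,
  73), (130, 24, 5, 19, 128), (131, 26, 72, 1, 55), (132, 75, 56, 19, 78), (133, 19, 4, 19, 134),
  (134, 19, 115, 19, 78), (146, 19, 4, 19, 151), (149, 19, 4, 19, 145), (152, 24, 5, 19, 145)]),
  (37, [(1, 18, 1, 1, 37), (2, 24, 8, 1, 41), (4, 18, 7, 1, 43), (5, 24, 5, 1, 38), (7, 18, 4, 1,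
  40), (25, 18, 4, 19, 40), (26, 19, 1, 19, 39), (38, 94, 1, 19, 94), (39, 93, 4, 19, 93), (41,
  91, 7, 19, 91), (44, 91, 5, 19, 94), (54, 1, 25, 1, 57), (57, 58, 130, 1, 114), (59, 38, 110,
  1, 41), (60, 24, 130, 1, 60), (62, 44, 116, 1, 38), (72, 2, 22, 1, 58), (73, 18, 109, 19, 145),
  (75, 144, 19, 1, 75), (76, 18, 115, 19, 151), (77, 19, 55, 19, 93), (78, 96, 91, 19, 78), (79,
  25, 110, 19, 145), (91, 112, 40, 19, 78), (92, 145, 61, 19, 145), (93, 39, 112, 19, 39), (94,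
  145, 19, 1, 75), (95, 151, 58, 19, 151), (97, 26, 127, 1, 58), (98, 151, 56, 19, 145), (108, 7,
  19, 1, 60), (109, 43, 112, 1, 43), (111, 18, 127, 1, 57), (112, 40, 109, 1, 40), (114, 75, 79,
  1, 114), (115, 37, 115, 1, 37), (126, 8, 19, 1, 58), (127, 18, 55, 19, 91), (129, 93, 97, 19,
  78), (130, 25, 59, 19, 94), (132, 147, 22, 1, 75), (133, 18, 58, 19, 94), (145, 112, 43, 19,
  78), (148, 26, 130, 1, 58), (149, 40, 109, 19, 40), (151, 145, 25, 1, 75)]), (38, [(1, 18, 1,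
  1, 38), (2, 24, 8, 1, 40), (4, 18, 7, 1, 41), (5, 24, 5, 1, 43), (8, 24, 2, 1, 37), (22, 25, 2,
  19, 39), (26, 24, 8, 19, 40), (37, 94, 1, 19, 94), (39, 90, 8, 19, 93), (40, 91, 4, 19, 91),
  (43, 91, 2, 19, 94), (54, 1, 98, 1, 114), (55, 41, 58, 1, 41), (57, 115, 41, 1, 57), (60, 129,
  98, 1, 60), (61, 38, 61, 1, 38), (72, 116, 44, 1, 58), (74, 24, 59, 19, 151), (75, 147, 20, 19,
  78), (77, 24, 56, 19, 145), (78, 96, 38, 1, 75), (79, 25, 110, 19, 93), (80, 19, 58, 19, 145),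
  (91, 145, 112, 19, 145), (92, 1, 80, 19, 78), (93, 36, 62, 19, 39), (94, 148, 116, 19, 151),
  (95, 131, 92, 1, 58), (97, 151, 113, 19, 145), (98, 97, 38, 1, 75), (108, 132, 92, 1, 57),
  (110, 43, 59, 1, 37), (111, 112, 38, 1, 60), (113, 37, 56, 1, 40), (114, 18, 149, 1, 114),
  (116, 40, 62, 1, 43), (126, 113, 38, 1, 58), (128, 19, 109, 19, 94), (129, 90, 44, 1, 75),
  (131, 24, 110, 19, 91), (132, 144, 23, 19, 78), (134, 24, 116, 19, 94), (146, 1, 77, 19, 78),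
  (148, 37, 56, 19, 40), (149, 97, 41, 1, 75), (152, 131, 98, 1, 58)])]

/-- Whether the pair is one of those searched. -/
def isSearched (y z : ℕ) : Bool := searched.any fun w => Nat.beq w.1 y && Nat.beq w.2 z

/-- Whether the block `{0, 3, 18, y, z}` is equivalent to one of those searched. -/
def isReduced (y z : ℕ) : Bool :=
  isSearched y z || reductions.any fun w => Nat.beq w.1 y && w.2.any fun w => Nat.beq w.1 z &&
    (isUnitDet w.2.1 w.2.2.1 && isSearched w.2.2.2.1 w.2.2.2.2 &&
      isCodes [w.2.2.2.2, w.2.2.2.1, 18, 3, 0] &&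
        carriesBlock w.2.1 w.2.2.1 [z, y, 18, 3, 0] [w.2.2.2.2, w.2.2.2.1, 18, 3, 0])

theorem mem_searched_of_isSearched {y z : ℕ} (h : isSearched y z = true) : (y, z) ∈ searched := by
  obtain ⟨w, hw, h⟩ := List.any_eq_true.mp h
  rw [Bool.and_eq_true] at h
  rwa [← Nat.eq_of_beq_eq_true h.1, ← Nat.eq_of_beq_eq_true h.2]

/-- All 6 · 81 normal forms are run through; those with a repeated difference or with too small a
weight for some character pass by the default value `true`. -/
theorem withBlock_isReduced :
    ∀ y ∈ [1, 2, 19, 20, 37, 38], ∀ a ∈ List.range 9, ∀ b ∈ List.range 9,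
      withBlock (fun _ _ => isReduced y (18 * a + b)) y (18 * a + b) = true := by
  decide +kernel

/-- Search all families with the block `{0, 3, 18, y, z}`. -/
def searchBlock (w : ℕ × ℕ) : Bool :=
  withBlock (search isKnown 3 [[w.2, w.1, 18, 3, 0]]) w.1 w.2

theorem searchBlock_below_eight : ∀ w ∈ searched.take 8, searchBlock w = true := by
  decide +kernel

theorem searchBlock_below_eighteen : ∀ w ∈ (searched.drop 8).take 10, searchBlock w = true := by
  decide +kernel

theorem searchBlock_below_twentyEight : ∀ w ∈ (searched.drop 18).take 10, searchBlock w = true := by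
  decide +kernel

theorem searchBlock_above_twentyEight : ∀ w ∈ searched.drop 28, searchBlock w = true := by
  decide +kernel

theorem searchBlock_of_mem {w : ℕ × ℕ} (hw : w ∈ searched) : searchBlock w = true := by
  have e : searched = searched.take 8 ++ ((searched.drop 8).take 10 ++
    ((searched.drop 18).take 10 ++ searched.drop 28)) := rfl
  rw [e] at hw
  simp only [List.mem_append] at hw
  rcases hw with h | h | h | h
  · exact searchBlock_below_eight w h
  · exact searchBlock_below_eighteen w h
  · exact searchBlock_below_twentyEight w h
  · exact searchBlock_above_twentyEight w h

theorem isSettled_of_mem_searched {y z : G} (h : (code y, code z) ∈ searched) :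
    IsSettled {z, y, (1, 0), (0, 3), 0} := by
  have h := searchBlock_of_mem h
  simp only [searchBlock] at h
  exact IsSettled.of_search h

theorem isReduced_sound {y z : G} (h : isReduced (code y) (code z) = true) :
    IsSettled {z, y, (1, 0), (0, 3), 0} := by
  have hp : ∀ m n : ℕ, points [m, n, 18, 3, 0] = {point m, point n, (1, 0), (0, 3), 0} := by
    intro m n
    simp only [points, List.map_cons, List.map_nil, List.toFinset_cons,
      List.toFinset_nil, show point 0 = 0 from rfl, show point 18 = (1, 0) from rfl,
      show point 3 = (0, 3) from rfl]
    rfl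
  rcases (Bool.or_eq_true _ _).mp h with h | h
  · exact isSettled_of_mem_searched (mem_searched_of_isSearched h)
  · obtain ⟨w, -, h⟩ := List.any_eq_true.mp h
    obtain ⟨w, -, h⟩ := List.any_eq_true.mp ((Bool.and_eq_true _ _).mp h).2
    simp only [Bool.and_eq_true] at h
    obtain ⟨-, ⟨⟨h1, h2⟩, h3⟩, h4⟩ := h
    obtain ⟨φ, hφ⟩ := exists_equiv_of_isUnitDet h1
    have hc : IsCodes [code z, code y, 18, 3, 0] := by
      intro n hn
      simp only [List.mem_cons, List.not_mem_nil, or_false] at hn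
      rcases hn with rfl | rfl | rfl | rfl | rfl
      exacts [⟨_, rfl⟩, ⟨_, rfl⟩, ⟨(1, 0), rfl⟩, ⟨(0, 3), rfl⟩, ⟨0, rfl⟩]
    have hc' := isCodes_sound h3
    obtain ⟨g, e⟩ := carriesBlock_sound hφ hc hc' h4
    rw [hp, hp, point_code, point_code] at e
    apply IsSettled.of_affine (φ := φ) (g := g)
    rw [affine, ← e]
    obtain ⟨z', hz'⟩ := hc' _ List.mem_cons_self
    obtain ⟨y', hy'⟩ := hc' _ (List.mem_cons_of_mem _ List.mem_cons_self)
    have h2 := mem_searched_of_isSearched h2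
    rw [← hz', ← hy'] at h2 ⊢
    rw [point_code, point_code]
    exact isSettled_of_mem_searched h2

/-- A block that lies in no family is settled vacuously. If it lies in one, the tests of `withBlock`
cannot stop early, so `withBlock_isReduced` gives `isReduced`. -/
theorem isSettled_normalForm {y z : G} (hy1 : y.1.val < 3) (hy2 : y.2.val = 1 ∨ y.2.val = 2) :
    IsSettled {z, y, (1, 0), (0, 3), 0} := by
  intro R hR hB
  obtain ⟨R', hR'⟩ := Multiset.exists_cons_of_mem hB
  have hc := hR.card_eq_four
  rw [hR', Multiset.card_cons] at hc
  have hy : code y ∈ [1, 2, 19, 20, 37, 38] := by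
    have : code y = 18 * y.1.val + y.2.val := rfl
    simp only [List.mem_cons, List.not_mem_nil, or_false]
    omega
  have h := withBlock_isReduced (code y) hy z.1.val (List.mem_range.mpr (ZMod.val_lt z.1))
    z.2.val (List.mem_range.mpr (ZMod.val_lt z.2))
  obtain ⟨-, -, -, -, h⟩ := withBlock_sound (z := z) h (hR' ▸ hR) (by omega) rfl
  exact isReduced_sound h R hR hB

/-- The numbers 3 and 54 stand for the characters `x ↦ 3 * x.2` and `x ↦ 3 * x.1`. If one of them
vanished on `B`, all differences of `B` would have weight 0, and the other three blocks would have
to carry 6156 although they can carry at most 5700. -/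
theorem exists_pairing_ne_zero {R : Multiset (Finset G)} (hR : IsCover R (Finset.univ.erase 0))
    {B : Finset G} (hB : B ∈ R) {c : ℕ} (hc : c ∈ [3, 54]) :
    ∃ x ∈ B, pairing (point c) x ≠ 0 := by
  by_contra! h
  obtain ⟨R, rfl⟩ := Multiset.exists_cons_of_mem hB
  have h4 := hR.card_eq_four
  rw [Multiset.card_cons] at h4
  have h1 := hR.of_cons.totalWeight_le (point c)
  have h2 := totalWeight_sdiff (hR.diffSet_subset hB) (point c)
  rw [totalWeight_univ_erase c (by simp only [List.mem_cons] at hc ⊢; tauto)] at h2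
  have h3 : totalWeight (diffSet B) (point c) = 0 := by
    apply Finset.sum_eq_zero
    intro d hd
    obtain ⟨x, hx, y, hy, -, rfl⟩ := mem_diffSet.mp hd
    rw [pairing_sub, h x hx, h y hy]
    rfl
  omega

theorem exists_mul_eq_one_of_three_mul : ∀ a : ZMod 9, 3 * a ≠ 0 → ∃ b, b * a = 1 := by decide

/-- For a unit `n` the numbers `n * (3 * i)` run through all multiples of 3, and `n * (1 + 3 * j)`
through the whole class of `n` modulo 3. -/
theorem exists_reduction : ∀ m n : ZMod 9, 3 * n ≠ 0 → ∃ i j : ZMod 9, (m + n * (3 * i)).val < 3 ∧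
    ((n * (1 + 3 * j)).val = 1 ∨ (n * (1 + 3 * j)).val = 2) := by decide

/-- Every difference family is equivalent to a listed one. -/
theorem isListed_of_isCover {R : Multiset (Finset G)} (hR : IsCover R (Finset.univ.erase 0)) :
    IsListed R := by
  obtain ⟨B, hB, ht⟩ := hR.exists_mem (d := (0, 3)) (by decide)
  suffices h : IsSettled B from h R hR hB
  obtain ⟨p, hp, q, hq, -, hpq⟩ := mem_diffSet.mp ht
  -- Translation by `-q` puts `q` at `0` and `p` at `(0, 3)`.
  apply IsSettled.of_affine (φ := AddEquiv.refl G) (g := -q)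
  replace hR := hR.affine (AddEquiv.refl G) (-q)
  replace hB := Multiset.mem_map_of_mem (affine (AddEquiv.refl G) (-q)) hB
  have h0 : (0 : G) ∈ affine (AddEquiv.refl G) (-q) B :=
    Finset.mem_image.mpr ⟨q, hq, by simp⟩
  have h3 : ((0, 3) : G) ∈ affine (AddEquiv.refl G) (-q) B :=
    Finset.mem_image.mpr ⟨p, hp, by rw [← hpq]; simp [sub_eq_add_neg]⟩
  generalize affine (AddEquiv.refl G) (-q) B = B at hB h0 h3
  generalize Multiset.map _ R = R at hR hB
  clear hpq hp hq p q ht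
  obtain ⟨x, hx, hx'⟩ := exists_pairing_ne_zero hR hB (c := 54) (by simp)
  obtain ⟨a, ha⟩ := exists_mul_eq_one_of_three_mul x.1 (by
    simpa [pairing, show point 54 = (3, 0) from rfl] using hx')
  -- With `a` the inverse of `x.1`, this map fixes `(0, 3)` and sends `x` to `(1, 0)`. Its
  -- determinant is `a`.
  obtain ⟨φ, hφ⟩ := exists_equiv_of_mul_det_eq_one (u := (a, -x.2 * a)) (v := (0, 1)) (e := x.1)
    (by simp only; linear_combination ha)
  apply IsSettled.of_affine (φ := φ) (g := 0)
  replace hR := hR.affine φ 0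
  replace hB := Multiset.mem_map_of_mem (affine φ 0) hB
  replace h0 : (0 : G) ∈ affine φ 0 B := Finset.mem_image.mpr ⟨0, h0, by simp⟩
  replace h3 : ((0, 3) : G) ∈ affine φ 0 B :=
    Finset.mem_image.mpr ⟨_, h3, by rw [hφ, linHom_apply]; simp⟩
  have h18 : ((1, 0) : G) ∈ affine φ 0 B :=
    Finset.mem_image.mpr ⟨x, hx, by
      rw [hφ, linHom_apply, add_zero]
      ext <;> simp only
      · linear_combination ha
      · linear_combination (-x.2) * ha⟩
  generalize affine φ 0 B = B at hB h0 h3 h18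
  generalize Multiset.map _ R = R at hR hB
  clear hφ φ ha a hx' hx x
  obtain ⟨y, hy, hy'⟩ := exists_pairing_ne_zero hR hB (c := 3) (by simp)
  have hy3 : 3 * y.2 ≠ 0 := by
    simpa [pairing, show point 3 = (0, 3) from rfl] using hy'
  obtain ⟨i, j, h1, h2⟩ := exists_reduction y.1 y.2 hy3
  -- These maps fix `(1, 0)` and also `(0, 3)`, because 9 = 0. The determinant `1 + 3 * j` has the
  -- inverse `1 - 3 * j` for the same reason.
  obtain ⟨φ, hφ⟩ := exists_equiv_of_mul_det_eq_one (u := (1, 0)) (v := (3 * i, 1 + 3 * j))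
    (e := 1 - 3 * j) (by
      have h9 : (9 : ZMod 9) = 0 := by decide
      simp only; linear_combination (-j ^ 2) * h9)
  have h9 : (9 : ZMod 9) = 0 := by decide
  have e3 : φ (0, 3) = (0, 3) := by
    rw [hφ, linHom_apply]
    ext <;> simp only
    · linear_combination i * h9
    · linear_combination j * h9
  have e18 : φ (1, 0) = (1, 0) := by rw [hφ, linHom_apply]; simp
  apply IsSettled.of_affine (φ := φ) (g := 0)
  have hyφ : φ y = (y.1 + y.2 * (3 * i), y.2 * (1 + 3 * j)) := by
    rw [hφ, linHom_apply]; simp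
  have hc := hR.card B hB
  have hn : y ∉ ({(1, 0), (0, 3), 0} : Finset G) := by
    intro h
    simp only [Finset.mem_insert, Finset.mem_singleton] at h
    rcases h with rfl | rfl | rfl
    · exact hy3 (by simp)
    · exact hy3 (by decide)
    · exact hy3 (by simp)
  have hc4 : ({y, (1, 0), (0, 3), 0} : Finset G).card = 4 := by
    rw [Finset.card_insert_of_notMem hn]; decide
  obtain ⟨z, hz, hzB⟩ := Finset.exists_eq_insert_iff.mpr
    ⟨show ({y, (1, 0), (0, 3), 0} : Finset G) ⊆ B by
      intro w hw
      simp only [Finset.mem_insert, Finset.mem_singleton] at hw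
      rcases hw with rfl | rfl | rfl | rfl <;> assumption, by rw [hc4, hc]⟩
  have e : affine φ 0 B = {φ z, φ y, (1, 0), (0, 3), 0} := by
    rw [← hzB, affine]
    simp only [Finset.image_insert, Finset.image_singleton, add_zero, e3, e18, map_zero]
  rw [e]
  exact isSettled_normalForm (by rw [hyφ]; exact h1) (by rw [hyφ]; exact h2)

/-! ### Developments -/

theorem length_listedCodes :
    ∀ i, ∀ l ∈ listedCodes i, l.length = 5 ∧ (points l).card = 5 := by
  decide +kernel

theorem sum_card_filter_listedFamily : ∀ (i : Fin 14) (a b : ZMod 9), ((a, b) : G) ≠ 0 →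
    ((listedFamily i).map fun B =>
      ((B ×ˢ B).filter fun z : G × G => z.1 - z.2 = (a, b)).card).sum = 1 := by
  decide +kernel

theorem isDifferenceFamily_listedFamily (i : Fin 14) : IsDifferenceFamily 5 1 (listedFamily i) := by
  refine ⟨?_, fun d => sum_card_filter_listedFamily i d.1 d.2⟩
  rw [listedFamily_eq]
  intro B hB
  obtain ⟨l, hl, rfl⟩ := List.mem_map.mp (Multiset.mem_coe.mp hB)
  exact (length_listedCodes i l hl).2

theorem IsCover.eq_of_mem_diffSet {R : Multiset (Finset G)} {S : Finset G} (h : IsCover R S)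
    {B C : Finset G} (hB : B ∈ R) (hC : C ∈ R) {d : G} (hdB : d ∈ diffSet B)
    (hdC : d ∈ diffSet C) : B = C := by
  by_contra hne
  obtain ⟨R, rfl⟩ := Multiset.exists_cons_of_mem hB
  have hC := (Multiset.mem_cons.mp hC).resolve_left (Ne.symm hne)
  exact (Finset.mem_sdiff.mp (h.of_cons.diffSet_subset hC hdC)).2 hdB

theorem mem_development {F : Multiset (Finset G)} {B : Finset G} :
    B ∈ development F ↔ ∃ C ∈ F, ∃ g, C.image (fun x => x + g) = B := by
  simp [development]

theorem image_add_mem_development {F : Multiset (Finset G)} {B : Finset G}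
    (h : B ∈ development F) (g : G) : B.image (fun x => x + g) ∈ development F := by
  obtain ⟨C, hC, g', rfl⟩ := mem_development.mp h
  refine mem_development.mpr ⟨C, hC, g' + g, ?_⟩
  rw [Finset.image_image]
  congr 1
  funext x
  simp [add_assoc]

/-- The element `x - y` is the difference of exactly one pair `p`, `q` in exactly one base block, so
the only block through `x` and `y` is the translate of that base block by `y - q`. -/
theorem IsCover.existsUnique {F : Multiset (Finset G)} (h : IsCover F (Finset.univ.erase 0))
    {x y : G} (hxy : x ≠ y) : ∃! B, B ∈ development F ∧ x ∈ B ∧ y ∈ B := by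
  obtain ⟨C, hC, hd⟩ := h.exists_mem (d := x - y) (by simp [sub_eq_zero, hxy])
  obtain ⟨p, hp, q, hq, hpq, e⟩ := mem_diffSet.mp hd
  refine ⟨C.image fun w => w + (y - q), ⟨mem_development.mpr ⟨C, hC, _, rfl⟩,
    Finset.mem_image.mpr ⟨p, hp, ?_⟩, Finset.mem_image.mpr ⟨q, hq, by abel⟩⟩, ?_⟩
  · rw [← add_sub_assoc, add_sub_right_comm, e, sub_add_cancel]
  · rintro B ⟨hB, hx, hy⟩
    obtain ⟨C', hC', g, rfl⟩ := mem_development.mp hB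
    obtain ⟨a, ha, rfl⟩ := Finset.mem_image.mp hx
    obtain ⟨b, hb, rfl⟩ := Finset.mem_image.mp hy
    have hab : a ≠ b := fun e => hxy (by rw [e])
    rw [add_sub_add_right_eq_sub] at e
    have : C' = C := h.eq_of_mem_diffSet hC' hC (d := a - b) (sub_mem_diffSet ha hb hab)
      (e ▸ sub_mem_diffSet hp hq hpq)
    subst this
    obtain ⟨rfl, rfl⟩ := (h.sidon _ hC).eq ha hb hp hq hab e.symm
    congr 1
    funext w
    abel

theorem IsCover.card_of_mem_development {F : Multiset (Finset G)}
    (h : IsCover F (Finset.univ.erase 0)) {B : Finset G} (hB : B ∈ development F) :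
    B.card = 5 := by
  obtain ⟨C, hC, g, rfl⟩ := mem_development.mp hB
  rw [Finset.card_image_of_injective _ (add_left_injective g), h.card C hC]

theorem IsCover.isSteinerSystem {F : Multiset (Finset G)} (h : IsCover F (Finset.univ.erase 0)) :
    IsSteinerSystem 2 5 81 (development F) := by
  refine ⟨by simp [ZMod.card], fun B hB => h.card_of_mem_development hB, ?_⟩
  intro T hT
  obtain ⟨x, y, hxy, rfl⟩ := Finset.card_eq_two.mp hT
  simpa only [Finset.insert_subset_iff, Finset.singleton_subset_iff] using h.existsUnique hxy

theorem isCover_listedFamily (i : Fin 14) : IsCover (listedFamily i) (Finset.univ.erase 0) :=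
  isCover_of_isDifferenceFamily (isDifferenceFamily_listedFamily i)

/-! ### Isomorphisms of block systems -/

section Isomorphism

variable {V W : Type*} [DecidableEq V] [DecidableEq W]

theorem mem_lineThrough {𝓑 : Finset (Finset V)} {x y p : V} :
    p ∈ lineThrough 𝓑 x y ↔ ∃ B ∈ 𝓑, x ∈ B ∧ y ∈ B ∧ p ∈ B := by
  simp only [lineThrough, Finset.mem_biUnion, Finset.mem_filter, id]
  constructor
  · rintro ⟨B, ⟨h1, h2, h3⟩, h4⟩; exact ⟨B, h1, h2, h3, h4⟩
  · rintro ⟨B, h1, h2, h3, h4⟩; exact ⟨B, ⟨h1, h2, h3⟩, h4⟩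

theorem lineThrough_image (𝓑 : Finset (Finset V)) (e : V ≃ W) (x y : V) :
    lineThrough (𝓑.image fun B => B.image e) (e x) (e y) = (lineThrough 𝓑 x y).image e := by
  ext p
  simp only [mem_lineThrough, Finset.mem_image]
  constructor
  · rintro ⟨_, ⟨B, hB, rfl⟩, hx, hy, hp⟩
    obtain ⟨p, hp, rfl⟩ := Finset.mem_image.mp hp
    exact ⟨p, ⟨B, hB, e.injective.mem_finset_image.mp hx,
      e.injective.mem_finset_image.mp hy,
      e.injective.mem_finset_image.mp hp⟩, rfl⟩
  · rintro ⟨p, ⟨B, hB, hx, hy, hp⟩, rfl⟩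
    exact ⟨_, ⟨B, hB, rfl⟩, Finset.mem_image_of_mem _ hx, Finset.mem_image_of_mem _ hy,
      Finset.mem_image_of_mem _ hp⟩

theorem hyperbolicNumber_image (𝓑 : Finset (Finset V)) (e : V ≃ W) (o x y p : V) :
    hyperbolicNumber (𝓑.image fun B => B.image e) (e o) (e x) (e y) (e p) =
      hyperbolicNumber 𝓑 o x y p := by
  rw [hyperbolicNumber, hyperbolicNumber, lineThrough_image 𝓑 e o y, Finset.filter_image,
    Finset.card_image_of_injective _ e.injective]
  congr 1
  refine Finset.filter_congr fun u _ => ?_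
  rw [lineThrough_image, lineThrough_image, Finset.disjoint_image e.injective]

/-- The condition that defines the quadruples with hyperbolic number `n`. -/
def IsHyperbolic (𝓑 : Finset (Finset V)) (n : ℕ) (o x y p : V) : Prop :=
  (¬ ∃ B ∈ 𝓑, o ∈ B ∧ x ∈ B ∧ y ∈ B) ∧ p ∈ lineThrough 𝓑 x y ∧ p ≠ x ∧ p ≠ y ∧
    hyperbolicNumber 𝓑 o x y p = n

instance (𝓑 : Finset (Finset V)) (n : ℕ) (o x y p : V) :
    Decidable (IsHyperbolic 𝓑 n o x y p) :=
  inferInstanceAs (Decidable (_ ∧ _))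

theorem isHyperbolic_image (𝓑 : Finset (Finset V)) (e : V ≃ W) (n : ℕ) (o x y p : V) :
    IsHyperbolic (𝓑.image fun B => B.image e) n (e o) (e x) (e y) (e p) ↔
      IsHyperbolic 𝓑 n o x y p := by
  rw [IsHyperbolic, IsHyperbolic, hyperbolicNumber_image, lineThrough_image]
  simp

theorem hyperbolicFrequency_eq_of_designIsomorphic [Fintype V] [Fintype W]
    {𝓑 : Finset (Finset V)} {𝓒 : Finset (Finset W)} (h : DesignIsomorphic 𝓑 𝓒) (n : ℕ) :
    hyperbolicFrequency 𝓑 n = hyperbolicFrequency 𝓒 n := by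
  obtain ⟨e, rfl⟩ := h
  let e4 : V × V × V × V ≃ W × W × W × W :=
    e.prodCongr (e.prodCongr (e.prodCongr e))
  refine Finset.card_equiv e4 fun q => ?_
  rw [Finset.mem_filter, Finset.mem_filter]
  exact and_congr (by simp) (isHyperbolic_image 𝓑 e n q.1 q.2.1 q.2.2.1 q.2.2.2).symm

end Isomorphism

theorem designIsomorphic_development {φ : G ≃+ G} {F F' : Multiset (Finset G)}
    (h : CarriesFamily φ F F') : DesignIsomorphic (development F) (development F') := by
  have key : ∀ {φ : G ≃+ G} {F F' : Multiset (Finset G)}, CarriesFamily φ F F' →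
      ∀ B ∈ development F, B.image φ ∈ development F' := by
    intro φ F F' h B hB
    obtain ⟨C, hC, g, rfl⟩ := mem_development.mp hB
    obtain ⟨C', hC', g', e⟩ := Multiset.exists_mem_of_rel_of_mem h hC
    refine mem_development.mpr ⟨C', hC', φ g - g', ?_⟩
    rw [e, Finset.image_image, Finset.image_image]
    congr 1
    funext x
    simp [add_assoc]
  refine ⟨φ.toEquiv, Finset.Subset.antisymm ?_ ?_⟩
  · intro B hB
    obtain ⟨C, hC, rfl⟩ := Finset.mem_image.mp hB
    exact key h C hC
  · intro B hB
    refine Finset.mem_image.mpr ⟨_, key (carriesFamily_symm h) B hB, ?_⟩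
    rw [Finset.image_image]
    conv_rhs => rw [← Finset.image_id (s := B)]
    congr 1
    funext x
    exact φ.apply_symm_apply x

theorem designIsomorphic_translation (F : Multiset (Finset G)) (g : G) :
    (development F).image (fun B => B.image (Equiv.addRight g)) = development F := by
  apply Finset.eq_of_subset_of_card_le
  · intro B hB
    obtain ⟨C, hC, rfl⟩ := Finset.mem_image.mp hB
    exact image_add_mem_development hC g
  · rw [Finset.card_image_of_injective _ (Finset.image_injective (Equiv.addRight g).injective)]

/-- By translation only the quadruples with first entry `0` have to be counted. -/
theorem hyperbolicFrequency_development (F : Multiset (Finset G)) (n : ℕ) :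
    hyperbolicFrequency (development F) n = 81 * (Finset.univ.filter fun q : G × G × G =>
      IsHyperbolic (development F) n 0 q.1 q.2.1 q.2.2).card := by
  have h1 : ∀ o : G, (Finset.univ.filter fun q : G × G × G =>
      IsHyperbolic (development F) n o q.1 q.2.1 q.2.2).card =
        (Finset.univ.filter fun q : G × G × G =>
      IsHyperbolic (development F) n 0 q.1 q.2.1 q.2.2).card := by
    intro o
    let e := Equiv.addRight o
    symm
    refine Finset.card_equiv (e.prodCongr (e.prodCongr e)) fun q => ?_
    rw [Finset.mem_filter, Finset.mem_filter]
    refine and_congr (by simp) ?_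
    have := isHyperbolic_image (development F) e n 0 q.1 q.2.1 q.2.2
    rw [designIsomorphic_translation, show e 0 = o from zero_add o] at this
    exact this.symm
  have h2 : hyperbolicFrequency (development F) n = ∑ o : G, (Finset.univ.filter
      fun q : G × G × G => IsHyperbolic (development F) n o q.1 q.2.1 q.2.2).card := by
    simp only [Finset.card_filter]
    rw [hyperbolicFrequency, Finset.card_filter, Fintype.sum_prod_type]
    rfl
  rw [h2, Finset.sum_congr rfl fun o _ => h1 o, Finset.sum_const, smul_eq_mul]
  rfl

/-! ### Multipliers -/

theorem apply_eq_linHom (φ : G ≃+ G) (x : G) : φ x = linHom (φ (1, 0)) (φ (0, 1)) x := by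
  have e : x = x.1.val • ((1, 0) : G) + x.2.val • ((0, 1) : G) := by
    ext <;> simp
  conv_lhs => rw [e, map_add, map_nsmul, map_nsmul]
  rw [linHom_apply]
  ext <;> simp

/-- The linear maps that fix the listed families, given by the numbers of the images of `(1, 0)`
and `(0, 1)`. -/
def fixing : Fin 14 → List (ℕ × ℕ) :=
  ![[(18, 1)], [(18, 1)], [(18, 1)], [(18, 1)], [(18, 1)], [(18, 1)],
    [(18, 1), (78, 19), (75, 97)], [(18, 1)], [(18, 1)], [(18, 1)], [(18, 1)],
    [(18, 1), (78, 19), (75, 97)],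
    [(18, 1), (55, 95), (98, 75)],
    [(18, 1), (26, 61), (127, 109)]]

theorem fixing_spec : ∀ i, ∀ w ∈ fixing i, isUnitDet w.1 w.2 = true ∧ isCodes [w.1, w.2] = true ∧
    matchAll (carriesBlock w.1 w.2) (listedCodes i) (listedCodes i) = true := by
  decide +kernel

theorem card_fixing : ∀ i, (fixing i).toFinset.card = listedMultiplier i := by decide +kernel

/-- Whether the linear map followed by the translation by `p` maps the block `b` to `c`. -/
def mapsBlock (u v p : ℕ) (b c : List ℕ) : Bool :=
  b.all fun w => c.any fun z => Nat.beq z (subCode (linCode u v w) (subCode 0 p))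

theorem mapsBlock_of_image {φ : G ≃+ G} {g : G} {b c : List ℕ} (hb : IsCodes b) (hc : IsCodes c)
    (h : points c = (points b).image fun x => φ x + g) :
    mapsBlock (code (φ (1, 0))) (code (φ (0, 1))) (code g) b c = true := by
  refine List.all_eq_true.mpr fun w hw => List.any_eq_true.mpr ?_
  obtain ⟨x, rfl⟩ := hb w hw
  have hx : φ x + g ∈ points c := by
    rw [h]
    exact Finset.mem_image.mpr ⟨x, mem_points.mpr ⟨_, hw, point_code x⟩, rfl⟩
  obtain ⟨z, hz, e⟩ := mem_points.mp hx
  obtain ⟨y, rfl⟩ := hc z hz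
  refine ⟨_, hz, ?_⟩
  have h0 := subCode_code 0 g
  rw [show code (0 : G) = 0 from rfl] at h0
  rw [point_code] at e
  rw [linCode_code, point_code, point_code, ← apply_eq_linHom, h0, subCode_code, e, zero_sub,
    sub_neg_eq_add]
  exact Nat.beq_refl _

/-- Whether each block is mapped to a translate of some block. -/
def mapsBlocks (u v : ℕ) (bs : List (List ℕ)) : Bool :=
  bs.all fun b => bs.any fun c => c.any fun p => mapsBlock u v p b c

/-- The first block contains `(0, 1)` and `(1, 0)`, so an automorphism is determined by what it does
to this block. As `0` lies in every block, the translation `g` is itself a point of the image block.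
-/
theorem mem_listedCodes : ∀ i, (listedCodes i).headD [] ∈ listedCodes i ∧
    (1 ∈ (listedCodes i).headD [] ∧ 18 ∈ (listedCodes i).headD []) ∧ ∀ b ∈ listedCodes i, 0 ∈ b := by
  decide +kernel

/-- Here `p`, `q`, `r` are the possible images of `0`, `(0, 1)`, `(1, 0)` in the block `c`, so an
automorphism that fixes the family has `r - p` and `q - p` as the images of the generators. This
leaves at most 4 · 5³ candidates. -/
theorem mem_fixing : ∀ i, ∀ c ∈ listedCodes i, ∀ p ∈ c, ∀ q ∈ c, ∀ r ∈ c, p ≠ q →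
    mapsBlock (subCode r p) (subCode q p) p ((listedCodes i).headD []) c = true →
      mapsBlocks (subCode r p) (subCode q p) (listedCodes i) = true →
        (subCode r p, subCode q p) ∈ fixing i := by
  decide +kernel

theorem mem_fixing_of_carriesFamily {i : Fin 14} {φ : G ≃+ G}
    (h : CarriesFamily φ (listedFamily i) (listedFamily i)) :
    (code (φ (1, 0)), code (φ (0, 1))) ∈ fixing i := by
  obtain ⟨h1, ⟨h2, h3⟩, h4⟩ := mem_listedCodes i
  have hcodes := isCodes_listedCodes i
  have key : ∀ b ∈ listedCodes i, ∃ c ∈ listedCodes i, ∃ g : G, code g ∈ c ∧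
      points c = (points b).image fun x => φ x + g := by
    intro b hb
    rw [listedFamily_eq] at h
    obtain ⟨C, hC, g, e⟩ := Multiset.exists_mem_of_rel_of_mem h
      (Multiset.mem_coe.mpr (List.mem_map_of_mem hb))
    obtain ⟨c, hc, rfl⟩ := List.mem_map.mp (Multiset.mem_coe.mp hC)
    refine ⟨c, hc, g, ?_, e⟩
    have hg : g ∈ points c := by
      rw [e]
      exact Finset.mem_image.mpr ⟨0, mem_points.mpr ⟨0, h4 b hb, rfl⟩, by simp⟩
    obtain ⟨n, hn, rfl⟩ := mem_points.mp hg
    obtain ⟨x, rfl⟩ := hcodes c hc n hn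
    rwa [point_code]
  obtain ⟨c, hc, g, hg, e⟩ := key _ h1
  have himage : ∀ x : G, code x ∈ (listedCodes i).headD [] → code (φ x + g) ∈ c := by
    intro x hx
    have : φ x + g ∈ points c := by
      rw [e]
      exact Finset.mem_image.mpr ⟨x, mem_points.mpr ⟨_, hx, point_code x⟩, rfl⟩
    obtain ⟨n, hn, e'⟩ := mem_points.mp this
    obtain ⟨y, rfl⟩ := hcodes c hc n hn
    rwa [← e', point_code]
  have e1 : subCode (code (φ (1, 0) + g)) (code g) = code (φ (1, 0)) := by
    rw [subCode_code, add_sub_cancel_right]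
  have e2 : subCode (code (φ (0, 1) + g)) (code g) = code (φ (0, 1)) := by
    rw [subCode_code, add_sub_cancel_right]
  have := mem_fixing i c hc _ hg _ (himage (0, 1) h2) _ (himage (1, 0) h3)
    fun h => by
      have h := add_right_cancel ((zero_add g).trans (code_injective h))
      exact absurd (φ.injective ((map_zero φ).trans h)) (by decide)
  rw [e1, e2] at this
  refine this (mapsBlock_of_image (hcodes _ h1) (hcodes c hc) e) ?_
  refine List.all_eq_true.mpr fun b hb => List.any_eq_true.mpr ?_
  obtain ⟨c, hc, g, hg, e⟩ := key b hb
  exact ⟨c, hc, List.any_eq_true.mpr ⟨_, hg, mapsBlock_of_image (hcodes b hb) (hcodes c hc) e⟩⟩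

theorem automorphismMultiplier_listedFamily (i : Fin 14) :
    automorphismMultiplier (listedFamily i) = listedMultiplier i := by
  let f : {φ : G ≃+ G // CarriesFamily φ (listedFamily i) (listedFamily i)} →
      {w // w ∈ (fixing i).toFinset} := fun φ =>
    ⟨(code (φ.1 (1, 0)), code (φ.1 (0, 1))), List.mem_toFinset.mpr (mem_fixing_of_carriesFamily φ.2)⟩
  have hf : Function.Bijective f := by
    constructor
    · rintro ⟨φ, hφ⟩ ⟨ψ, hψ⟩ e
      have e := congrArg Subtype.val e
      simp only [f, Prod.mk.injEq, code_inj] at e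
      apply Subtype.ext
      apply AddEquiv.ext
      intro x
      rw [apply_eq_linHom φ, apply_eq_linHom ψ, e.1, e.2]
    · rintro ⟨⟨u, v⟩, hw⟩
      obtain ⟨h1, h2, h3⟩ := fixing_spec i _ (List.mem_toFinset.mp hw)
      obtain ⟨φ, hφ⟩ := exists_equiv_of_isUnitDet h1
      have hc := isCodes_listedCodes i
      have h := carriesFamily_of_matchAll hφ hc hc h3
      rw [← listedFamily_eq] at h
      refine ⟨⟨φ, h⟩, Subtype.ext ?_⟩
      obtain ⟨a, ha⟩ := isCodes_sound h2 u (by simp)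
      obtain ⟨b, hb⟩ := isCodes_sound h2 v (by simp)
      simp only at hφ
      simp only [f, hφ, linHom_apply, ← ha, ← hb, point_code]
      simp
  rw [← card_fixing, automorphismMultiplier, Nat.card_congr (Equiv.ofBijective f hf),
    Nat.card_eq_fintype_card, Fintype.card_coe]

/-! ### Sums over lists -/

/-- The sum of the values of a function on a list. -/
def sumOver (l : List ℕ) (f : ℕ → ℕ) : ℕ := List.rec 0 (fun a _ ih => Nat.add (f a) ih) l

theorem sumOver_eq (l : List ℕ) (f : ℕ → ℕ) : sumOver l f = (l.map f).sum := by
  induction l with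
  | nil => rfl
  | cons a l ih => rw [List.map_cons, List.sum_cons, ← ih]; rfl

theorem sumOver_points {l : List ℕ} (hl : IsCodes l) (hn : l.Nodup) (f : ℕ → ℕ) :
    sumOver l f = ∑ x ∈ points l, f (code x) := by
  have hn' : (l.map point).Nodup := by
    refine (List.nodup_map_iff_inj_on hn).mpr fun a ha b hb e => ?_
    obtain ⟨x, rfl⟩ := hl a ha
    obtain ⟨y, rfl⟩ := hl b hb
    rw [point_code, point_code] at e
    rw [e]
  rw [sumOver_eq, points, List.sum_toFinset _ hn', List.map_map]
  congr 1
  refine List.map_congr_left fun a ha => ?_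
  obtain ⟨x, rfl⟩ := hl a ha
  rw [Function.comp, point_code]

/-- The numbers of the nonzero elements. -/
def nonzeroCodes : List ℕ :=
  ((List.range 9).flatMap fun a => (List.range 9).map fun b => 18 * a + b).tail

theorem sumOver_nonzeroCodes (f : ℕ → ℕ) :
    sumOver nonzeroCodes f = ∑ x ∈ Finset.univ.erase (0 : G), f (code x) := by
  have h : isCodes nonzeroCodes = true ∧ nonzeroCodes.Nodup ∧
    points nonzeroCodes = Finset.univ.erase 0 := by decide +kernel
  rw [sumOver_points (isCodes_sound h.1) h.2.1, h.2.2]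

/-! ### Lines of the developments -/

/-- The lines through `0` of the development. -/
def linesThroughZero (bs : List (List ℕ)) : List (List ℕ) :=
  bs.flatMap fun b => b.map fun q => b.map fun x => subCode x q

/-- The first of the lists whose mask contains the bit `d`. -/
def firstThrough (d : ℕ) (ls : List (List ℕ)) : List ℕ :=
  List.rec [] (fun l _ ih => ifZero (Nat.land (Nat.shiftRight (maskOf l) d) 1) ih l) ls

theorem firstThrough_mem {d : ℕ} {ls : List (List ℕ)} (h : ∃ l ∈ ls, d ∈ l) :
    firstThrough d ls ∈ ls ∧ d ∈ firstThrough d ls := by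
  induction ls with
  | nil => simp at h
  | cons l ls ih =>
    have e : firstThrough d (l :: ls) =
      ifZero (Nat.land (Nat.shiftRight (maskOf l) d) 1) (firstThrough d ls) l := rfl
    have hb : Nat.land (Nat.shiftRight (maskOf l) d) 1 = ((maskOf l).testBit d).toNat := by
      rw [raw_and, raw_shiftRight, Nat.and_one_is_mod, Nat.testBit_eq_decide_div_mod_eq,
        Nat.shiftRight_eq_div_pow]
      rcases Nat.mod_two_eq_zero_or_one (maskOf l / 2 ^ d) with h | h <;> simp [h]
    by_cases hd : d ∈ l
    · rw [(testBit_maskOf l d).mpr hd] at hb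
      rw [e, hb]
      exact ⟨List.mem_cons_self, hd⟩
    · have : (maskOf l).testBit d = false := by
        rw [← Bool.not_eq_true, testBit_maskOf]; exact hd
      rw [this] at hb
      obtain ⟨h1, h2⟩ := ih (by
        obtain ⟨l', h1, h2⟩ := h
        rcases List.mem_cons.mp h1 with rfl | h1
        · exact absurd h2 hd
        · exact ⟨l', h1, h2⟩)
      rw [e, hb]
      exact ⟨List.mem_cons_of_mem _ h1, h2⟩

/-- The line through `0` and the element with number `d`. -/
def lineZero (i : Fin 14) (d : ℕ) : List ℕ :=
  memo (fun d => firstThrough d (linesThroughZero (listedCodes i))) d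

/-- The mask of the line through `0` and the element with number `d`. -/
def maskZero (i : Fin 14) (d : ℕ) : ℕ := memo (fun d => maskOf (lineZero i d)) d

/-- The mask of the line through the elements with numbers `a` and `b`, where
`k = 162 * a + b`. -/
def maskThrough (i : Fin 14) (k : ℕ) : ℕ :=
  (fun a b => foldMask (Nat.shiftLeft (maskZero i (subCode b a)) (Nat.sub 171 (subCode 0 a))))
    (Nat.div k 162) (Nat.mod k 162)

/-- The number of the sum of the elements with numbers `a` and `b`, where `k = 162 * a + b`. -/
def addCode (k : ℕ) : ℕ := reduceCode (Nat.add (Nat.div k 162) (Nat.mod k 162))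

/-- Apply a function to the elements of a list. -/
def mapOver (l : List ℕ) (f : ℕ → ℕ) : List ℕ := List.rec [] (fun a _ ih => f a :: ih) l

theorem mapOver_eq (l : List ℕ) (f : ℕ → ℕ) : mapOver l f = l.map f := by
  induction l with
  | nil => rfl
  | cons a l ih => rw [List.map_cons, ← ih]; rfl

/-- The line through the elements with numbers `a` and `b`. -/
def lineBetween (i : Fin 14) (a b : ℕ) : List ℕ :=
  mapOver (lineZero i (subCode b a)) fun w => memo addCode (Nat.add (Nat.mul 162 a) w)

theorem addCode_code (x y : G) :
    memo addCode (Nat.add (Nat.mul 162 (code x)) (code y)) = code (y + x) := by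
  have h1 : Nat.div (Nat.add (Nat.mul 162 (code x)) (code y)) 162 = code x := by
    have := code_lt y
    rw [raw_div, raw_add, raw_mul]; omega
  have h2 : Nat.mod (Nat.add (Nat.mul 162 (code x)) (code y)) 162 = code y := by
    have := code_lt y
    rw [raw_mod, raw_add, raw_mul]; omega
  obtain ⟨c, hc, e⟩ := code_shift (y + x) y
  rw [add_sub_cancel_left] at e
  rw [memo_eq, addCode, h1, h2, raw_add]
  have h : ∀ c', (c' = 0 ∨ c' = 9 ∨ c' = 162 ∨ c' = 171) → code x + code y = code (y + x) + c' →
      reduceCode (code x + code y) = code (y + x) := fun c' hc' e' => by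
    rw [e', reduceCode_add _ hc']
  -- The complement `171 - c` of a carry is again a carry.
  exact h (171 - c) (by omega) (by omega)

section Line

variable (i : Fin 14)

theorem lineThrough_comm {V : Type*} [DecidableEq V] (𝓑 : Finset (Finset V)) (x y : V) :
    lineThrough 𝓑 x y = lineThrough 𝓑 y x := by
  ext p; simp only [mem_lineThrough]
  exact ⟨fun ⟨B, h1, h2, h3, h4⟩ => ⟨B, h1, h3, h2, h4⟩,
    fun ⟨B, h1, h2, h3, h4⟩ => ⟨B, h1, h3, h2, h4⟩⟩

theorem lineThrough_eq {B : Finset G} (hB : B ∈ development (listedFamily i)) {x y : G}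
    (hxy : x ≠ y) (hx : x ∈ B) (hy : y ∈ B) : lineThrough (development (listedFamily i)) x y = B := by
  ext p
  rw [mem_lineThrough]
  constructor
  · rintro ⟨C, hC, hx', hy', hp⟩
    rwa [((isCover_listedFamily i).existsUnique hxy).unique ⟨hB, hx, hy⟩ ⟨hC, hx', hy'⟩]
  · exact fun hp => ⟨B, hB, hx, hy, hp⟩

theorem lineThrough_mem {x y : G} (hxy : x ≠ y) :
    lineThrough (development (listedFamily i)) x y ∈ development (listedFamily i) := by
  obtain ⟨B, ⟨hB, hx, hy⟩, -⟩ := (isCover_listedFamily i).existsUnique hxy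
  rwa [lineThrough_eq i hB hxy hx hy]

theorem left_mem_lineThrough {x y : G} (hxy : x ≠ y) :
    x ∈ lineThrough (development (listedFamily i)) x y := by
  obtain ⟨B, ⟨hB, hx, hy⟩, -⟩ := (isCover_listedFamily i).existsUnique hxy
  rwa [lineThrough_eq i hB hxy hx hy]

theorem right_mem_lineThrough {x y : G} (hxy : x ≠ y) :
    y ∈ lineThrough (development (listedFamily i)) x y := by
  rw [lineThrough_comm]
  exact left_mem_lineThrough i hxy.symm

theorem lineThrough_translate {x y : G} (hxy : x ≠ y) :
    lineThrough (development (listedFamily i)) x y =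
      (lineThrough (development (listedFamily i)) 0 (y - x)).image fun w => w + x := by
  have h : (0 : G) ≠ y - x := (sub_ne_zero.mpr hxy.symm).symm
  apply lineThrough_eq i (image_add_mem_development (lineThrough_mem i h) x) hxy
  · exact Finset.mem_image.mpr ⟨0, left_mem_lineThrough i h, zero_add x⟩
  · exact Finset.mem_image.mpr ⟨_, right_mem_lineThrough i h, sub_add_cancel y x⟩

theorem linesThroughZero_spec {l : List ℕ} (hl : l ∈ linesThroughZero (listedCodes i)) :
    IsCodes l ∧ l.length = 5 ∧ points l ∈ development (listedFamily i) ∧ 0 ∈ points l := by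
  obtain ⟨b, hb, hl⟩ := List.mem_flatMap.mp hl
  obtain ⟨q, hq, rfl⟩ := List.mem_map.mp hl
  have hc := isCodes_listedCodes i b hb
  obtain ⟨q, rfl⟩ := hc q hq
  have e : points (b.map fun x => subCode x (code q)) = (points b).image fun x => x + -q := by
    ext y
    simp only [mem_points, Finset.mem_image, List.mem_map]
    constructor
    · rintro ⟨_, ⟨m, hm, rfl⟩, rfl⟩
      obtain ⟨x, rfl⟩ := hc m hm
      exact ⟨_, ⟨_, hm, rfl⟩, by rw [subCode_code, point_code, point_code, sub_eq_add_neg]⟩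
    · rintro ⟨_, ⟨m, hm, rfl⟩, rfl⟩
      obtain ⟨x, rfl⟩ := hc m hm
      exact ⟨_, ⟨_, hm, rfl⟩, by rw [subCode_code, point_code, point_code, sub_eq_add_neg]⟩
  refine ⟨?_, ?_, ?_, ?_⟩
  · intro n hn
    obtain ⟨m, hm, rfl⟩ := List.mem_map.mp hn
    obtain ⟨x, rfl⟩ := hc m hm
    exact ⟨_, (subCode_code x q).symm⟩
  · rw [List.length_map, (length_listedCodes i b hb).1]
  · rw [e]
    apply image_add_mem_development
    refine mem_development.mpr ⟨points b, ?_, 0, by simp⟩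
    rw [listedFamily_eq]
    exact List.mem_map_of_mem hb
  · rw [e]
    exact Finset.mem_image.mpr ⟨q, mem_points.mpr ⟨_, hq, point_code q⟩, add_neg_cancel q⟩

theorem linesThroughZero_cover : ∀ i, ∀ d ∈ nonzeroCodes,
    (linesThroughZero (listedCodes i)).any (fun l => l.any fun w => Nat.beq w d) = true := by
  decide +kernel

theorem code_mem_nonzeroCodes {d : G} (hd : d ≠ 0) : code d ∈ nonzeroCodes := by
  have h : isCodes nonzeroCodes = true ∧ points nonzeroCodes = Finset.univ.erase 0 := by
    decide +kernel
  have hm : d ∈ points nonzeroCodes := by rw [h.2]; simp [hd]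
  obtain ⟨n, hn, rfl⟩ := mem_points.mp hm
  obtain ⟨x, rfl⟩ := isCodes_sound h.1 n hn
  rwa [point_code]

theorem nodup_of_card_points {l : List ℕ} (h : (points l).card = l.length) : l.Nodup := by
  refine List.Nodup.of_map point ?_
  rw [← Multiset.coe_nodup, ← Multiset.toFinset_card_eq_card_iff_nodup, Multiset.coe_card,
    List.length_map, ← h]
  rfl

theorem lineZero_spec {d : G} (hd : d ≠ 0) : IsCodes (lineZero i (code d)) ∧
    (lineZero i (code d)).Nodup ∧
      points (lineZero i (code d)) = lineThrough (development (listedFamily i)) 0 d := by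
  obtain ⟨l, hl, hd'⟩ := List.any_eq_true.mp (linesThroughZero_cover i _ (code_mem_nonzeroCodes hd))
  obtain ⟨w, hw, e⟩ := List.any_eq_true.mp hd'
  rw [Nat.eq_of_beq_eq_true e] at hw
  obtain ⟨h1, h2⟩ := firstThrough_mem ⟨l, hl, hw⟩
  rw [← memo_eq (fun d => firstThrough d (linesThroughZero (listedCodes i)))] at h1 h2
  change lineZero i (code d) ∈ _ at h1
  change _ ∈ lineZero i (code d) at h2
  obtain ⟨h3, h4, h5, h6⟩ := linesThroughZero_spec i h1
  refine ⟨h3, nodup_of_card_points ?_, ?_⟩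
  · rw [(isCover_listedFamily i).card_of_mem_development h5, h4]
  · exact (lineThrough_eq i h5 hd.symm h6 (mem_points.mpr ⟨_, h2, point_code d⟩)).symm

theorem isMask_maskOf {l : List ℕ} (hl : IsCodes l) : IsMask (maskOf l) (points l) := by
  intro n
  rw [testBit_maskOf]
  constructor
  · intro hn
    obtain ⟨x, rfl⟩ := hl n hn
    exact ⟨x, mem_points.mpr ⟨_, hn, point_code x⟩, rfl⟩
  · rintro ⟨x, hx, rfl⟩
    obtain ⟨n, hn, rfl⟩ := mem_points.mp hx
    obtain ⟨x, rfl⟩ := hl n hn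
    rwa [point_code]

theorem isMask_maskZero {d : G} (hd : d ≠ 0) :
    IsMask (maskZero i (code d)) (lineThrough (development (listedFamily i)) 0 d) := by
  obtain ⟨h1, -, h3⟩ := lineZero_spec i hd
  rw [maskZero, memo_eq, ← h3]
  exact isMask_maskOf h1

theorem subCode_zero (x : G) : subCode 0 (code x) = code (-x) := by
  have := subCode_code 0 x
  rwa [zero_sub] at this

theorem isMask_maskThrough {a b : G} (hab : a ≠ b) :
    IsMask (memo (maskThrough i) (Nat.add (Nat.mul 162 (code a)) (code b)))
      (lineThrough (development (listedFamily i)) a b) := by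
  have h1 : Nat.div (Nat.add (Nat.mul 162 (code a)) (code b)) 162 = code a := by
    have := code_lt b
    rw [raw_div, raw_add, raw_mul]; omega
  have h2 : Nat.mod (Nat.add (Nat.mul 162 (code a)) (code b)) 162 = code b := by
    have := code_lt b
    rw [raw_mod, raw_add, raw_mul]; omega
  rw [memo_eq, maskThrough, h1, h2]
  simp only [subCode_code, subCode_zero]
  rw [lineThrough_translate i hab]
  -- The line through `a` and `b` is the line through `0` and `b - a` moved by `a`, and this
  -- translation is a subtraction of `-a`.
  have := isMask_foldMask_shiftLeft (isMask_maskZero i (sub_ne_zero.mpr hab.symm)) (-a)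
  simp only [sub_neg_eq_add] at this
  exact this

theorem lineBetween_spec {a b : G} (hab : a ≠ b) : IsCodes (lineBetween i (code a) (code b)) ∧
    (lineBetween i (code a) (code b)).Nodup ∧
      points (lineBetween i (code a) (code b)) =
        lineThrough (development (listedFamily i)) a b := by
  obtain ⟨h1, h2, h3⟩ := lineZero_spec i (sub_ne_zero.mpr hab.symm)
  have h := addCode_code a
  rw [lineBetween, subCode_code, mapOver_eq]
  refine ⟨?_, ?_, ?_⟩
  · intro n hn
    obtain ⟨m, hm, rfl⟩ := List.mem_map.mp hn
    obtain ⟨x, rfl⟩ := h1 m hm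
    exact ⟨_, (h x).symm⟩
  · refine (List.nodup_map_iff_inj_on h2).mpr fun m hm n hn e => ?_
    obtain ⟨x, rfl⟩ := h1 m hm
    obtain ⟨y, rfl⟩ := h1 n hn
    rw [h, h, code_inj] at e
    rw [add_right_cancel e]
  · rw [lineThrough_translate i hab, ← h3]
    ext y
    simp only [mem_points, Finset.mem_image, List.mem_map]
    constructor
    · rintro ⟨_, ⟨m, hm, rfl⟩, rfl⟩
      obtain ⟨x, rfl⟩ := h1 m hm
      exact ⟨_, ⟨_, hm, rfl⟩, by rw [h, point_code, point_code]⟩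
    · rintro ⟨_, ⟨m, hm, rfl⟩, rfl⟩
      obtain ⟨x, rfl⟩ := h1 m hm
      exact ⟨_, ⟨_, hm, rfl⟩, by rw [h, point_code, point_code]⟩

theorem IsMask.and_eq_zero_iff {A B : ℕ} {S T : Finset G} (hA : IsMask A S) (hB : IsMask B T) :
    A &&& B = 0 ↔ Disjoint S T := by
  refine ⟨fun h => ?_, hA.eq_zero_of_disjoint hB⟩
  rw [Finset.disjoint_iff_inter_eq_empty, Finset.eq_empty_iff_forall_notMem]
  intro x hx
  have := ((hA.inter hB).testBit_code x).mpr hx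
  rw [h, Nat.zero_testBit] at this
  exact Bool.noConfusion this

/-! ### Counting -/

/-- The hyperbolic number of `0`, `x`, `y`, `p`, where `L` is the mask of the line through `0`
and `x`. -/
def countDisjoint (i : Fin 14) (L y p : ℕ) : ℕ :=
  (fun P => sumOver (lineZero i y) fun u =>
    ifZero (Nat.land (memo (maskThrough i) (Nat.add P u)) L) 1 0) (Nat.mul 162 p)

/-- The number of triples `(x, y, p)` for each hyperbolic number, in fields of `24` bits. -/
def packedFrequency (i : Fin 14) : ℕ :=
  sumOver nonzeroCodes fun x => (fun L => sumOver nonzeroCodes fun y =>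
    ifZero (Nat.land (Nat.shiftRight L y) 1)
      (sumOver (lineBetween i x y) fun p => ifZero (Nat.xor p x) 0 (ifZero (Nat.xor p y) 0
        (Nat.shiftLeft 1 (Nat.mul 24 (countDisjoint i L y p))))) 0) (maskZero i x)

theorem ifZero_land_shiftRight {α : Type} {M : ℕ} {S : Finset G} (hM : IsMask M S) (y : G)
    (a b : α) : ifZero (Nat.land (Nat.shiftRight M (code y)) 1) a b = if y ∈ S then b else a := by
  have h : Nat.land (Nat.shiftRight M (code y)) 1 = (M.testBit (code y)).toNat := by
    rw [raw_and, raw_shiftRight, Nat.and_one_is_mod, Nat.testBit_eq_decide_div_mod_eq,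
      Nat.shiftRight_eq_div_pow]
    rcases Nat.mod_two_eq_zero_or_one (M / 2 ^ code y) with h | h <;> simp [h]
  rw [h]
  by_cases hy : y ∈ S
  · rw [(hM.testBit_code y).mpr hy, if_pos hy]; rfl
  · rw [if_neg hy, Bool.eq_false_iff.mpr fun e => hy ((hM.testBit_code y).mp e)]; rfl

theorem ifZero_xor {α : Type} (x y : G) (a b : α) :
    ifZero (Nat.xor (code x) (code y)) a b = if x = y then a else b := by
  by_cases h : x = y
  · subst h; rw [if_pos rfl, raw_xor, Nat.xor_self, ifZero_zero]
  · rw [if_neg h, ifZero_of_ne]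
    rw [raw_xor, Ne, Nat.xor_eq_zero_iff]
    exact fun e => h (code_injective e)

theorem ifZero_eq_ite {α : Type} (n : ℕ) (a b : α) : ifZero n a b = if n = 0 then a else b := by
  cases n <;> rfl

/-- Since `p` is off the line through `0` and `y`, it differs from every `u` on it, as required for
`maskThrough` to give the line through `p` and `u`. -/
theorem countDisjoint_code {x y p : G} {L : ℕ}
    (hL : IsMask L (lineThrough (development (listedFamily i)) 0 x)) (hy : y ≠ 0)
    (hp : p ∉ lineThrough (development (listedFamily i)) 0 y) :
    countDisjoint i L (code y) (code p) =
      hyperbolicNumber (development (listedFamily i)) 0 x y p := by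
  obtain ⟨h1, h2, h3⟩ := lineZero_spec i hy
  rw [countDisjoint]
  beta_reduce
  rw [sumOver_points h1 h2, h3, hyperbolicNumber, Finset.card_filter]
  refine Finset.sum_congr rfl fun u hu => ?_
  have hpu : p ≠ u := fun e => hp (e ▸ hu)
  rw [ifZero_eq_ite, raw_and]
  exact if_congr ((isMask_maskThrough i hpu).and_eq_zero_iff hL) rfl rfl

/-- The triples that have a hyperbolic number together with `0`. -/
def IsTriangle (x y p : G) : Prop :=
  (¬ ∃ B ∈ development (listedFamily i), 0 ∈ B ∧ x ∈ B ∧ y ∈ B) ∧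
    p ∈ lineThrough (development (listedFamily i)) x y ∧ p ≠ x ∧ p ≠ y

instance (x y p : G) : Decidable (IsTriangle i x y p) := inferInstanceAs (Decidable (_ ∧ _))

theorem not_exists_iff {x y : G} :
    (¬ ∃ B ∈ development (listedFamily i), 0 ∈ B ∧ x ∈ B ∧ y ∈ B) ↔
      y ∉ lineThrough (development (listedFamily i)) 0 x :=
  not_congr mem_lineThrough.symm

/-- If `p` were on the line through `0` and `y`, this line would share the distinct points `p` and
`y` with the line through `x` and `y`; the two lines would coincide, and `0`, `x`, `y` would be on a
common block. -/
theorem IsTriangle.ne_zero {x y p : G} (h : IsTriangle i x y p) : x ≠ 0 ∧ y ≠ 0 ∧ x ≠ y ∧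
    p ∉ lineThrough (development (listedFamily i)) 0 y := by
  have key : ∀ z : G, ∃ B ∈ development (listedFamily i), 0 ∈ B ∧ z ∈ B := by
    intro z
    by_cases hz : z = 0
    · obtain ⟨B, ⟨h1, h2, -⟩, -⟩ := (isCover_listedFamily i).existsUnique
        (show (0 : G) ≠ (0, 1) by decide)
      exact ⟨B, h1, h2, hz ▸ h2⟩
    · obtain ⟨B, ⟨h1, h2, h3⟩, -⟩ := (isCover_listedFamily i).existsUnique (Ne.symm hz)
      exact ⟨B, h1, h2, h3⟩
  have hx : x ≠ 0 := by
    rintro rfl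
    obtain ⟨B, h1, h2, h3⟩ := key y
    exact h.1 ⟨B, h1, h2, h2, h3⟩
  have hy : y ≠ 0 := by
    rintro rfl
    obtain ⟨B, h1, h2, h3⟩ := key x
    exact h.1 ⟨B, h1, h2, h3, h2⟩
  have hxy : x ≠ y := by
    rintro rfl
    obtain ⟨B, h1, h2, h3⟩ := key x
    exact h.1 ⟨B, h1, h2, h3, h3⟩
  refine ⟨hx, hy, hxy, fun hp => h.1 ?_⟩
  have e : lineThrough (development (listedFamily i)) 0 y =
      lineThrough (development (listedFamily i)) x y := by
    rw [← lineThrough_eq i (lineThrough_mem i hy.symm) h.2.2.2 hp (right_mem_lineThrough i hy.symm),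
      ← lineThrough_eq i (lineThrough_mem i hxy) h.2.2.2 h.2.1 (right_mem_lineThrough i hxy)]
  exact ⟨_, lineThrough_mem i hxy, e ▸ left_mem_lineThrough i hy.symm, left_mem_lineThrough i hxy,
    right_mem_lineThrough i hxy⟩

/-- The degenerate triples left out of the lists, with `x = 0` or `y = 0`, contribute nothing,
because `0` and any further point lie on a common block. -/
theorem packedFrequency_eq : packedFrequency i = ∑ q : G × G × G,
    if IsTriangle i q.1 q.2.1 q.2.2 then
      2 ^ (24 * hyperbolicNumber (development (listedFamily i)) 0 q.1 q.2.1 q.2.2) else 0 := by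
  rw [packedFrequency, sumOver_nonzeroCodes, Fintype.sum_prod_type,
    ← Finset.add_sum_erase Finset.univ _ (Finset.mem_univ (0 : G))]
  have h0 : ∀ x y p : G, (x = 0 ∨ y = 0) → (if IsTriangle i x y p then
      2 ^ (24 * hyperbolicNumber (development (listedFamily i)) 0 x y p) else 0) = 0 := by
    intro x y p hxy
    rw [if_neg]
    intro h
    rcases hxy with hxy | hxy
    · exact h.ne_zero.1 hxy
    · exact h.ne_zero.2.1 hxy
  rw [Finset.sum_eq_zero (s := (Finset.univ : Finset (G × G))) fun q _ =>
    h0 0 q.1 q.2 (Or.inl rfl), zero_add]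
  refine Finset.sum_congr rfl fun x hx => ?_
  have hx : x ≠ 0 := Finset.ne_of_mem_erase hx
  beta_reduce
  rw [sumOver_nonzeroCodes, Fintype.sum_prod_type,
    ← Finset.add_sum_erase Finset.univ _ (Finset.mem_univ (0 : G)),
    Finset.sum_eq_zero (s := (Finset.univ : Finset G)) fun p _ => h0 x 0 p (Or.inr rfl), zero_add]
  refine Finset.sum_congr rfl fun y hy => ?_
  have hy : y ≠ 0 := Finset.ne_of_mem_erase hy
  have hL := isMask_maskZero i hx
  rw [ifZero_land_shiftRight hL]
  by_cases hxy : y ∈ lineThrough (development (listedFamily i)) 0 x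
  · rw [if_pos hxy, Finset.sum_eq_zero]
    intro p _
    rw [if_neg]
    exact fun h => (not_exists_iff i).mp h.1 hxy
  · rw [if_neg hxy]
    have hne : x ≠ y := by rintro rfl; exact hxy (right_mem_lineThrough i hx.symm)
    obtain ⟨h1, h2, h3⟩ := lineBetween_spec i hne
    rw [sumOver_points h1 h2, h3,
      ← Finset.sum_subset (Finset.subset_univ (lineThrough (development (listedFamily i)) x y))]
    · refine Finset.sum_congr rfl fun p hp => ?_
      rw [ifZero_xor, ifZero_xor]
      by_cases hpx : p = x
      · rw [if_pos hpx, if_neg fun h : IsTriangle i x y p => h.2.2.1 hpx]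
      by_cases hpy : p = y
      · rw [if_neg hpx, if_pos hpy, if_neg fun h : IsTriangle i x y p => h.2.2.2 hpy]
      have ht : IsTriangle i x y p := ⟨(not_exists_iff i).mpr hxy, hp, hpx, hpy⟩
      rw [if_neg hpx, if_neg hpy, if_pos ht, countDisjoint_code i hL hy ht.ne_zero.2.2.2,
        raw_shiftLeft, Nat.shiftLeft_eq, one_mul]
      rfl
    · intro p _ hp
      rw [if_neg fun h : IsTriangle i x y p => hp h.2.1]

/-- A line has five points. This crude bound suffices to limit the number of fields to six. -/
theorem hyperbolicNumber_le {x y p : G} (h : IsTriangle i x y p) :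
    hyperbolicNumber (development (listedFamily i)) 0 x y p ≤ 5 := by
  refine (Finset.card_filter_le _ _).trans ?_
  rw [(isCover_listedFamily i).card_of_mem_development (lineThrough_mem i h.ne_zero.2.1.symm)]

theorem sum_ite_eq_sum_card_mul {α : Type} [Fintype α] (P : α → Prop) [DecidablePred P]
    (Q : ℕ → α → Prop) [∀ n, DecidablePred (Q n)] {g : α → ℕ} (f : ℕ → ℕ) {m : ℕ}
    (h : ∀ q, P q → g q < m) (hQ : ∀ n q, Q n q ↔ P q ∧ g q = n) :
    ∑ q, (if P q then f (g q) else 0) =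
      ∑ n ∈ Finset.range m, (Finset.univ.filter (Q n)).card * f n := by
  rw [← Finset.sum_filter, ← Finset.sum_fiberwise_of_maps_to (t := Finset.range m) (g := g)
    fun q hq => Finset.mem_range.mpr (h q (Finset.mem_filter.mp hq).2)]
  refine Finset.sum_congr rfl fun n _ => ?_
  rw [Finset.sum_congr rfl fun q hq => congrArg f (Finset.mem_filter.mp hq).2, Finset.sum_const,
    smul_eq_mul, Finset.filter_filter]
  congr 2
  exact Finset.filter_congr fun q _ => (hQ n q).symm

theorem isHyperbolic_iff (n : ℕ) (x y p : G) :
    IsHyperbolic (development (listedFamily i)) n 0 x y p ↔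
      IsTriangle i x y p ∧ hyperbolicNumber (development (listedFamily i)) 0 x y p = n := by
  simp only [IsHyperbolic, IsTriangle, and_assoc]

theorem packedFrequency_eq_sum : packedFrequency i = ∑ n ∈ Finset.range 6,
    (Finset.univ.filter fun q : G × G × G =>
      IsHyperbolic (development (listedFamily i)) n 0 q.1 q.2.1 q.2.2).card * 2 ^ (24 * n) := by
  rw [packedFrequency_eq]
  exact sum_ite_eq_sum_card_mul _ _ (fun n => 2 ^ (24 * n))
    (fun q hq => Nat.lt_succ_of_le (hyperbolicNumber_le i hq))
    fun n q => isHyperbolic_iff i n q.1 q.2.1 q.2.2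

/-- There are only 81³ triples, so no field of 24 bits overflows and the counts are the digits of
`packedFrequency` in base `2 ^ 24`. -/
theorem card_isHyperbolic_lt (n : ℕ) : (Finset.univ.filter fun q : G × G × G =>
    IsHyperbolic (development (listedFamily i)) n 0 q.1 q.2.1 q.2.2).card < 2 ^ 24 := by
  refine (Finset.card_filter_le _ _).trans_lt ?_
  rw [Finset.card_univ, Fintype.card_prod, Fintype.card_prod, Fintype.card_prod, ZMod.card]
  norm_num

end Line

/-! ### Hyperbolic frequencies -/

/-- The value of `packedFrequency` that corresponds to the listed frequencies. -/
def listedPackedFrequency (i : Fin 14) : ℕ :=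
  (fun l => l.getD 0 0 / 81 + 2 ^ 24 * (l.getD 1 0 / 81) + 2 ^ 48 * (l.getD 2 0 / 81) +
    2 ^ 72 * (l.getD 3 0 / 81)) (listedFrequency i)

theorem packedFrequency_zero_to_three : ∀ i ∈ [0, 1, 2, 3],
    packedFrequency i = listedPackedFrequency i := by
  decide +kernel

theorem packedFrequency_four_to_seven : ∀ i ∈ [4, 5, 6, 7],
    packedFrequency i = listedPackedFrequency i := by
  decide +kernel

theorem packedFrequency_eight_to_ten : ∀ i ∈ [8, 9, 10],
    packedFrequency i = listedPackedFrequency i := by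
  decide +kernel

theorem packedFrequency_eleven_to_thirteen : ∀ i ∈ [11, 12, 13],
    packedFrequency i = listedPackedFrequency i := by
  decide +kernel

theorem packedFrequency_eq_listed (i : Fin 14) :
    packedFrequency i = listedPackedFrequency i := by
  have h : ∀ i : Fin 14, i ∈ [0, 1, 2, 3] ∨ i ∈ [4, 5, 6, 7] ∨ i ∈ [8, 9, 10] ∨
      i ∈ [11, 12, 13] := by
    decide
  rcases h i with h | h | h | h
  · exact packedFrequency_zero_to_three i h
  · exact packedFrequency_four_to_seven i h
  · exact packedFrequency_eight_to_ten i h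
  · exact packedFrequency_eleven_to_thirteen i h

/-- Divisibility by 81, the number of choices of the first point, makes the divisions in
`listedPackedFrequency` exact. -/
theorem listedFrequency_spec : ∀ i, (listedFrequency i).length = 4 ∧
    ∀ k < 4, 81 ∣ (listedFrequency i).getD k 0 ∧ (listedFrequency i).getD k 0 < 2 ^ 24 := by
  decide +kernel

theorem hyperbolicFrequency_listedFamily (i : Fin 14) (n : ℕ) :
    hyperbolicFrequency (development (listedFamily i)) n = (listedFrequency i).getD n 0 := by
  rw [hyperbolicFrequency_development]
  obtain ⟨h1, h2⟩ := listedFrequency_spec i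
  have h3 := packedFrequency_eq_sum i
  have h4 := card_isHyperbolic_lt i
  have h5 : ∀ n, 6 ≤ n → (Finset.univ.filter fun q : G × G × G =>
      IsHyperbolic (development (listedFamily i)) n 0 q.1 q.2.1 q.2.2).card = 0 := by
    intro n hn
    rw [Finset.card_eq_zero, Finset.filter_eq_empty_iff]
    intro q _ hq
    obtain ⟨h6, h7⟩ := (isHyperbolic_iff i n q.1 q.2.1 q.2.2).mp hq
    have := hyperbolicNumber_le i h6
    omega
  rw [packedFrequency_eq_listed] at h3
  obtain ⟨c, hc⟩ : ∃ c : ℕ → ℕ, ∀ n, (Finset.univ.filter fun q : G × G × G =>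
      IsHyperbolic (development (listedFamily i)) n 0 q.1 q.2.1 q.2.2).card = c n :=
    ⟨_, fun _ => rfl⟩
  simp only [hc] at h3 h4 h5 ⊢
  simp only [Finset.sum_range_succ, Finset.sum_range_zero, listedPackedFrequency] at h3
  -- From here on the digits of two equal numbers in base `2 ^ 24` are compared; the digits in
  -- positions 4 and 5 vanish because `listedPackedFrequency` fills only four fields.
  norm_num at h3 h4
  have g0 := h2 0 (by omega)
  have g1 := h2 1 (by omega)
  have g2 := h2 2 (by omega)
  have g3 := h2 3 (by omega)
  generalize (listedFrequency i) = l at *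
  have c0 := h4 0
  have c1 := h4 1
  have c2 := h4 2
  have c3 := h4 3
  have c4 := h4 4
  have c5 := h4 5
  have hn : n = 0 ∨ n = 1 ∨ n = 2 ∨ n = 3 ∨ 4 ≤ n := by omega
  simp only [← List.getD_eq_getElem?_getD] at h3
  rcases hn with rfl | rfl | rfl | rfl | hn
  · omega
  · omega
  · omega
  · omega
  · rw [List.getD_eq_default _ _ (by omega)]
    have hn : n = 4 ∨ n = 5 ∨ 6 ≤ n := by omega
    rcases hn with rfl | rfl | hn
    · omega
    · omega
    · rw [h5 n hn]

/-! ### The fourteen families are distinguished by their developments. -/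

theorem listedFrequency_injective : ∀ i j : Fin 14, i ≠ j →
    listedFrequency i ≠ listedFrequency j := by
  decide +kernel

theorem not_designIsomorphic {i j : Fin 14} (hij : i ≠ j) :
    ¬ DesignIsomorphic (development (listedFamily i)) (development (listedFamily j)) := by
  intro h
  apply listedFrequency_injective i j hij
  have e : ∀ n, (listedFrequency i).getD n 0 = (listedFrequency j).getD n 0 := fun n => by
    rw [← hyperbolicFrequency_listedFamily, ← hyperbolicFrequency_listedFamily,
      hyperbolicFrequency_eq_of_designIsomorphic h]
  apply List.ext_getElem
  · rw [(listedFrequency_spec i).1, (listedFrequency_spec j).1]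
  · intro n h1 h2
    rw [← List.getD_eq_getElem _ 0 h1, ← List.getD_eq_getElem _ 0 h2, e]

theorem DesignIsomorphic.symm_trans {𝓐 𝓑 𝓒 : Finset (Finset G)} (h1 : DesignIsomorphic 𝓐 𝓒)
    (h2 : DesignIsomorphic 𝓑 𝓒) : DesignIsomorphic 𝓐 𝓑 := by
  obtain ⟨e, rfl⟩ := h1
  obtain ⟨f, hf⟩ := h2
  refine ⟨e.trans f.symm, ?_⟩
  have key : (fun B : Finset G => B.image (e.trans f.symm)) =
      (fun B => B.image f.symm) ∘ fun B => B.image e := by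
    funext B
    rw [Function.comp, Finset.image_image]
    rfl
  rw [key, ← Finset.image_image, ← hf, Finset.image_image]
  conv_rhs => rw [← Finset.image_id (s := 𝓑)]
  congr 1
  funext B
  rw [Function.comp, Finset.image_image]
  conv_rhs => rw [id, ← Finset.image_id (s := B)]
  congr 1
  funext x
  exact f.symm_apply_apply x

/-- For uniqueness, two listed families equivalent to `F` would both have developments isomorphic to
that of `F`, against `not_designIsomorphic`. -/
theorem existsUnique_multiplierEquivalent {F : Multiset (Finset G)}
    (hF : IsDifferenceFamily 5 1 F) : ∃! i : Fin 14, MultiplierEquivalent (listedFamily i) F := by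
  obtain ⟨i, φ, hφ⟩ := isListed_of_isCover (isCover_of_isDifferenceFamily hF)
  refine ⟨i, ⟨φ, hφ⟩, ?_⟩
  rintro j ⟨ψ, hψ⟩
  by_contra hij
  exact not_designIsomorphic hij (DesignIsomorphic.symm_trans (designIsomorphic_development hψ)
    (designIsomorphic_development hφ))

end Z9

theorem mainTheorem7 :
    (∀ i : Fin 14, IsDifferenceFamily 5 1 (listedFamily i)) ∧
    (∀ F : Multiset (Finset (ZMod 9 × ZMod 9)), IsDifferenceFamily 5 1 F →
      ∃! i : Fin 14, MultiplierEquivalent (listedFamily i) F) ∧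
    (∀ i : Fin 14, automorphismMultiplier (listedFamily i) = listedMultiplier i) ∧
    (∀ i : Fin 14, IsSteinerSystem 2 5 81 (development (listedFamily i))) ∧
    (∀ (i : Fin 14) (n : ℕ),
      hyperbolicFrequency (development (listedFamily i)) n = (listedFrequency i).getD n 0) ∧
    (∀ i j : Fin 14, i ≠ j →
      ¬ DesignIsomorphic (development (listedFamily i)) (development (listedFamily j))) :=
  ⟨Z9.isDifferenceFamily_listedFamily, fun _ => Z9.existsUnique_multiplierEquivalent,
    Z9.automorphismMultiplier_listedFamily, fun i => (Z9.isCover_listedFamily i).isSteinerSystem,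
    Z9.hyperbolicFrequency_listedFamily, fun _ _ => Z9.not_designIsomorphic⟩
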